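/- Let $n,m\ge 1$, and let $G_{m,n+1}$ be the Grassmann manifold of oriented $m$-dimensional linear subspaces of $\mathbb{R}^{n+m+1}$. For $P,Q\in G_{m,n+1}$ with oriented orthonormal bases $(e_i)$, $(f_j)$ put $$w(P,Q)=\langle e_1\wedge\cdots\wedge e_m,\ f_1\wedge\cdots\wedge f_m\rangle=\det\big(\langle e_i,f_j\rangle\big),$$ and call $P$ and $Q$ S-orthogonal if $\dim(P\cap Q)=m-1$ and $w(P,Q)=0$. Let $M^n$ be a compact, connected, oriented (immersed, smooth) minimal submanifold of the unit sphere $S^{n+m}\subset\mathbb{R}^{n+m+1}$, and let $\gamma^N:M\to G_{m,n+1}$, $x\mapsto N_xM$, be its normal Gauss map, where the normal space $N_xM$ of $M$ in $S^{n+m}$ is translated to the origin of $\mathbb{R}^{n+m+1}$ and carries the orientation induced by those of $M$ and $S^{n+m}$. The rank of $\gamma^N$ at a point is the rank of its differential there, and $\operatorname{rank}(\gamma^N)\le 2$ means that this holds at every point. Let $P,Q\in G_{m,n+1}$ be S-orthogonal. Assume that for all $x\in M$, with $N=\gamma^N(x)$, $$w(N,P)^2+w(N,Q)^2>\begin{cases}0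 & \text{if } \operatorname{rank}(\gamma^N)\le 2,\\ \tfrac19 & \text{otherwise,}\end{cases}$$ and that there is no point $x\in M$ at which $w(N,Q)=0$ and $w(N,P)<0$. Then $M$ is an equator: its second fundamental form in $S^{n+m}$ vanishes identically, and its image is $S^{n+m}\cap V$ for some $(n+1)$-dimensional linear subspace $V\subset\mathbb{R}^{n+m+1}$. -/

import Mathlib

open scoped Manifold ContDiff InnerProductSpace Topology

noncomputable section

namespace BernsteinSphere

/-! ### Oriented Grassmann manifolds -/

/-- Orthonormal `k`-frames in `ℝ^N`. -/
abbrev Frame (k N : ℕ) : Type :=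
  {e : Fin k → EuclideanSpace ℝ (Fin N) // Orthonormal ℝ e}

/-- Matrix `(⟪e i, f j⟫)` of two `k`-tuples of vectors. -/
def gram {k N : ℕ} (e f : Fin k → EuclideanSpace ℝ (Fin N)) : Matrix (Fin k) (Fin k) ℝ :=
  Matrix.of fun i j => ⟪e i, f j⟫_ℝ

/-- The tuple with `i`-th entry `∑ j, A i j • e j`. -/
def rotate {k N : ℕ} (A : Matrix (Fin k) (Fin k) ℝ) (e : Fin k → EuclideanSpace ℝ (Fin N)) :
    Fin k → EuclideanSpace ℝ (Fin N) :=
  fun i => ∑ j, A i j • e j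

theorem rotate_one {k N : ℕ} (e : Fin k → EuclideanSpace ℝ (Fin N)) : rotate 1 e = e := by
  funext i
  simp [rotate, Matrix.one_apply]

theorem rotate_mul {k N : ℕ} (A B : Matrix (Fin k) (Fin k) ℝ)
    (e : Fin k → EuclideanSpace ℝ (Fin N)) : rotate (A * B) e = rotate A (rotate B e) := by
  funext i
  simp only [rotate, Matrix.mul_apply, Finset.sum_smul, Finset.smul_sum, smul_smul]
  rw [Finset.sum_comm]

/-- Two orthonormal frames represent the same oriented `k`-plane when they differ by a matrix
in `SO(k)`. -/
instance frameSetoid (k N : ℕ) : Setoid (Frame k N) where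
  r e f := ∃ A ∈ Matrix.specialOrthogonalGroup (Fin k) ℝ, f.1 = rotate A e.1
  iseqv :=
    { refl := fun e => ⟨1, one_mem _, (rotate_one e.1).symm⟩
      symm := by
        rintro e f ⟨A, hA, h⟩
        have hA' := Matrix.mem_specialOrthogonalGroup_iff.1 hA
        refine ⟨star A, Matrix.mem_specialOrthogonalGroup_iff.2 ⟨Unitary.star_mem hA'.1, ?_⟩, ?_⟩
        · rw [Matrix.star_eq_conjTranspose, Matrix.det_conjTranspose, hA'.2, star_one]
        · rw [h, ← rotate_mul, hA'.1.1, rotate_one]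
      trans := by
        rintro e f g ⟨A, hA, h⟩ ⟨B, hB, h'⟩
        exact ⟨B * A, mul_mem hB hA, by rw [h', h, rotate_mul]⟩ }

/-- The Grassmann manifold of oriented `k`-dimensional linear subspaces of `ℝ^N`. -/
def Grassmannian (k N : ℕ) : Type := Quotient (frameSetoid k N)

theorem gram_rotate {k N : ℕ} (A B : Matrix (Fin k) (Fin k) ℝ)
    (e f : Fin k → EuclideanSpace ℝ (Fin N)) :
    gram (rotate A e) (rotate B f) = A * gram e f * B.transpose := by
  ext i j
  simp only [gram, rotate, Matrix.of_apply, Matrix.mul_apply, Matrix.transpose_apply, sum_inner,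
    inner_sum, real_inner_smul_left, real_inner_smul_right, Finset.sum_mul]
  exact Finset.sum_congr rfl fun _ _ => Finset.sum_congr rfl fun _ _ => by ring

/-- `w(P, Q) = ⟨e₁ ∧ ⋯ ∧ e_k, f₁ ∧ ⋯ ∧ f_k⟩ = det (⟪e i, f j⟫)` for oriented orthonormal bases
`e` of `P` and `f` of `Q`. -/
def w {k N : ℕ} : Grassmannian k N → Grassmannian k N → ℝ :=
  Quotient.lift₂ (fun e f => (gram e.1 f.1).det) (by
    rintro e f e' f' ⟨A, hA, h⟩ ⟨B, hB, h'⟩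
    rw [h, h', gram_rotate, Matrix.det_mul, Matrix.det_mul, Matrix.det_transpose,
      (Matrix.mem_specialOrthogonalGroup_iff.1 hA).2,
      (Matrix.mem_specialOrthogonalGroup_iff.1 hB).2]
    simp)

theorem span_rotate_le {k N : ℕ} (A : Matrix (Fin k) (Fin k) ℝ)
    (e : Fin k → EuclideanSpace ℝ (Fin N)) :
    Submodule.span ℝ (Set.range (rotate A e)) ≤ Submodule.span ℝ (Set.range e) := by
  rw [Submodule.span_le]
  rintro _ ⟨i, rfl⟩
  exact Submodule.sum_mem _ fun j _ =>
    Submodule.smul_mem _ _ (Submodule.subset_span (Set.mem_range_self j))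

/-- The linear subspace underlying an oriented `k`-plane. -/
def toSubmodule {k N : ℕ} : Grassmannian k N → Submodule ℝ (EuclideanSpace ℝ (Fin N)) :=
  Quotient.lift (fun e => Submodule.span ℝ (Set.range e.1)) (by
    intro e f h
    have key : ∀ {e f : Frame k N}, e ≈ f →
        Submodule.span ℝ (Set.range f.1) ≤ Submodule.span ℝ (Set.range e.1) := by
      rintro e f ⟨A, _, h⟩
      rw [h]
      exact span_rotate_le A e.1
    exact le_antisymm (key (Setoid.symm h)) (key h))

/-- `P` and `Q` are S-orthogonal: `dim (P ∩ Q) = k - 1` and `w(P, Q) = 0`. -/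
def SOrthogonal {k N : ℕ} (P Q : Grassmannian k N) : Prop :=
  Module.finrank ℝ ↥(toSubmodule P ⊓ toSubmodule Q) + 1 = k ∧ w P Q = 0

/-- The Plücker embedding `P ↦ e₁ ∧ ⋯ ∧ e_k ∈ Λ^k ℝ^N`, in the coordinates of the standard basis
of `Λ^k ℝ^N`: the `k × k` minors of an oriented orthonormal basis. -/
def plucker {k N : ℕ} : Grassmannian k N → ((Fin k ↪o Fin N) → ℝ) :=
  Quotient.lift (fun e J => (Matrix.of fun i j => e.1 i (J j)).det) (by
    rintro e f ⟨A, hA, h⟩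
    funext J
    have : (Matrix.of fun i j => f.1 i (J j)) = A * Matrix.of fun i j => e.1 i (J j) := by
      ext i j
      simp [h, rotate, Matrix.mul_apply]
    rw [this, Matrix.det_mul, (Matrix.mem_specialOrthogonalGroup_iff.1 hA).2, one_mul])

/-! ### Oriented manifolds -/

/-- An orientation of the `n`-manifold `M`: an orientation of every tangent space which is locally
constant in the local trivializations of the tangent bundle. -/
structure ManifoldOrientation (n : ℕ) (M : Type*) [TopologicalSpace M]
    [ChartedSpace (EuclideanSpace ℝ (Fin n)) M] [IsManifold (𝓡 n) ∞ M] where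
  /-- the orientation of the tangent space at a point -/
  orient : ∀ x : M, Orientation ℝ (TangentSpace (𝓡 n) x) (Fin n)
  /-- local constancy -/
  locally_constant : ∀ x₀ : M, ∃ o₀ : Orientation ℝ (EuclideanSpace ℝ (Fin n)) (Fin n),
    ∀ᶠ x in 𝓝 x₀,
      ∀ hx : x ∈ (trivializationAt (EuclideanSpace ℝ (Fin n)) (TangentSpace (𝓡 n)) x₀).baseSet,
        Orientation.map (Fin n) ((trivializationAt (EuclideanSpace ℝ (Fin n))
          (TangentSpace (𝓡 n)) x₀).continuousLinearEquivAt ℝ x hx).toLinearEquiv (orient x) = o₀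

/-! ### Immersed submanifolds of the sphere -/

section Immersion

variable {n m : ℕ} {M : Type*} [TopologicalSpace M] [ChartedSpace (EuclideanSpace ℝ (Fin n)) M]

/-- The differential of `f : M → ℝ^{n+m+1}` at `x`. -/
def differential (f : M → EuclideanSpace ℝ (Fin (n + m + 1))) (x : M) :
    TangentSpace (𝓡 n) x →ₗ[ℝ] EuclideanSpace ℝ (Fin (n + m + 1)) :=
  (mfderiv (𝓡 n) 𝓘(ℝ, EuclideanSpace ℝ (Fin (n + m + 1))) f x).toLinearMap

/-- `f` is a smooth immersion of `M` into the unit sphere `S^{n+m} ⊂ ℝ^{n+m+1}`. -/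
structure IsSphereImmersion (f : M → EuclideanSpace ℝ (Fin (n + m + 1))) : Prop where
  contMDiff : ContMDiff (𝓡 n) 𝓘(ℝ, EuclideanSpace ℝ (Fin (n + m + 1))) ∞ f
  norm_eq_one : ∀ x, ‖f x‖ = 1
  injective : ∀ x, Function.Injective (differential f x)

/-- The normal space `N_x M` of `M` in `S^{n+m}`, translated to the origin of `ℝ^{n+m+1}`: the
vectors orthogonal to the position vector `f x` and to the tangent space. -/
def normalSpace (f : M → EuclideanSpace ℝ (Fin (n + m + 1))) (x : M) :
    Submodule ℝ (EuclideanSpace ℝ (Fin (n + m + 1))) :=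
  (Submodule.span ℝ {f x} ⊔ LinearMap.range (differential f x))ᗮ

/-- The second fundamental form `B(u, v)` of `M` in `S^{n+m}` at `x`: the component in `N_x M`
of the second derivative of `f`, taken in the chart at `x` (in which `T_x M = ℝ^n`). -/
def secondFundamentalForm (f : M → EuclideanSpace ℝ (Fin (n + m + 1))) (x : M)
    (u v : TangentSpace (𝓡 n) x) : EuclideanSpace ℝ (Fin (n + m + 1)) :=
  (normalSpace f x).starProjection
    (fderiv ℝ (fderiv ℝ (f ∘ (extChartAt (𝓡 n) x).symm)) (extChartAt (𝓡 n) x x) u v)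

/-- The `i`-th coordinate vector of the chart at `x`. -/
def coordVector (x : M) (i : Fin n) : TangentSpace (𝓡 n) x :=
  (EuclideanSpace.single i (1 : ℝ) : EuclideanSpace ℝ (Fin n))

/-- The induced metric `g_{ij} = ⟪∂_i f, ∂_j f⟫` at `x`, in the chart at `x`. -/
def metricMatrix (f : M → EuclideanSpace ℝ (Fin (n + m + 1))) (x : M) :
    Matrix (Fin n) (Fin n) ℝ :=
  Matrix.of fun i j =>
    ⟪differential f x (coordVector x i), differential f x (coordVector x j)⟫_ℝ

/-- The mean curvature vector `H = ∑ g^{ij} B(∂_i, ∂_j)`, the trace of the second fundamental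
form with respect to the induced metric. -/
def meanCurvature (f : M → EuclideanSpace ℝ (Fin (n + m + 1))) (x : M) :
    EuclideanSpace ℝ (Fin (n + m + 1)) :=
  ∑ i, ∑ j, (metricMatrix f x)⁻¹ i j •
    secondFundamentalForm f x (coordVector x i) (coordVector x j)

theorem inner_differential {f : M → EuclideanSpace ℝ (Fin (n + m + 1))} (hf : IsSphereImmersion f)
    (x : M) (u : TangentSpace (𝓡 n) x) : ⟪f x, differential f x u⟫_ℝ = 0 := by
  have h := (hf.contMDiff.mdifferentiableAt (x := x) (by simp)).hasMFDerivAt.2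
  have h2 := h.norm_sq
  have hc : (fun y => ‖writtenInExtChartAt (𝓡 n) 𝓘(ℝ, EuclideanSpace ℝ (Fin (n + m + 1))) x f y‖ ^ 2)
      = fun _ => (1 : ℝ) := by
    funext y
    simp only [writtenInExtChartAt, extChartAt_model_space_eq_id, PartialEquiv.refl_coe,
      Function.comp_apply, id_eq, hf.norm_eq_one, one_pow]
  rw [hc] at h2
  simp only [ModelWithCorners.range_eq_univ, hasFDerivWithinAt_univ] at h2
  have h3 := congrArg (fun L => L u) (h2.unique (hasFDerivAt_const _ _))
  simp only [writtenInExtChartAt, extChartAt_model_space_eq_id, PartialEquiv.refl_coe,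
    Function.comp_apply, id_eq, extChartAt_to_inv] at h3
  change (2 : ℕ) • ⟪f x, differential f x u⟫_ℝ = 0 at h3
  simpa using h3

variable [IsManifold (𝓡 n) ∞ M]

/-- `ν` is a positively oriented orthonormal basis of the normal space `N_x M`: for a positively
oriented basis `b` of `T_x M`, the basis `(f x, df b₁, …, df b_n, ν₁, …, ν_m)` of `ℝ^{n+m+1}` is
positively oriented. -/
def IsOrientedNormalFrame (o : ManifoldOrientation n M)
    (f : M → EuclideanSpace ℝ (Fin (n + m + 1))) (x : M) (ν : Frame m (n + m + 1)) : Prop :=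
  (∀ i, ν.1 i ∈ normalSpace f x) ∧
    ∃ b : Module.Basis (Fin n) ℝ (TangentSpace (𝓡 n) x), b.orientation = o.orient x ∧
      0 < (EuclideanSpace.basisFun (Fin (n + m + 1)) ℝ).toBasis.det
        (Fin.cons (f x) (Fin.append (fun i => differential f x (b i)) ν.1))

theorem exists_orientedNormalFrame [NeZero n] [NeZero m] (o : ManifoldOrientation n M)
    {f : M → EuclideanSpace ℝ (Fin (n + m + 1))} (hf : IsSphereImmersion f) (x : M) :
    ∃ ν : Frame m (n + m + 1), IsOrientedNormalFrame o f x ν := by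
  have hn : 0 < n := Nat.pos_of_ne_zero (NeZero.ne n)
  have hm : 0 < m := Nat.pos_of_ne_zero (NeZero.ne m)
  -- a positively oriented basis of the tangent space
  obtain ⟨b, hb⟩ : ∃ b : Module.Basis (Fin n) ℝ (TangentSpace (𝓡 n) x),
      b.orientation = o.orient x :=
    ⟨Module.Basis.adjustToOrientation
      (EuclideanSpace.basisFun (Fin n) ℝ).toBasis (o.orient x),
      Module.Basis.orientation_adjustToOrientation _ _⟩
  have hli : LinearIndependent ℝ (fun i => differential f x (b i)) :=
    b.linearIndependent.map' _ (LinearMap.ker_eq_bot.2 (hf.injective x))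
  have hfx : f x ≠ 0 := by
    intro h
    have := hf.norm_eq_one x
    simp [h] at this
  have hrange : ∀ y ∈ LinearMap.range (differential f x), ⟪f x, y⟫_ℝ = 0 := by
    rintro _ ⟨u, rfl⟩
    exact inner_differential hf x u
  have hspan : Submodule.span ℝ (Set.range fun i => differential f x (b i)) =
      LinearMap.range (differential f x) := by
    rw [LinearMap.range_eq_map, ← b.span_eq, Submodule.map_span, ← Set.range_comp]
    rfl
  have hnot : f x ∉ Submodule.span ℝ (Set.range fun i => differential f x (b i)) := by
    rw [hspan]
    intro h
    exact hfx (inner_self_eq_zero.1 (hrange _ h))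
  have hcons : LinearIndependent ℝ
      (Fin.cons (f x) (fun i => differential f x (b i)) : Fin (n + 1) → _) :=
    linearIndependent_finCons.2 ⟨hli, hnot⟩
  have hspan' : Submodule.span ℝ
      (Set.range (Fin.cons (f x) (fun i => differential f x (b i)) : Fin (n + 1) → _)) =
      Submodule.span ℝ {f x} ⊔ LinearMap.range (differential f x) := by
    rw [Fin.range_cons, Submodule.span_insert, hspan]
  have hdim : Module.finrank ℝ
      ↥(Submodule.span ℝ {f x} ⊔ LinearMap.range (differential f x)) = n + 1 := by
    rw [← hspan', finrank_span_eq_card hcons, Fintype.card_fin]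
  have hdimN : Module.finrank ℝ (normalSpace f x) = m := by
    have := Submodule.finrank_add_finrank_orthogonal
      (Submodule.span ℝ {f x} ⊔ LinearMap.range (differential f x))
    rw [hdim, finrank_euclideanSpace_fin] at this
    unfold normalSpace
    omega
  let β : OrthonormalBasis (Fin m) ℝ (normalSpace f x) :=
    (stdOrthonormalBasis ℝ (normalSpace f x)).reindex (finCongr hdimN)
  have hβ : Orthonormal ℝ (fun i => (β i : EuclideanSpace ℝ (Fin (n + m + 1)))) :=
    β.orthonormal.comp_linearIsometry (normalSpace f x).subtypeₗᵢ
  -- the combined family is a basis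
  set t : (Fin m → EuclideanSpace ℝ (Fin (n + m + 1))) →
    Fin (n + m + 1) → EuclideanSpace ℝ (Fin (n + m + 1)) := fun ν =>
      Fin.cons (f x) (Fin.append (fun i => differential f x (b i)) ν) with ht
  have hspanT : ⊤ ≤ Submodule.span ℝ
      (Set.range (t fun i => (β i : EuclideanSpace ℝ (Fin (n + m + 1))))) := by
    have h1 : Submodule.span ℝ
        (Set.range fun i => (β i : EuclideanSpace ℝ (Fin (n + m + 1)))) = normalSpace f x := by
      have h2 := congrArg (Submodule.map (normalSpace f x).subtype) β.toBasis.span_eq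
      rw [Submodule.map_span, ← Set.range_comp, Submodule.map_subtype_top] at h2
      have h4 : (fun i => (β i : EuclideanSpace ℝ (Fin (n + m + 1)))) =
          (normalSpace f x).subtype ∘ β.toBasis := by
        funext i
        simp
      rw [h4]
      exact h2
    have h3 : Set.range (Fin.append (fun i => differential f x (b i))
        (fun i => (β i : EuclideanSpace ℝ (Fin (n + m + 1))))) =
        Set.range (fun i => differential f x (b i)) ∪
          Set.range (fun i => (β i : EuclideanSpace ℝ (Fin (n + m + 1)))) := by
      ext y
      simp only [Set.mem_range, Set.mem_union]
      constructor
      · rintro ⟨i, rfl⟩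
        refine Fin.addCases (fun j => ?_) (fun j => ?_) i
        · exact Or.inl ⟨j, by simp⟩
        · exact Or.inr ⟨j, by simp⟩
      · rintro (⟨j, rfl⟩ | ⟨j, rfl⟩)
        · exact ⟨Fin.castAdd m j, by simp⟩
        · exact ⟨Fin.natAdd n j, by simp⟩
    rw [ht, Fin.range_cons, Submodule.span_insert, h3, Submodule.span_union, hspan, h1, ← sup_assoc]
    exact (Submodule.sup_orthogonal_of_hasOrthogonalProjection).ge
  have hdet : (EuclideanSpace.basisFun (Fin (n + m + 1)) ℝ).toBasis.det
      (t fun i => (β i : EuclideanSpace ℝ (Fin (n + m + 1)))) ≠ 0 :=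
    ((Module.Basis.is_basis_iff_det _).1
      ⟨linearIndependent_of_top_le_span_of_card_eq_finrank hspanT (by simp),
        top_le_iff.1 hspanT⟩).ne_zero
  have hmemβ : ∀ i, (β i : EuclideanSpace ℝ (Fin (n + m + 1))) ∈ normalSpace f x :=
    fun i => (β i).2
  rcases lt_or_gt_of_ne hdet with h | h
  · -- change the sign of one normal vector
    let i₀ : Fin m := ⟨0, hm⟩
    let ν : Fin m → EuclideanSpace ℝ (Fin (n + m + 1)) :=
      Function.update (fun i => (β i : EuclideanSpace ℝ (Fin (n + m + 1)))) i₀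
        (-(β i₀ : EuclideanSpace ℝ (Fin (n + m + 1))))
    have hν : ∀ i, ν i = β i ∨ ν i = -(β i : EuclideanSpace ℝ (Fin (n + m + 1))) := by
      intro i
      by_cases hi : i = i₀
      · subst hi
        exact Or.inr (by simp [ν])
      · exact Or.inl (by simp [ν, hi])
    have hortho : Orthonormal ℝ ν := by
      constructor
      · intro i
        rcases hν i with h' | h' <;> rw [h']
        · exact hβ.1 i
        · rw [norm_neg]
          exact hβ.1 i
      · intro i j hij
        have := hβ.2 hij
        simp only at this
        rcases hν i with h' | h' <;> rcases hν j with h'' | h'' <;>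
          simp [h', h'', inner_neg_left, inner_neg_right, this]
    have htν : t ν = Function.update (t fun i => (β i : EuclideanSpace ℝ (Fin (n + m + 1))))
        (Fin.natAdd n i₀).succ (-(t (fun i => (β i : EuclideanSpace ℝ (Fin (n + m + 1))))
          (Fin.natAdd n i₀).succ)) := by
      funext i
      refine Fin.cases ?_ (fun i => ?_) i
      · rw [Function.update_of_ne (Fin.succ_ne_zero _).symm]
        rfl
      · refine Fin.addCases (fun j => ?_) (fun j => ?_) i
        · have hne : Fin.castAdd m j ≠ Fin.natAdd n i₀ := by
            intro h'
            have := congrArg Fin.val h'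
            simp at this
            omega
          simp [ht, hne]
        · by_cases hj : j = i₀
          · subst hj
            simp [ht, ν]
          · simp [ht, ν, hj]
    refine ⟨⟨ν, hortho⟩, fun i => ?_, b, hb, ?_⟩
    · rcases hν i with h' | h' <;> simp only [h']
      · exact hmemβ i
      · exact neg_mem (hmemβ i)
    · change 0 < (EuclideanSpace.basisFun (Fin (n + m + 1)) ℝ).toBasis.det (t ν)
      rw [htν, AlternatingMap.map_update_neg, Function.update_eq_self]
      linarith
  · exact ⟨⟨_, hβ⟩, hmemβ, b, hb, h⟩

/-- The normal Gauss map `x ↦ N_x M` into the Grassmannian of oriented `m`-planes of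
`ℝ^{n+m+1}`; its value is the class of any positively oriented orthonormal normal frame. -/
def normalGaussMap [NeZero n] [NeZero m] (o : ManifoldOrientation n M)
    {f : M → EuclideanSpace ℝ (Fin (n + m + 1))} (hf : IsSphereImmersion f) (x : M) :
    Grassmannian m (n + m + 1) :=
  Quotient.mk _ (exists_orientedNormalFrame o hf x).choose

/-- The rank of the normal Gauss map at `x`, the Grassmannian being viewed as a submanifold of
`Λ^m ℝ^{n+m+1}` through the Plücker embedding. -/
def normalGaussRank [NeZero n] [NeZero m] (o : ManifoldOrientation n M)
    {f : M → EuclideanSpace ℝ (Fin (n + m + 1))} (hf : IsSphereImmersion f) (x : M) : ℕ :=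
  Module.finrank ℝ (LinearMap.range
    (mfderiv (𝓡 n) 𝓘(ℝ, (Fin m ↪o Fin (n + m + 1)) → ℝ)
      (fun y => plucker (normalGaussMap o hf y)) x).toLinearMap)

end Immersion

/-- An `n`-dimensional equator (totally geodesic great sphere) of the unit sphere of `ℝ^N`. -/
def IsEquator (n : ℕ) {N : ℕ} (S : Set (EuclideanSpace ℝ (Fin N))) : Prop :=
  ∃ V : Submodule ℝ (EuclideanSpace ℝ (Fin N)),
    Module.finrank ℝ V = n + 1 ∧ S = Metric.sphere 0 1 ∩ (V : Set (EuclideanSpace ℝ (Fin N)))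

end BernsteinSphere

end

noncomputable section
namespace BernsteinSphere

/-! ### Algebraic inequalities -/

/-! Fix an oriented plane R and study w(N, R)⁻² along the normal Gauss map N, where w(N, R) ≠ 0.
Near a point x the cone over M is a graph over the span of the position vector and the tangent
space, and R is a graph over N_x with slopes z. Expanding the determinants to second order,
minimality removes every term linear in second order data. With B the second fundamental form, what
remains is Δ w⁻² = 2 w⁻² (∑ |B_ij|² + ∑ ⟪B_ij, z_l⟫⟪B_il, z_j⟫ + 2 ∑_i (∑_j ⟪B_ij, z_j⟫)²).

The thresholds come from the sign of the bracket. In a tangent frame with orthogonal slopes, ∏ (1 +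
|z_j|²) ≤ w⁻². `norm_sq_add_slopeForm_nonneg` shows that the bracket is nonnegative when this
product is at most 9, that is for |w| ≥ 1/3; for |w| > 1/3 it vanishes only if B = 0
(`eq_zero_of_norm_sq_add_slopeForm_le`). If the Gauss map has rank at most 2, its kernel lies in the
nullity of B. Then B lives on a trace-free 2 × 2 block, the middle sum is a sum of two squares, and
no lower bound on |w| is needed.

A single plane R is not enough, since w(N, R) may vanish somewhere. S-orthogonality of P and Q
yields a pencil R_β with w(N, R_β) = cos β w(N, P) + sin β w(N, Q) = r cos (θ - β). Avoiding the
slit makes the angle θ a continuous real function on M. Choose a constant c below min r and above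
1/3 (above 0 in the rank two case), and let α be the maximum of θ - arccos (c / r). Where it is
attained, w(N, R_α) has a local minimum with value c, so the subharmonic function w⁻² has a local
maximum. The strong maximum principle (`eventually_eq_of_isSubsolutionAt`) and connectedness give
w(N, R_α) = c on all of M (`exists_w_eq_const`), and the rigidity part of the algebraic inequality
gives B = 0.

Finally, B = 0 makes the normal space constant. The image then lies in the unit sphere of its
orthogonal complement, where it is open and closed, hence everything (`isEquator_range`). -/

theorem elementary_symmetric_le {p q r : ℝ} (hq : 0 ≤ q) (hr : 0 ≤ r) (hp : 2 ≤ p)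
    (h : (1 + p) * (1 + q) * (1 + r) ≤ 9) : p * q + p * r + q * r - p * q * r ≤ 4 := by
  have hu : q + r + q * r ≤ 2 := by
    have : 3 * ((1 + q) * (1 + r)) ≤ 9 := by
      have h1 : 0 ≤ (1 + q) * (1 + r) := by positivity
      nlinarith
    nlinarith
  have hqr : 0 ≤ q * r := mul_nonneg hq hr
  have h1 : q * r ≤ q + r := by nlinarith
  have hpos : 0 < 1 + q + r + q * r := by positivity
  have hp' : p * (1 + q + r + q * r) ≤ 8 - q - r - q * r := by nlinarith
  have key : (p * (q + r - q * r) + q * r) * (1 + q + r + q * r) ≤ 4 * (1 + q + r + q * r) := by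
    have h2 : p * (1 + q + r + q * r) * (q + r - q * r) ≤
        (8 - q - r - q * r) * (q + r - q * r) :=
      mul_le_mul_of_nonneg_right hp' (by linarith)
    -- Once p is eliminated through `hp'`, the difference of the two sides of `key` is (q + r - 2)²
    -- + qr (11 - 2qr - (q + r)).
    have h3 : 0 ≤ q * r * (11 - 2 * (q * r) - (q + r)) := mul_nonneg hqr (by linarith)
    nlinarith [sq_nonneg (q + r - 2)]
  have := le_of_mul_le_mul_right key hpos
  linarith

/-- With s = ax + by + cz and p, q, r the squares of a, b, c, twice the form is s² + (2 - p) x² + (2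
- q) y² + (2 - r) z², where only the x² term is negative. Writing ax = s - by - cz and applying a
weighted Cauchy inequality reduces the claim to nonnegativity of the determinant of the doubled
form, 8 - 2 (pq + pr + qr - pqr). This is `elementary_symmetric_le`. -/
theorem ternary_form_nonneg_of_two_le {a b c : ℝ} (x y z : ℝ) (ha : 2 < a ^ 2)
    (h : (1 + a ^ 2) * (1 + b ^ 2) * (1 + c ^ 2) ≤ 9) :
    0 ≤ x ^ 2 + y ^ 2 + z ^ 2 + b * c * (y * z) + a * c * (x * z) + a * b * (x * y) := by
  have he := elementary_symmetric_le (sq_nonneg b) (sq_nonneg c) ha.le h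
  have hu : b ^ 2 + c ^ 2 + b ^ 2 * c ^ 2 < 2 := by
    have h1 : 0 < (1 + b ^ 2) * (1 + c ^ 2) := by positivity
    nlinarith
  set p := a ^ 2 with hp
  set q := b ^ 2 with hq
  set r := c ^ 2 with hr
  have hq0 : 0 ≤ q := sq_nonneg b
  have hr0 : 0 ≤ r := sq_nonneg c
  have hqr : 0 ≤ q * r := mul_nonneg hq0 hr0
  have h2q : 0 < 2 - q := by linarith
  have h2r : 0 < 2 - r := by linarith
  set s := a * x + b * y + c * z with hs
  have e : 2 * (x ^ 2 + y ^ 2 + z ^ 2 + b * c * (y * z) + a * c * (x * z) + a * b * (x * y)) =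
      s ^ 2 + (2 - q) * y ^ 2 + (2 - r) * z ^ 2 - (p - 2) * x ^ 2 := by
    rw [hs, hp, hq, hr]; ring
  have hax : p * x ^ 2 = (s - b * y - c * z) ^ 2 := by rw [hs, hp]; ring
  -- weighted Cauchy inequality
  have hC : (s - b * y - c * z) ^ 2 * ((2 - q) * (2 - r)) ≤
      ((2 - q) * (2 - r) + q * (2 - r) + r * (2 - q)) *
        (s ^ 2 + (2 - q) * y ^ 2 + (2 - r) * z ^ 2) := by
    have e1 : ((2 - q) * (2 - r) + q * (2 - r) + r * (2 - q)) *
        (s ^ 2 + (2 - q) * y ^ 2 + (2 - r) * z ^ 2) -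
        (s - b * y - c * z) ^ 2 * ((2 - q) * (2 - r)) =
        (2 - r) * (b * s + (2 - q) * y) ^ 2 + (2 - q) * (c * s + (2 - r) * z) ^ 2 +
          (b * (2 - r) * z - c * (2 - q) * y) ^ 2 := by
      rw [hq, hr]; ring
    have : 0 ≤ (2 - r) * (b * s + (2 - q) * y) ^ 2 + (2 - q) * (c * s + (2 - r) * z) ^ 2 +
          (b * (2 - r) * z - c * (2 - q) * y) ^ 2 := by positivity
    linarith
  -- The second factor on the left expands to 4 - qr, and the inequality becomes the determinant
  -- bound `he`.
  have hD : (p - 2) * ((2 - q) * (2 - r) + q * (2 - r) + r * (2 - q)) ≤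
      p * ((2 - q) * (2 - r)) := by nlinarith
  set R := s ^ 2 + (2 - q) * y ^ 2 + (2 - r) * z ^ 2 with hR
  have hR0 : 0 ≤ R := by positivity
  have hd : 0 < (2 - q) * (2 - r) := mul_pos h2q h2r
  have hfin : (p - 2) * x ^ 2 * (p * ((2 - q) * (2 - r))) ≤ R * (p * ((2 - q) * (2 - r))) := by
    calc (p - 2) * x ^ 2 * (p * ((2 - q) * (2 - r)))
        = (p - 2) * ((s - b * y - c * z) ^ 2 * ((2 - q) * (2 - r))) := by rw [← hax]; ring
      _ ≤ (p - 2) * (((2 - q) * (2 - r) + q * (2 - r) + r * (2 - q)) * R) :=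
          mul_le_mul_of_nonneg_left hC (by linarith)
      _ = ((p - 2) * ((2 - q) * (2 - r) + q * (2 - r) + r * (2 - q))) * R := by ring
      _ ≤ (p * ((2 - q) * (2 - r))) * R := mul_le_mul_of_nonneg_right hD hR0
      _ = _ := by ring
  have := le_of_mul_le_mul_right hfin (by positivity)
  linarith

theorem ternary_form_nonneg {a b c : ℝ} (x y z : ℝ)
    (h : (1 + a ^ 2) * (1 + b ^ 2) * (1 + c ^ 2) ≤ 9) :
    0 ≤ x ^ 2 + y ^ 2 + z ^ 2 + b * c * (y * z) + a * c * (x * z) + a * b * (x * y) := by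
  by_cases ha : 2 < a ^ 2
  · exact ternary_form_nonneg_of_two_le x y z ha h
  by_cases hb : 2 < b ^ 2
  · have := ternary_form_nonneg_of_two_le (a := b) (b := a) (c := c) y x z hb (by linarith)
    linarith
  by_cases hc : 2 < c ^ 2
  · have := ternary_form_nonneg_of_two_le (a := c) (b := b) (c := a) z y x hc (by linarith)
    linarith
  push Not at ha hb hc
  -- When no square exceeds 2, twice the form is manifestly a sum of nonnegative terms.
  nlinarith [sq_nonneg (a * x + b * y + c * z), mul_nonneg (sub_nonneg.2 ha) (sq_nonneg x),
    mul_nonneg (sub_nonneg.2 hb) (sq_nonneg y), mul_nonneg (sub_nonneg.2 hc) (sq_nonneg z)]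

theorem one_add_sum_le_prod {ι : Type*} (J : Finset ι) {t : ι → ℝ} (ht : ∀ j ∈ J, 0 ≤ t j) :
    1 + ∑ j ∈ J, t j ≤ ∏ j ∈ J, (1 + t j) := by
  classical
  induction J using Finset.induction_on with
  | empty => simp
  | insert a J ha ih =>
    rw [Finset.sum_insert ha, Finset.prod_insert ha]
    have h1 := ih fun j hj => ht j (Finset.mem_insert_of_mem hj)
    have h2 := ht a (Finset.mem_insert_self a J)
    have h3 : 0 ≤ ∑ j ∈ J, t j := Finset.sum_nonneg fun j hj => ht j (Finset.mem_insert_of_mem hj)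
    nlinarith

/-- A coefficient is negative only if (l² - 1) λ_j² > 2. The product bound then makes the sum τ of
the other λ_k² at most 1/8, so all other coefficients stay at least 3/2. The single negative term is
absorbed by the z² term, the squared trace and the remaining positive terms together. -/
theorem row_form_nonneg {ι : Type*} (J : Finset ι) (l z : ℝ) (lam x : ι → ℝ)
    (h : (1 + l ^ 2) * ∏ j ∈ J, (1 + lam j ^ 2) ≤ 9) :
    0 ≤ ∑ j ∈ J, (2 + lam j ^ 2 - l ^ 2 * lam j ^ 2) * x j ^ 2 + (1 + l ^ 2) * z ^ 2 +
      2 * (l * z + ∑ j ∈ J, lam j * x j) ^ 2 := by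
  classical
  by_cases hJ : ∀ j ∈ J, (l ^ 2 - 1) * lam j ^ 2 ≤ 2
  · have : 0 ≤ ∑ j ∈ J, (2 + lam j ^ 2 - l ^ 2 * lam j ^ 2) * x j ^ 2 :=
      Finset.sum_nonneg fun j hj => mul_nonneg (by linarith [hJ j hj]) (sq_nonneg _)
    positivity
  push Not at hJ
  obtain ⟨j₀, hj₀, h2⟩ := hJ
  rw [← Finset.mul_prod_erase J _ hj₀] at h
  rw [← Finset.add_sum_erase J _ hj₀, ← Finset.add_sum_erase J (fun j => lam j * x j) hj₀]
  have hτ := one_add_sum_le_prod (J.erase j₀) (t := fun j => lam j ^ 2) fun j _ => sq_nonneg _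
  have hCS : (∑ j ∈ J.erase j₀, lam j * x j) ^ 2 ≤
      (∑ j ∈ J.erase j₀, lam j ^ 2) * ∑ j ∈ J.erase j₀, x j ^ 2 :=
    Finset.sum_mul_sq_le_sq_mul_sq _ _ _
  have hτ0 : 0 ≤ ∑ j ∈ J.erase j₀, lam j ^ 2 := Finset.sum_nonneg fun j _ => sq_nonneg _
  have hτj : ∀ j ∈ J.erase j₀, lam j ^ 2 ≤ ∑ j ∈ J.erase j₀, lam j ^ 2 := fun j hj =>
    Finset.single_le_sum (f := fun j => lam j ^ 2) (fun j _ => sq_nonneg _) hj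
  set τ := ∑ j ∈ J.erase j₀, lam j ^ 2 with hτdef
  set s := l ^ 2 with hs
  set t := lam j₀ ^ 2 with ht
  set Y := ∑ j ∈ J.erase j₀, lam j * x j with hY
  have hs0 : 0 ≤ s := sq_nonneg l
  have ht0 : 0 ≤ t := sq_nonneg _
  have hs1 : 1 < s := by nlinarith
  have hst : (1 + s) * ((1 + t) * (1 + τ)) ≤ 9 :=
    le_trans (by gcongr) h
  have h3 : s + 1 ≤ (1 + t) * (s - 1) := by linarith
  -- Eliminating t between (s - 1) t > 2 and the product bound. Since 8 (s - 1) ≤ (s + 1)², it gives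
  -- τ ≤ 1/8; dropping τ it reads (s - 2)(s - 5) ≤ 0.
  have h4 : (s + 1) * (s + 1) * (1 + τ) ≤ 9 * (s - 1) := by
    calc (s + 1) * (s + 1) * (1 + τ) = (s + 1) * (1 + τ) * (s + 1) := by ring
      _ ≤ (s + 1) * (1 + τ) * ((1 + t) * (s - 1)) :=
          mul_le_mul_of_nonneg_left h3 (by positivity)
      _ = (1 + s) * ((1 + t) * (1 + τ)) * (s - 1) := by ring
      _ ≤ 9 * (s - 1) := mul_le_mul_of_nonneg_right hst (by linarith)
  have hτ8 : τ ≤ 1 / 8 := by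
    have h5 : (s + 1) * (s + 1) * τ ≤ (s + 1) * (s + 1) * (1 / 8) := by
      nlinarith [sq_nonneg (s - 3)]
    exact le_of_mul_le_mul_left h5 (by positivity)
  have hs5 : s ≤ 5 := by
    have : (s + 1) * (s + 1) ≤ 9 * (s - 1) := le_trans (by nlinarith) h4
    nlinarith
  have hrest : 12 * Y ^ 2 ≤ ∑ j ∈ J.erase j₀, (2 + lam j ^ 2 - s * lam j ^ 2) * x j ^ 2 := by
    have hX0 : 0 ≤ ∑ j ∈ J.erase j₀, x j ^ 2 := Finset.sum_nonneg fun j _ => sq_nonneg _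
    have h6 : ∑ j ∈ J.erase j₀, (3 / 2) * x j ^ 2 ≤
        ∑ j ∈ J.erase j₀, (2 + lam j ^ 2 - s * lam j ^ 2) * x j ^ 2 := by
      refine Finset.sum_le_sum fun j hj => mul_le_mul_of_nonneg_right ?_ (sq_nonneg _)
      have := hτj j hj
      nlinarith [sq_nonneg (lam j)]
    rw [← Finset.mul_sum] at h6
    nlinarith
  have ht1 : (1 + s) * (1 + t) ≤ 9 := le_trans (by nlinarith [mul_nonneg (by positivity : 0 ≤ (1 + s) * (1 + t)) hτ0]) hst
  -- Otherwise (s - 11/7) t > 2, while t ≤ (8 - s)/(1 + s). Together these say s² - (53/7) s + 102/7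
  -- < 0, a quadratic with negative discriminant and vertex 53/14.
  have hcoef : (s - 1) * t - 2 ≤ 4 / 7 * t := by
    by_contra hcon
    push Not at hcon
    have h7 : 0 < s - 11 / 7 := by nlinarith
    have h8 : 2 * (1 + s) < (s - 11 / 7) * (t * (1 + s)) := by nlinarith
    have h9 : (s - 11 / 7) * (t * (1 + s)) ≤ (s - 11 / 7) * (8 - s) :=
      mul_le_mul_of_nonneg_left (by nlinarith) h7.le
    nlinarith [sq_nonneg (s - 53 / 14)]
  have hcoef' : ((s - 1) * t - 2) * x j₀ ^ 2 ≤ 4 / 7 * (lam j₀ * x j₀) ^ 2 := by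
    calc ((s - 1) * t - 2) * x j₀ ^ 2 ≤ 4 / 7 * t * x j₀ ^ 2 :=
          mul_le_mul_of_nonneg_right hcoef (sq_nonneg _)
      _ = _ := by rw [ht]; ring
  have hz : (l * z) ^ 2 ≤ (1 + s) * z ^ 2 := by rw [hs]; nlinarith [sq_nonneg z]
  set X₀ := lam j₀ * x j₀
  set Z := l * z
  -- Write X₀ = (Z + X₀ + Y) - Z - Y. Cauchy with weights 2, 1, 12 gives the constant 1/(1/2 + 1 +
  -- 1/12) = 12/19, which exceeds 4/7.
  have hfin : 4 / 7 * X₀ ^ 2 ≤ Z ^ 2 + 2 * (Z + (X₀ + Y)) ^ 2 + 12 * Y ^ 2 := by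
    nlinarith [sq_nonneg (Z - 2 * (Z + (X₀ + Y)) * (-1)), sq_nonneg (12 * Y - Z),
      sq_nonneg (2 * (Z + (X₀ + Y)) + 12 * Y)]
  linarith

/-! ### Positivity and rigidity of the quadratic form in the second fundamental form -/

section TensorInequality

variable {ι : Type*} [Fintype ι]

/-- The triple sum is symmetrized cyclically and split by coincidences among the indices. A triple
of distinct indices contributes the ternary form in h i j l, h j i l, h l i j with coefficients λ_i,
λ_j, λ_l. The other triples, grouped by the index i that is not repeated, form rows; each row
together with its own squared trace is handled by `row_form_nonneg`. -/
theorem cubic_tensor_form_nonneg (h : ι → ι → ι → ℝ) (hsym : ∀ l i j, h l i j = h l j i)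
    (lam : ι → ℝ) (hlam : ∏ j, (1 + lam j ^ 2) ≤ 9) :
    0 ≤ ∑ i, ∑ j, ∑ l, (h l i j ^ 2 + lam l * lam j * (h l i j * h j i l)) +
      2 * ∑ i, (∑ l, lam l * h l i l) ^ 2 := by
  classical
  set f : ι → ι → ι → ℝ := fun i j l => h l i j ^ 2 + lam l * lam j * (h l i j * h j i l) with hf
  set g : ι → ι → ι → ℝ := fun i j l => f i j l + f j l i + f l i j with hg
  have hsub : ∀ J : Finset ι, ∏ j ∈ J, (1 + lam j ^ 2) ≤ 9 := fun J => by
    refine le_trans ?_ hlam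
    rw [← Finset.prod_mul_prod_compl J]
    have h1 : 1 ≤ ∏ j ∈ Jᶜ, (1 + lam j ^ 2) :=
      le_trans (by linarith [Finset.sum_nonneg fun j (_ : j ∈ Jᶜ) => sq_nonneg (lam j)])
        (one_add_sum_le_prod Jᶜ (t := fun j => lam j ^ 2) fun j _ => sq_nonneg _)
    have h0 : 0 ≤ ∏ j ∈ J, (1 + lam j ^ 2) := Finset.prod_nonneg fun j _ => by positivity
    nlinarith
  have hsum : ∑ i, ∑ j, ∑ l, g i j l = 3 * ∑ i, ∑ j, ∑ l, f i j l := by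
    have e1 : ∑ i, ∑ j, ∑ l, f j l i = ∑ i, ∑ j, ∑ l, f i j l := by
      rw [Finset.sum_comm]
      exact Finset.sum_congr rfl fun j _ => Finset.sum_comm
    have e2 : ∑ i, ∑ j, ∑ l, f l i j = ∑ i, ∑ j, ∑ l, f i j l := by
      calc ∑ i, ∑ j, ∑ l, f l i j = ∑ i, ∑ l, ∑ j, f l i j :=
            Finset.sum_congr rfl fun i _ => Finset.sum_comm
        _ = _ := Finset.sum_comm
    simp only [hg, Finset.sum_add_distrib]
    rw [e1, e2]
    ring
  -- the triples with three distinct entries contribute a nonnegative amount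
  have hpt : ∀ i j l, (if i = j then g i j l else 0) + (if j = l then g i j l else 0) +
      (if i = l then g i j l else 0) - 2 * (if i = j then (if j = l then g i j l else 0) else 0)
        ≤ g i j l := by
    intro i j l
    by_cases hij : i = j
    · subst hij
      by_cases hil : i = l
      · subst hil; simp; linarith
      · simp [hil]
    · by_cases hjl : j = l
      · subst hjl; simp [hij]
      · by_cases hil : i = l
        · subst hil; simp [hij, hjl]
        · simp only [hij, hjl, hil, if_false]
          have h3 := hsub {i, j, l}
          rw [Finset.prod_insert (by simp [hij, hil]), Finset.prod_insert (by simp [hjl]),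
            Finset.prod_singleton, ← mul_assoc] at h3
          have := ternary_form_nonneg (h i j l) (h j i l) (h l i j) h3
          simp only [hg, hf]
          rw [hsym l j i, hsym i l j, hsym j l i] at *
          linarith
  have hle : ∑ i, ∑ j, ∑ l, ((if i = j then g i j l else 0) + (if j = l then g i j l else 0) +
      (if i = l then g i j l else 0) - 2 * (if i = j then (if j = l then g i j l else 0) else 0))
        ≤ ∑ i, ∑ j, ∑ l, g i j l :=
    Finset.sum_le_sum fun i _ => Finset.sum_le_sum fun j _ => Finset.sum_le_sum fun l _ => hpt i j l
  -- By cyclic invariance of g the three coincidence patterns contribute equally. The full diagonal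
  -- is counted in all three, so two copies are subtracted.
  have hdiag : ∑ i, ∑ j, ∑ l, ((if i = j then g i j l else 0) + (if j = l then g i j l else 0) +
      (if i = l then g i j l else 0) - 2 * (if i = j then (if j = l then g i j l else 0) else 0))
      = 3 * ∑ i, ∑ j, g j j i - 2 * ∑ i, g i i i := by
    simp only [Finset.sum_sub_distrib, Finset.sum_add_distrib, ← Finset.mul_sum]
    have e1 : ∑ i, ∑ j, ∑ l, (if i = j then g i j l else 0) = ∑ i, ∑ j, g j j i := by
      calc ∑ i, ∑ j, ∑ l, (if i = j then g i j l else 0)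
          = ∑ i, ∑ l, ∑ j, (if i = j then g i j l else 0) :=
            Finset.sum_congr rfl fun i _ => Finset.sum_comm
        _ = ∑ i, ∑ l, g i i l := by simp
        _ = _ := Finset.sum_comm
    have e2 : ∑ i, ∑ j, ∑ l, (if j = l then g i j l else 0) = ∑ i, ∑ j, g j j i := by
      simp only [Finset.sum_ite_eq, Finset.mem_univ, if_true, hg]
      exact Finset.sum_congr rfl fun i _ => Finset.sum_congr rfl fun j _ => by ring
    have e3 : ∑ i, ∑ j, ∑ l, (if i = l then g i j l else 0) = ∑ i, ∑ j, g j j i := by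
      simp only [Finset.sum_ite_eq, Finset.mem_univ, if_true, hg]
      rw [Finset.sum_comm]
      exact Finset.sum_congr rfl fun i _ => Finset.sum_congr rfl fun j _ => by ring
    have e4 : ∑ i, ∑ j, ∑ l, (if i = j then (if j = l then g i j l else 0) else 0) =
        ∑ i, g i i i := by
      refine Finset.sum_congr rfl fun i _ => ?_
      simp
    rw [e1, e2, e3, e4]
    ring
  have hrow : ∀ i, 0 ≤ ∑ j, g j j i - 2 / 3 * g i i i + 2 * (∑ l, lam l * h l i l) ^ 2 := by
    intro i
    have h1 := row_form_nonneg (Finset.univ.erase i) (lam i) (h i i i) lam (fun j => h j i j)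
      (by
        have := hsub Finset.univ
        rwa [← Finset.mul_prod_erase _ _ (Finset.mem_univ i)] at this)
    rw [← Finset.add_sum_erase _ _ (Finset.mem_univ i),
      ← Finset.add_sum_erase _ (fun l => lam l * h l i l) (Finset.mem_univ i)]
    -- Completing the square in h i j j leaves the coefficient 2 + λ_j² - λ_i² λ_j² on (h j i j)².
    have h2 : ∑ j ∈ Finset.univ.erase i,
        (2 + lam j ^ 2 - lam i ^ 2 * lam j ^ 2) * h j i j ^ 2 ≤
          ∑ j ∈ Finset.univ.erase i, g j j i := by
      refine Finset.sum_le_sum fun j _ => ?_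
      simp only [hg, hf]
      rw [hsym j j i]
      nlinarith [sq_nonneg (h i j j + lam i * lam j * h j i j)]
    have h3 : g i i i = 3 * ((1 + lam i ^ 2) * h i i i ^ 2) := by
      simp only [hg, hf]; ring
    linarith
  have hrows := Finset.sum_nonneg fun i (_ : i ∈ Finset.univ) => hrow i
  rw [Finset.sum_add_distrib, Finset.sum_sub_distrib, ← Finset.mul_sum, ← Finset.mul_sum] at hrows
  linarith

variable {W : Type*} [NormedAddCommGroup W] [InnerProductSpace ℝ W]

/-- Bessel's inequality without full orthonormality: a normalized slope is a unit vector or zero. -/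
theorem sum_inner_sq_le {u : ι → W} (hu : ∀ i j, i ≠ j → ⟪u i, u j⟫_ℝ = 0)
    (hu1 : ∀ i, ‖u i‖ ≤ 1) (v : W) : ∑ i, ⟪v, u i⟫_ℝ ^ 2 ≤ ‖v‖ ^ 2 := by
  classical
  have h0 : 0 ≤ ‖v - ∑ i, ⟪v, u i⟫_ℝ • u i‖ ^ 2 := sq_nonneg _
  rw [norm_sub_sq_real] at h0
  have h1 : ⟪v, ∑ i, ⟪v, u i⟫_ℝ • u i⟫_ℝ = ∑ i, ⟪v, u i⟫_ℝ ^ 2 := by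
    simp only [inner_sum, real_inner_smul_right, sq]
  have h2 : ‖∑ i, ⟪v, u i⟫_ℝ • u i‖ ^ 2 ≤ ∑ i, ⟪v, u i⟫_ℝ ^ 2 := by
    rw [← real_inner_self_eq_norm_sq, sum_inner]
    refine Finset.sum_le_sum fun i _ => ?_
    rw [inner_sum, Finset.sum_eq_single i]
    · rw [real_inner_smul_left, real_inner_smul_right, real_inner_self_eq_norm_sq]
      have : ‖u i‖ ^ 2 ≤ 1 := pow_le_one₀ (norm_nonneg _) (hu1 i)
      nlinarith [sq_nonneg ⟪v, u i⟫_ℝ]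
    · intro j _ hj
      rw [real_inner_smul_left, real_inner_smul_right, hu i j hj.symm]
      simp
    · simp
  linarith

/-- The quadratic form in the second fundamental form `b` which governs the Laplacian of a power
of a Plücker coordinate with slopes `z`. -/
def slopeForm (b : ι → ι → W) (z : ι → W) : ℝ :=
  ∑ i, ∑ j, ∑ l, ⟪b i j, z l⟫_ℝ * ⟪b i l, z j⟫_ℝ

/-- The components of b along the normalized slopes form a tensor to which
`cubic_tensor_form_nonneg` applies with λ_j = ‖z_j‖. The components of b off the slopes enter only
‖b‖², so Bessel's inequality discards them. -/
theorem norm_sq_add_slopeForm_nonneg {b : ι → ι → W} (hb : ∀ i j, b i j = b j i) {z : ι → W}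
    (hz : ∀ i j, i ≠ j → ⟪z i, z j⟫_ℝ = 0) (hprod : ∏ j, (1 + ‖z j‖ ^ 2) ≤ 9) :
    0 ≤ ∑ i, ∑ j, ‖b i j‖ ^ 2 + slopeForm b z + 2 * ∑ i, (∑ j, ⟪b i j, z j⟫_ℝ) ^ 2 := by
  have hzu : ∀ j, z j = ‖z j‖ • (‖z j‖⁻¹ • z j) := by
    intro j
    by_cases h : z j = 0
    · simp [h]
    · rw [smul_smul, mul_inv_cancel₀ (norm_ne_zero_iff.2 h), one_smul]
  set u : ι → W := fun j => ‖z j‖⁻¹ • z j with hu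
  have hin : ∀ v j, ⟪v, z j⟫_ℝ = ‖z j‖ * ⟪v, u j⟫_ℝ := by
    intro v j
    conv_lhs => rw [hzu j]
    rw [real_inner_smul_right]
  have huo : ∀ i j, i ≠ j → ⟪u i, u j⟫_ℝ = 0 := by
    intro i j hij
    simp only [hu, real_inner_smul_left, real_inner_smul_right, hz i j hij, mul_zero]
  have hu1 : ∀ i, ‖u i‖ ≤ 1 := by
    intro i
    simp only [hu, norm_smul, norm_inv, norm_norm]
    exact inv_mul_le_one
  have key := cubic_tensor_form_nonneg (fun l i j => ⟪b i j, u l⟫_ℝ)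
    (fun l i j => by simp only [hb i j]) (fun j => ‖z j‖) hprod
  simp only [Finset.sum_add_distrib] at key
  have h1 : ∑ i, ∑ j, ∑ l, ⟪b i j, u l⟫_ℝ ^ 2 ≤ ∑ i, ∑ j, ‖b i j‖ ^ 2 :=
    Finset.sum_le_sum fun i _ => Finset.sum_le_sum fun j _ => sum_inner_sq_le huo hu1 _
  have h2 : slopeForm b z =
      ∑ i, ∑ j, ∑ l, ‖z l‖ * ‖z j‖ * (⟪b i j, u l⟫_ℝ * ⟪b i l, u j⟫_ℝ) := by
    refine Finset.sum_congr rfl fun i _ => Finset.sum_congr rfl fun j _ =>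
      Finset.sum_congr rfl fun l _ => ?_
    rw [hin, hin]; ring
  have h3 : ∑ i, (∑ j, ⟪b i j, z j⟫_ℝ) ^ 2 = ∑ i, (∑ l, ‖z l‖ * ⟪b i l, u l⟫_ℝ) ^ 2 := by
    simp only [hin]
  rw [h2, h3]
  linarith

theorem slopeForm_smul (b : ι → ι → W) (z : ι → W) (c : ℝ) :
    slopeForm b (fun j => c • z j) = c ^ 2 * slopeForm b z := by
  simp only [slopeForm, real_inner_smul_right, Finset.mul_sum]
  exact Finset.sum_congr rfl fun i _ => Finset.sum_congr rfl fun j _ =>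
      Finset.sum_congr rfl fun l _ => by ring

/-- The strict product bound leaves room to scale the slopes by some c > 1. Writing the form as A +
S, with A = ∑ ‖b i j‖² and S homogeneous of degree two in z, one has A + c² S ≥ 0 and A + S ≤ 0;
hence (c² - 1) A ≤ 0. -/
theorem eq_zero_of_norm_sq_add_slopeForm_le {b : ι → ι → W} (hb : ∀ i j, b i j = b j i) {z : ι → W}
    (hz : ∀ i j, i ≠ j → ⟪z i, z j⟫_ℝ = 0) (hprod : ∏ j, (1 + ‖z j‖ ^ 2) < 9)
    (h : ∑ i, ∑ j, ‖b i j‖ ^ 2 + slopeForm b z + 2 * ∑ i, (∑ j, ⟪b i j, z j⟫_ℝ) ^ 2 ≤ 0)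
    (i j : ι) : b i j = 0 := by
  obtain ⟨c, hc, hc9⟩ : ∃ c : ℝ, 1 < c ∧ ∏ j, (1 + ‖c • z j‖ ^ 2) < 9 := by
    have hcont : Continuous fun c : ℝ => ∏ j, (1 + ‖c • z j‖ ^ 2) := by fun_prop
    have h1 : ∀ᶠ c in 𝓝 (1 : ℝ), ∏ j, (1 + ‖c • z j‖ ^ 2) < 9 :=
      hcont.continuousAt.eventually_lt_const (by simpa using hprod)
    have h2 := (h1.filter_mono nhdsWithin_le_nhds).and
      (self_mem_nhdsWithin : Set.Ioi (1 : ℝ) ∈ 𝓝[>] 1)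
    obtain ⟨c, h3, h4⟩ := h2.exists
    exact ⟨c, h4, h3⟩
  have key := norm_sq_add_slopeForm_nonneg hb (z := fun j => c • z j)
    (fun i j hij => by rw [real_inner_smul_left, real_inner_smul_right, hz i j hij]; simp) hc9.le
  rw [slopeForm_smul] at key
  have h3 : ∑ i, (∑ j, ⟪b i j, c • z j⟫_ℝ) ^ 2 = c ^ 2 * ∑ i, (∑ j, ⟪b i j, z j⟫_ℝ) ^ 2 := by
    simp only [real_inner_smul_right, ← Finset.mul_sum, mul_pow]
  rw [h3] at key
  have hA : 0 ≤ ∑ i, ∑ j, ‖b i j‖ ^ 2 :=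
    Finset.sum_nonneg fun i _ => Finset.sum_nonneg fun j _ => sq_nonneg _
  have hA0 : ∑ i, ∑ j, ‖b i j‖ ^ 2 = 0 := by
    refine le_antisymm ?_ hA
    by_contra hcon
    push Not at hcon
    have hc2 : 1 < c ^ 2 := by nlinarith
    nlinarith [mul_pos (sub_pos.2 hc2) hcon]
  have h5 := (Finset.sum_eq_zero_iff_of_nonneg
    (fun i _ => Finset.sum_nonneg fun j _ => sq_nonneg _)).1 hA0 i (Finset.mem_univ i)
  have h6 := (Finset.sum_eq_zero_iff_of_nonneg (fun j _ => sq_nonneg _)).1 h5 j (Finset.mem_univ j)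
  simpa using h6

/-- With β = b p p = -b q q and γ = b p q the form equals (⟪β, z p⟫ - ⟪γ, z q⟫)² + (⟪β, z q⟫ + ⟪γ, z
p⟫)². The case p = q forces b = 0, since the trace vanishes. -/
theorem slopeForm_nonneg_of_rank_two {b : ι → ι → W} (hb : ∀ i j, b i j = b j i)
    (htr : ∑ i, b i i = 0) (z : ι → W) (p q : ι) (hpq : ∀ i, i ≠ p → i ≠ q → ∀ j, b i j = 0) :
    0 ≤ slopeForm b z := by
  by_cases h : p = q
  · subst h
    have hpp : b p p = 0 := by
      rw [← htr, Finset.sum_eq_single p]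
      · exact fun i _ hi => hpq i hi hi i
      · simp
    have hall : ∀ i j, b i j = 0 := by
      intro i j
      by_cases hi : i = p
      · by_cases hj : j = p
        · rw [hi, hj, hpp]
        · rw [hb, hpq j hj hj]
      · exact hpq i hi hi j
    simp [slopeForm, hall]
  · have hqq : b q q = - b p p := by
      rw [Fintype.sum_eq_add p q h (fun i hi => hpq i hi.1 hi.2 i)] at htr
      exact eq_neg_of_add_eq_zero_right htr
    have e : ∀ i, ∑ j, ∑ l, ⟪b i j, z l⟫_ℝ * ⟪b i l, z j⟫_ℝ =
        ⟪b i p, z p⟫_ℝ * ⟪b i p, z p⟫_ℝ + ⟪b i p, z q⟫_ℝ * ⟪b i q, z p⟫_ℝ +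
          (⟪b i q, z p⟫_ℝ * ⟪b i p, z q⟫_ℝ + ⟪b i q, z q⟫_ℝ * ⟪b i q, z q⟫_ℝ) := by
      intro i
      rw [Fintype.sum_eq_add p q h]
      · rw [Fintype.sum_eq_add p q h, Fintype.sum_eq_add p q h]
        · intro l hl; rw [hb i l, hpq l hl.1 hl.2]; simp
        · intro l hl; rw [hb i l, hpq l hl.1 hl.2]; simp
      · intro j hj
        refine Finset.sum_eq_zero fun l _ => ?_
        rw [hb i j, hpq j hj.1 hj.2]; simp
    rw [slopeForm, Fintype.sum_eq_add p q h]
    · rw [e, e, hqq, hb q p]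
      simp only [inner_neg_left]
      nlinarith [sq_nonneg (⟪b p p, z p⟫_ℝ + ⟪b p q, z q⟫_ℝ),
        sq_nonneg (⟪b p p, z q⟫_ℝ - ⟪b p q, z p⟫_ℝ),
        sq_nonneg (⟪b p p, z p⟫_ℝ - ⟪b p q, z q⟫_ℝ),
        sq_nonneg (⟪b p p, z q⟫_ℝ + ⟪b p q, z p⟫_ℝ)]
    · intro i hi
      rw [e]
      simp [hpq i hi.1 hi.2]

end TensorInequality

/-! ### Second order jets of curves -/

section Jets

variable {V W : Type*} [NormedAddCommGroup V] [NormedSpace ℝ V] [NormedAddCommGroup W]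
  [NormedSpace ℝ W]

/-- The curve `g` is twice differentiable at `0`, with first derivative `a` and second
derivative `b`. -/
def HasJet (g : ℝ → V) (a b : V) : Prop :=
  ∃ g' : ℝ → V, (∀ᶠ s in 𝓝 0, HasDerivAt g (g' s) s) ∧ g' 0 = a ∧ HasDerivAt g' b 0

namespace HasJet

variable {g h : ℝ → V} {a b c d : V}

theorem hasDerivAt (hg : HasJet g a b) : HasDerivAt g a 0 := by
  obtain ⟨g', h1, rfl, _⟩ := hg
  exact h1.self_of_nhds

theorem continuousAt (hg : HasJet g a b) : ContinuousAt g 0 := hg.hasDerivAt.continuousAt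

theorem congr (hg : HasJet g a b) (h' : h =ᶠ[𝓝 0] g) : HasJet h a b := by
  obtain ⟨g', h1, h2, h3⟩ := hg
  refine ⟨g', ?_, h2, h3⟩
  filter_upwards [h1, h'.eventually_nhds] with s hs hs'
  exact hs.congr_of_eventuallyEq hs'

theorem cast (hg : HasJet g a b) (ha : c = a) (hb : d = b) : HasJet g c d := by
  rw [ha, hb]; exact hg

theorem const (v : V) : HasJet (fun _ => v) 0 0 :=
  ⟨fun _ => 0, Filter.Eventually.of_forall fun s => hasDerivAt_const s v, rfl,
    hasDerivAt_const _ _⟩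

theorem add (hg : HasJet g a b) (hh : HasJet h c d) :
    HasJet (fun s => g s + h s) (a + c) (b + d) := by
  obtain ⟨g', h1, rfl, h3⟩ := hg
  obtain ⟨h', k1, rfl, k3⟩ := hh
  refine ⟨fun s => g' s + h' s, ?_, rfl, h3.add k3⟩
  filter_upwards [h1, k1] with s hs hs'
  exact hs.add hs'

theorem clm (L : V →L[ℝ] W) (hg : HasJet g a b) : HasJet (fun s => L (g s)) (L a) (L b) := by
  obtain ⟨g', h1, rfl, h3⟩ := hg
  refine ⟨fun s => L (g' s), ?_, rfl, L.hasFDerivAt.comp_hasDerivAt 0 h3⟩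
  filter_upwards [h1] with s hs
  exact L.hasFDerivAt.comp_hasDerivAt s hs

theorem sum {ι : Type*} (s : Finset ι) {g : ι → ℝ → V} {a b : ι → V}
    (hg : ∀ i ∈ s, HasJet (g i) (a i) (b i)) :
    HasJet (fun t => ∑ i ∈ s, g i t) (∑ i ∈ s, a i) (∑ i ∈ s, b i) := by
  classical
  induction s using Finset.induction_on with
  | empty => simpa using const (0 : V)
  | insert i s hi ih =>
    simp only [Finset.sum_insert hi]
    exact (hg i (Finset.mem_insert_self i s)).add
      (ih fun j hj => hg j (Finset.mem_insert_of_mem hj))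

theorem smul {r : ℝ → ℝ} {r1 r2 : ℝ} (hr : HasJet r r1 r2) (hg : HasJet g a b) :
    HasJet (fun s => r s • g s) (r 0 • a + r1 • g 0)
      (r 0 • b + (2 : ℝ) • r1 • a + r2 • g 0) := by
  have hr0 := hr.hasDerivAt
  have hg0 := hg.hasDerivAt
  obtain ⟨g', h1, rfl, h3⟩ := hg
  obtain ⟨r', k1, rfl, k3⟩ := hr
  refine ⟨fun s => r s • g' s + r' s • g s, ?_, rfl, ?_⟩
  · filter_upwards [h1, k1] with s hs hs'
    exact hs'.smul hs
  · refine ((hr0.smul h3).add (k3.smul hg0)).congr_deriv ?_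
    rw [two_smul]; abel

theorem const_smul (r : ℝ) (hg : HasJet g a b) : HasJet (fun s => r • g s) (r • a) (r • b) :=
  hg.clm (r • ContinuousLinearMap.id ℝ V)

theorem mul {p q : ℝ → ℝ} {p1 p2 q1 q2 : ℝ} (hp : HasJet p p1 p2) (hq : HasJet q q1 q2) :
    HasJet (fun s => p s * q s) (p 0 * q1 + p1 * q 0) (p 0 * q2 + 2 * (p1 * q1) + p2 * q 0) :=
  hp.smul hq

theorem comp {p : ℝ → ℝ} {p1 p2 : ℝ} {φ φ' : ℝ → ℝ} {c : ℝ} (hp : HasJet p p1 p2)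
    (hφ : ∀ᶠ y in 𝓝 (p 0), HasDerivAt φ (φ' y) y) (hφ' : HasDerivAt φ' c (p 0)) :
    HasJet (fun s => φ (p s)) (φ' (p 0) * p1) (c * p1 ^ 2 + φ' (p 0) * p2) := by
  have hp0 := hp.hasDerivAt
  obtain ⟨p', h1, rfl, h3⟩ := hp
  refine ⟨fun s => φ' (p s) * p' s, ?_, rfl, ?_⟩
  · filter_upwards [h1, hp0.continuousAt.eventually hφ] with s hs hs'
    exact hs'.comp s hs
  · refine ((hφ'.comp (0 : ℝ) hp0).mul h3).congr_deriv ?_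
    simp only [Function.comp]
    ring

/-- A positive second derivative would make 0 a local minimum as well, so the function would be
locally constant and its second derivative zero. -/
theorem nonpos_of_isLocalMax {p : ℝ → ℝ} {p1 p2 : ℝ} (hp : HasJet p p1 p2)
    (hmax : IsLocalMax p 0) : p2 ≤ 0 := by
  have hp1 := hmax.hasDerivAt_eq_zero hp.hasDerivAt
  have hc := hp.continuousAt
  obtain ⟨p', h1, rfl, h3⟩ := hp
  by_contra hcon
  push Not at hcon
  have hd : deriv p =ᶠ[𝓝 0] p' := h1.mono fun s hs => hs.deriv
  have hmin : IsLocalMin p 0 := by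
    refine isLocalMin_of_deriv_deriv_pos ?_ (by rw [hd.self_of_nhds, hp1]) hc
    rw [hd.deriv_eq, h3.deriv]
    exact hcon
  have hconst : p =ᶠ[𝓝 0] fun _ => p 0 := by
    filter_upwards [hmax, hmin] with s h1 h2
    exact le_antisymm h1 h2
  have h0 : p' =ᶠ[𝓝 0] fun _ => 0 := by
    filter_upwards [h1, hconst.eventually_nhds] with s hs hs'
    exact (hs.congr_of_eventuallyEq (Filter.EventuallyEq.symm hs')).unique (hasDerivAt_const s _)
  have := (h3.congr_of_eventuallyEq h0.symm).unique (hasDerivAt_const (0 : ℝ) (0 : ℝ))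
  linarith

theorem of_contDiffAt {φ : V → W} (hφ : ContDiffAt ℝ 2 φ 0) (v : V) :
    HasJet (fun s : ℝ => φ (s • v)) (fderiv ℝ φ 0 v) (fderiv ℝ (fderiv ℝ φ) 0 v v) := by
  have hline : ∀ s : ℝ, HasDerivAt (fun s : ℝ => s • v) v s := fun s => by
    simpa using (hasDerivAt_id s).smul_const v
  have hcont : Filter.Tendsto (fun s : ℝ => s • v) (𝓝 0) (𝓝 0) := by
    have := (hline 0).continuousAt.tendsto
    simpa using this
  refine ⟨fun s => fderiv ℝ φ (s • v) v, ?_, by simp, ?_⟩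
  · have h1 : ∀ᶠ y in 𝓝 (0 : V), ContDiffAt ℝ 1 φ y :=
      (hφ.of_le (by norm_num)).eventually (by simp)
    filter_upwards [hcont.eventually h1] with s hs
    exact ((hs.differentiableAt (by simp)).hasFDerivAt).comp_hasDerivAt s (hline s)
  · have h2 : ContDiffAt ℝ 1 (fderiv ℝ φ) 0 := hφ.fderiv_right (by norm_num)
    have h3 := (h2.differentiableAt (by simp)).hasFDerivAt
    rw [← zero_smul ℝ v] at h3
    have h4 := h3.comp_hasDerivAt (0 : ℝ) (hline 0)
    have h5 := (ContinuousLinearMap.apply ℝ W v).hasFDerivAt.comp_hasDerivAt (0 : ℝ) h4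
    simpa [Function.comp_def] using h5

end HasJet

variable {ι : Type*} [Fintype ι] [DecidableEq ι]

/-- Jacobi's formula. The derivative of the multilinear determinant replaces one column at a time,
and Cramer's rule identifies each term with a diagonal entry of adj(Y) Y'. -/
theorem hasDerivAt_det {Y : ℝ → Matrix ι ι ℝ} {Y' : Matrix ι ι ℝ} {s : ℝ}
    (h : ∀ i j, HasDerivAt (fun s => Y s i j) (Y' i j) s) :
    HasDerivAt (fun s => (Y s).det) ((Y s).adjugate * Y').trace s := by
  let D : ContinuousMultilinearMap ℝ (fun _ : ι => ι → ℝ) ℝ :=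
    { (Matrix.detRowAlternating : (ι → ℝ) [⋀^ι]→ₗ[ℝ] ℝ).toMultilinearMap with
      cont := (continuous_id : Continuous fun M : ι → ι → ℝ => M).matrix_det }
  have hD : ∀ M : ι → ι → ℝ, D M = (Matrix.of M).det := fun M => rfl
  have h1 : HasDerivAt (fun s => (fun i j => Y s j i : ι → ι → ℝ)) (fun i j => Y' j i) s :=
    hasDerivAt_pi.2 fun i => hasDerivAt_pi.2 fun j => h j i
  have h2 := (D.hasFDerivAt (fun i j => Y s j i)).comp_hasDerivAt s h1
  have h3 : (fun s => (Y s).det) = D ∘ fun s => (fun i j => Y s j i : ι → ι → ℝ) := by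
    funext s
    rw [Function.comp, hD, ← Matrix.det_transpose]
    rfl
  rw [h3]
  refine h2.congr_deriv ?_
  rw [ContinuousMultilinearMap.linearDeriv_apply, Matrix.trace]
  refine Finset.sum_congr rfl fun i _ => ?_
  rw [hD, Matrix.diag_apply, Matrix.mul_apply]
  have h4 : Matrix.of (Function.update (fun i j => Y s j i) i fun j => Y' j i) =
      ((Y s).updateCol i fun j => Y' j i).transpose := by
    ext k l
    by_cases hk : k = i
    · subst hk; simp
    · simp [hk]
  rw [h4, Matrix.det_transpose, ← Matrix.cramer_apply, Matrix.cramer_eq_adjugate_mulVec]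
  rfl

/-- Differentiating adj(Y) Y = det(Y) 1 at Y = 1 gives the derivative tr(A) 1 - A of the adjugate.
Inserted in Jacobi's formula it produces tr(A)² - tr(A²). -/
theorem HasJet.det {Y : ℝ → Matrix ι ι ℝ} {A B : Matrix ι ι ℝ} (h0 : Y 0 = 1)
    (h : ∀ i j, HasJet (fun s => Y s i j) (A i j) (B i j)) :
    HasJet (fun s => (Y s).det) A.trace (A.trace ^ 2 - (A * A).trace + B.trace) := by
  have hA := fun i j => (h i j).hasDerivAt
  choose Y' h1 h2 h3 using h
  refine ⟨fun s => ((Y s).adjugate * Matrix.of fun i j => Y' i j s).trace, ?_, ?_, ?_⟩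
  · have : ∀ᶠ s in 𝓝 0, ∀ i j, HasDerivAt (fun s => Y s i j) (Y' i j s) s :=
      Filter.eventually_all.2 fun i => Filter.eventually_all.2 fun j => h1 i j
    filter_upwards [this] with s hs
    exact hasDerivAt_det hs
  · have : (Matrix.of fun i j => Y' i j 0) = A := by ext i j; exact h2 i j
    simp only [this, h0, Matrix.adjugate_one, one_mul]
  · -- the derivative of the adjugate matrix at the identity
    have hadj : ∃ Z : Matrix ι ι ℝ, ∀ i j, HasDerivAt (fun s => (Y s).adjugate i j) (Z i j) 0 := by
      have : ∀ i j, ∃ z, HasDerivAt (fun s => (Y s).adjugate i j) z 0 := by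
        intro i j
        simp only [Matrix.adjugate_apply]
        refine ⟨_, hasDerivAt_det (Y' := Matrix.of fun k l => if k = j then 0 else A k l) ?_⟩
        intro k l
        by_cases hk : k = j
        · subst hk; simpa using hasDerivAt_const (0 : ℝ) _
        · simpa [Matrix.updateRow_apply, hk] using hA k l
      choose z hz using this
      exact ⟨Matrix.of z, hz⟩
    obtain ⟨Z, hZ⟩ := hadj
    have hZA : Z = A.trace • (1 : Matrix ι ι ℝ) - A := by
      ext i j
      have e1 : HasDerivAt (fun s => ((Y s).adjugate * Y s) i j)
          ((Z * Y 0 + (Y 0).adjugate * A) i j) 0 := by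
        simp only [Matrix.mul_apply, Matrix.add_apply]
        rw [← Finset.sum_add_distrib]
        exact HasDerivAt.fun_sum fun k _ => (hZ i k).mul (hA k j)
      have e2 : HasDerivAt (fun s => ((Y s).adjugate * Y s) i j)
          ((A.trace • (1 : Matrix ι ι ℝ)) i j) 0 := by
        have := (hasDerivAt_det (s := 0) hA).mul_const ((1 : Matrix ι ι ℝ) i j)
        rw [h0, Matrix.adjugate_one, one_mul] at this
        simpa [Matrix.adjugate_mul] using this
      have e3 := e1.unique e2
      rw [h0, Matrix.adjugate_one, mul_one, one_mul] at e3
      rw [Matrix.sub_apply, ← e3, Matrix.add_apply]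
      ring
    have h4 : HasDerivAt (fun s => ((Y s).adjugate * Matrix.of fun i j => Y' i j s).trace)
        (∑ i, ∑ k, (Z i k * Y' k i 0 + (Y 0).adjugate i k * B k i)) 0 := by
      simp only [Matrix.trace, Matrix.diag_apply, Matrix.mul_apply, Matrix.of_apply]
      exact HasDerivAt.fun_sum fun i _ => HasDerivAt.fun_sum fun k _ => (hZ i k).mul (h3 k i)
    refine h4.congr_deriv ?_
    rw [h0, Matrix.adjugate_one]
    simp only [h2, Finset.sum_add_distrib]
    have e1 : ∑ i, ∑ k, Z i k * A k i = (Z * A).trace := by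
      simp [Matrix.trace, Matrix.mul_apply]
    have e2 : ∑ i, ∑ k, (1 : Matrix ι ι ℝ) i k * B k i = (1 * B).trace := by
      simp only [Matrix.trace, Matrix.mul_apply, Matrix.diag_apply]
    rw [e1, e2, hZA, sub_mul, Matrix.smul_mul, one_mul, one_mul, Matrix.trace_sub,
      Matrix.trace_smul, smul_eq_mul]
    ring

end Jets

/-! ### Plücker coordinates of graphs -/

section Pairing

variable {k N : ℕ}

/-- The number `⟨e₁ ∧ ⋯ ∧ e_k, q₁ ∧ ⋯ ∧ q_k⟩` for an oriented orthonormal basis `e` of `G` and an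
arbitrary tuple `q`. -/
def pairing (G : Grassmannian k N) (q : Fin k → EuclideanSpace ℝ (Fin N)) : ℝ :=
  Quotient.lift (fun e : Frame k N => (gram e.1 q).det) (by
    rintro e e' ⟨A, hA, h⟩
    have h1 := gram_rotate A 1 e.1 q
    rw [rotate_one] at h1
    rw [h, h1, Matrix.det_mul, Matrix.det_mul, (Matrix.mem_specialOrthogonalGroup_iff.1 hA).2]
    simp) G

theorem pairing_mk (e : Frame k N) (q : Fin k → EuclideanSpace ℝ (Fin N)) :
    pairing (Quotient.mk _ e) q = (gram e.1 q).det := rfl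

theorem w_mk_right (G : Grassmannian k N) (p : Frame k N) :
    w G (Quotient.mk _ p) = pairing G p.1 := by
  induction G using Quotient.inductionOn
  rfl

theorem gram_self_of_orthonormal {e : Fin k → EuclideanSpace ℝ (Fin N)} (he : Orthonormal ℝ e) :
    gram e e = 1 := by
  ext i j
  rw [gram, Matrix.of_apply, orthonormal_iff_ite.1 he, Matrix.one_apply]

theorem gram_comm (e q : Fin k → EuclideanSpace ℝ (Fin N)) : gram e q = (gram q e).transpose := by
  ext i j
  simp only [gram, Matrix.of_apply, Matrix.transpose_apply]
  exact real_inner_comm _ _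

theorem w_self (G : Grassmannian k N) : w G G = 1 := by
  induction G using Quotient.inductionOn
  rename_i e
  change (gram e.1 e.1).det = 1
  rw [gram_self_of_orthonormal e.2, Matrix.det_one]

theorem eq_rotate_of_mem_span {e : Fin k → EuclideanSpace ℝ (Fin N)} (he : Orthonormal ℝ e)
    {v : Fin k → EuclideanSpace ℝ (Fin N)} (hv : ∀ i, v i ∈ Submodule.span ℝ (Set.range e)) :
    v = rotate (gram v e) e := by
  funext i
  obtain ⟨c, hc⟩ := (Submodule.mem_span_range_iff_exists_fun ℝ).1 (hv i)
  simp only [rotate, gram, Matrix.of_apply]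
  conv_lhs => rw [← hc]
  refine Finset.sum_congr rfl fun j _ => ?_
  congr 1
  rw [← hc, he.inner_left_fintype]
  simp

theorem det_gram_of_mem_span {e : Fin k → EuclideanSpace ℝ (Fin N)} (he : Orthonormal ℝ e)
    {v : Fin k → EuclideanSpace ℝ (Fin N)} (hv : ∀ i, v i ∈ Submodule.span ℝ (Set.range e))
    (q : Fin k → EuclideanSpace ℝ (Fin N)) :
    (gram v q).det = (gram v e).det * (gram e q).det := by
  have h1 := gram_rotate (gram v e) 1 e q
  rw [rotate_one, ← eq_rotate_of_mem_span he hv] at h1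
  rw [h1, Matrix.det_mul, Matrix.det_mul]
  simp

end Pairing

section Graph

variable {n m N : ℕ} (B : OrthonormalBasis (Option (Fin n) ⊕ Fin m) ℝ (EuclideanSpace ℝ (Fin N)))

/-- The normal vectors `ν_α - ∑ b, ⟪χ b, ν_α⟫ e_b` of the graph spanned by the vectors
`e_b + χ b`. -/
def graphNormal (χ : Option (Fin n) → EuclideanSpace ℝ (Fin N)) :
    Fin m → EuclideanSpace ℝ (Fin N) :=
  fun α => B (Sum.inr α) - ∑ b, ⟪χ b, B (Sum.inr α)⟫_ℝ • B (Sum.inl b)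

/-- The coefficients of `χ` in the normal directions. -/
def normalCoeff (χ : Option (Fin n) → EuclideanSpace ℝ (Fin N)) :
    Matrix (Option (Fin n)) (Fin m) ℝ :=
  Matrix.of fun b α => ⟪χ b, B (Sum.inr α)⟫_ℝ

/-- The coefficients of `q` in the tangential directions. -/
def tangentCoeff (q : Fin m → EuclideanSpace ℝ (Fin N)) : Matrix (Option (Fin n)) (Fin m) ℝ :=
  Matrix.of fun b β => ⟪B (Sum.inl b), q β⟫_ℝ

/-- The frame of the normal directions. -/
def normalPart : Fin m → EuclideanSpace ℝ (Fin N) := fun α => B (Sum.inr α)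

/-- The slopes of the plane spanned by `q`, as a graph over the normal directions. -/
def slopeMatrix (q : Fin m → EuclideanSpace ℝ (Fin N)) : Matrix (Option (Fin n)) (Fin m) ℝ :=
  tangentCoeff B q * (gram (normalPart B) q)⁻¹

/-- The rows of the slope matrix, as normal vectors. -/
def slope (q : Fin m → EuclideanSpace ℝ (Fin N)) (b : Option (Fin n)) :
    EuclideanSpace ℝ (Fin N) :=
  ∑ α, slopeMatrix B q b α • B (Sum.inr α)

theorem orthonormal_normalPart : Orthonormal ℝ (normalPart B) :=
  B.orthonormal.comp _ Sum.inr_injective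

variable {B}

theorem inner_inr_inl (α : Fin m) (b : Option (Fin n)) :
    ⟪B (Sum.inr α), B (Sum.inl b)⟫_ℝ = 0 := by
  rw [orthonormal_iff_ite.1 B.orthonormal]; simp

theorem inner_inl_inl (a b : Option (Fin n)) :
    ⟪B (Sum.inl a), B (Sum.inl b)⟫_ℝ = if a = b then 1 else 0 := by
  rw [orthonormal_iff_ite.1 B.orthonormal]; simp

theorem inner_inr_inr (a b : Fin m) :
    ⟪B (Sum.inr a), B (Sum.inr b)⟫_ℝ = if a = b then 1 else 0 := by
  rw [orthonormal_iff_ite.1 B.orthonormal]; simp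

theorem inner_graphNormal {χ : Option (Fin n) → EuclideanSpace ℝ (Fin N)}
    (hχ : ∀ b c, ⟪χ b, B (Sum.inl c)⟫_ℝ = 0) (α : Fin m) (b : Option (Fin n)) :
    ⟪graphNormal B χ α, B (Sum.inl b) + χ b⟫_ℝ = 0 := by
  rw [graphNormal, inner_sub_left, inner_add_right, inner_add_right, inner_inr_inl, sum_inner,
    sum_inner]
  simp only [real_inner_smul_left, inner_inl_inl]
  have : ∀ c, ⟪B (Sum.inl c), χ b⟫_ℝ = 0 := fun c => by rw [real_inner_comm, hχ]
  simp [this, real_inner_comm]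

theorem gram_graphNormal (χ : Option (Fin n) → EuclideanSpace ℝ (Fin N))
    (q : Fin m → EuclideanSpace ℝ (Fin N)) :
    gram (graphNormal B χ) q =
      gram (normalPart B) q - (normalCoeff B χ).transpose * tangentCoeff B q := by
  ext α β
  simp only [gram, graphNormal, normalPart, normalCoeff, tangentCoeff, Matrix.of_apply,
    Matrix.sub_apply, Matrix.mul_apply, Matrix.transpose_apply, inner_sub_left, sum_inner,
    real_inner_smul_left]

theorem gram_graphNormal_normalPart (χ : Option (Fin n) → EuclideanSpace ℝ (Fin N)) :
    gram (graphNormal B χ) (normalPart B) = 1 := by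
  rw [gram_graphNormal, gram_self_of_orthonormal (orthonormal_normalPart B)]
  have : tangentCoeff B (normalPart B) = 0 := by
    ext b α
    simp only [tangentCoeff, normalPart, Matrix.of_apply, Matrix.zero_apply]
    rw [real_inner_comm, inner_inr_inl]
  rw [this, Matrix.mul_zero, sub_zero]

theorem gram_graphNormal_self (χ : Option (Fin n) → EuclideanSpace ℝ (Fin N)) :
    gram (graphNormal B χ) (graphNormal B χ) =
      1 + (normalCoeff B χ).transpose * normalCoeff B χ := by
  have h1 : tangentCoeff B (graphNormal B χ) = - normalCoeff B χ := by
    ext b α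
    simp only [tangentCoeff, graphNormal, Matrix.of_apply, Matrix.neg_apply, normalCoeff,
      inner_sub_right, inner_sum, real_inner_smul_right, inner_inl_inl]
    rw [real_inner_comm, inner_inr_inl]
    simp
  rw [gram_graphNormal, gram_comm, gram_graphNormal_normalPart, h1]
  simp

theorem det_gram_graphNormal (χ : Option (Fin n) → EuclideanSpace ℝ (Fin N))
    {q : Fin m → EuclideanSpace ℝ (Fin N)} (hq : (gram (normalPart B) q).det ≠ 0) :
    (gram (graphNormal B χ) q).det =
      (1 - (normalCoeff B χ).transpose * slopeMatrix B q).det * (gram (normalPart B) q).det := by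
  rw [gram_graphNormal, ← Matrix.det_mul, slopeMatrix, sub_mul, one_mul, Matrix.mul_assoc,
    Matrix.mul_assoc, Matrix.nonsing_inv_mul _ (Ne.isUnit hq), Matrix.mul_one]

theorem inner_slope (q : Fin m → EuclideanSpace ℝ (Fin N)) (v : EuclideanSpace ℝ (Fin N))
    (b : Option (Fin n)) :
    ⟪v, slope B q b⟫_ℝ = ∑ α, ⟪v, B (Sum.inr α)⟫_ℝ * slopeMatrix B q b α := by
  simp only [slope, inner_sum, real_inner_smul_right]
  exact Finset.sum_congr rfl fun α _ => mul_comm _ _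

theorem inner_slope_slope (q : Fin m → EuclideanSpace ℝ (Fin N)) (b c : Option (Fin n)) :
    ⟪slope B q b, slope B q c⟫_ℝ = ∑ α, slopeMatrix B q b α * slopeMatrix B q c α := by
  rw [inner_slope]
  refine Finset.sum_congr rfl fun α _ => ?_
  simp [slope, sum_inner, real_inner_smul_left, inner_inr_inr]

theorem sum_inner_normal_sq {v : EuclideanSpace ℝ (Fin N)}
    (hv : ∀ c, ⟪v, B (Sum.inl c)⟫_ℝ = 0) : ∑ α, ⟪v, B (Sum.inr α)⟫_ℝ ^ 2 = ‖v‖ ^ 2 := by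
  rw [← B.sum_sq_norm_inner_left v, Fintype.sum_sum_type]
  simp [hv]

/-- Let M and T be the normal and tangential coefficients of q. Orthonormality says MᵀM + TᵀT = 1,
and since the slopes are T M⁻¹, conjugating 1 + ZᵀZ by M gives this identity matrix. -/
theorem det_one_add_slopeMatrix {q : Fin m → EuclideanSpace ℝ (Fin N)} (hq : Orthonormal ℝ q)
    (hq0 : (gram (normalPart B) q).det ≠ 0) :
    (1 + (slopeMatrix B q).transpose * slopeMatrix B q).det =
      ((gram (normalPart B) q).det ^ 2)⁻¹ := by
  set M := gram (normalPart B) q with hM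
  have h1 : M.transpose * M + (tangentCoeff B q).transpose * tangentCoeff B q = 1 := by
    rw [← gram_self_of_orthonormal hq]
    ext i j
    simp only [gram, Matrix.add_apply, Matrix.mul_apply, Matrix.transpose_apply, Matrix.of_apply,
      hM, tangentCoeff, normalPart]
    rw [← B.sum_inner_mul_inner, Fintype.sum_sum_type, add_comm]
    congr 1 <;> exact Finset.sum_congr rfl fun k _ => by rw [real_inner_comm]
  have hU : M * M⁻¹ = 1 := Matrix.mul_nonsing_inv _ (Ne.isUnit hq0)
  have hU' : M⁻¹ * M = 1 := Matrix.nonsing_inv_mul _ (Ne.isUnit hq0)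
  have h2 : M.transpose * (1 + (slopeMatrix B q).transpose * slopeMatrix B q) * M = 1 := by
    rw [Matrix.mul_add, Matrix.add_mul, Matrix.mul_one, slopeMatrix, Matrix.transpose_mul]
    refine Eq.trans ?_ h1
    congr 1
    have hT : M.transpose * (M⁻¹).transpose = 1 := by
      rw [← Matrix.transpose_mul, hU', Matrix.transpose_one]
    calc M.transpose * (M⁻¹.transpose * (tangentCoeff B q).transpose *
          (tangentCoeff B q * M⁻¹)) * M
        = (M.transpose * M⁻¹.transpose) * (tangentCoeff B q).transpose *
          tangentCoeff B q * (M⁻¹ * M) := by simp only [Matrix.mul_assoc]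
      _ = _ := by rw [hT, hU', Matrix.one_mul, Matrix.mul_one]
  have h3 := congrArg Matrix.det h2
  rw [Matrix.det_mul, Matrix.det_mul, Matrix.det_transpose, Matrix.det_one] at h3
  refine eq_inv_of_mul_eq_one_left ?_
  linarith

/-- The rows indexed by `some` are orthogonal, so for them det (1 + Z₁ᵀZ₁) = det (1 + Z₁Z₁ᵀ) is the
determinant of a diagonal matrix. The row `none`, on which nothing is assumed, is a positive rank
one perturbation, and by the matrix determinant lemma it can only increase the determinant. -/
theorem prod_le_det_one_add (Z : Matrix (Option (Fin n)) (Fin m) ℝ)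
    (hZ : ∀ i j : Fin n, i ≠ j → ∑ α, Z (some i) α * Z (some j) α = 0) :
    ∏ j : Fin n, (1 + ∑ α, Z (some j) α ^ 2) ≤ (1 + Z.transpose * Z).det := by
  set Z₁ : Matrix (Fin n) (Fin m) ℝ := Z.submatrix some id with hZ₁
  set A := 1 + Z₁.transpose * Z₁ with hA
  have hdetA : A.det = ∏ j : Fin n, (1 + ∑ α, Z (some j) α ^ 2) := by
    rw [hA, Matrix.det_one_add_mul_comm]
    have : 1 + Z₁ * Z₁.transpose = Matrix.diagonal fun j => 1 + ∑ α, Z (some j) α ^ 2 := by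
      ext i j
      by_cases h : i = j
      · subst h
        simp [Matrix.mul_apply, hZ₁, sq]
      · simp [Matrix.mul_apply, hZ₁, h, hZ i j h]
    rw [this, Matrix.det_diagonal]
  have hApos : A.PosDef := by
    refine Matrix.PosDef.add_posSemidef Matrix.PosDef.one ?_
    have := Matrix.posSemidef_conjTranspose_mul_self Z₁
    rwa [Matrix.conjTranspose_eq_transpose_of_trivial] at this
  have hsplit : 1 + Z.transpose * Z = A + Matrix.replicateCol Unit (Z none) *
      Matrix.replicateRow Unit (Z none) := by
    rw [hA, add_assoc]
    congr 1
    ext i j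
    simp [Matrix.mul_apply, Fintype.sum_option, hZ₁, add_comm]
  rw [hsplit, Matrix.det_add_replicateCol_mul_replicateRow hApos.det_pos.ne'.isUnit, hdetA,
    ← hdetA]
  refine le_mul_of_one_le_right hApos.det_pos.le ?_
  rw [Matrix.det_unique]
  have h1 := hApos.inv.posSemidef.dotProduct_mulVec_nonneg (Z none)
  simp only [Matrix.add_apply, Matrix.one_apply_eq, le_add_iff_nonneg_right]
  refine le_trans h1 (le_of_eq ?_)
  rw [Matrix.mul_assoc, Matrix.mul_apply]
  simp only [dotProduct, Pi.star_apply, star_trivial, Matrix.replicateRow_apply]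
  rfl

/-- Converts a lower bound on |w| into the product bound required by the algebraic inequalities: |w|
≥ 1/3 makes the right side at most 9. -/
theorem prod_one_add_slope_le {q : Fin m → EuclideanSpace ℝ (Fin N)} (hq : Orthonormal ℝ q)
    (hq0 : (gram (normalPart B) q).det ≠ 0)
    (hz : ∀ i j : Fin n, i ≠ j → ⟪slope B q (some i), slope B q (some j)⟫_ℝ = 0) :
    ∏ j : Fin n, (1 + ‖slope B q (some j)‖ ^ 2) ≤ ((gram (normalPart B) q).det ^ 2)⁻¹ := by
  rw [← det_one_add_slopeMatrix hq hq0]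
  refine le_trans (le_of_eq ?_) (prod_le_det_one_add (slopeMatrix B q) fun i j hij => ?_)
  · refine Finset.prod_congr rfl fun j _ => ?_
    rw [← real_inner_self_eq_norm_sq, inner_slope_slope]
    simp only [sq]
  · rw [← inner_slope_slope, hz i j hij]

/-- Second order expansion of `w⁻²` along a curve of graphs. -/
theorem hasJet_graph {q : Fin m → EuclideanSpace ℝ (Fin N)}
    {χ : Option (Fin n) → ℝ → EuclideanSpace ℝ (Fin N)}
    {χ1 χ2 : Option (Fin n) → EuclideanSpace ℝ (Fin N)} (hχ : ∀ b, HasJet (χ b) (χ1 b) (χ2 b))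
    (hχ0 : ∀ b, χ b 0 = 0) (hχ1 : ∀ b c, ⟪χ1 b, B (Sum.inl c)⟫_ℝ = 0) :
    HasJet (fun s => (1 + (normalCoeff B fun b => χ b s).transpose *
        normalCoeff B fun b => χ b s).det *
        ((1 - (normalCoeff B fun b => χ b s).transpose * slopeMatrix B q).det ^ 2)⁻¹)
      (2 * ∑ b, ⟪χ1 b, slope B q b⟫_ℝ)
      (4 * (∑ b, ⟪χ1 b, slope B q b⟫_ℝ) ^ 2 +
        2 * ∑ b, ∑ c, ⟪χ1 b, slope B q c⟫_ℝ * ⟪χ1 c, slope B q b⟫_ℝ +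
        2 * ∑ b, ⟪χ2 b, slope B q b⟫_ℝ + 2 * ∑ b, ‖χ1 b‖ ^ 2) := by
  have hc : ∀ b α, HasJet (fun s => ⟪χ b s, B (Sum.inr α)⟫_ℝ) ⟪χ1 b, B (Sum.inr α)⟫_ℝ
      ⟪χ2 b, B (Sum.inr α)⟫_ℝ := by
    intro b α
    simp only [real_inner_comm (B (Sum.inr α))]
    exact (hχ b).clm (innerSL ℝ (B (Sum.inr α)))
  have hc0 : (normalCoeff B fun b => χ b 0) = 0 := by
    ext b α
    simp [normalCoeff, hχ0]
  -- the matrix `1 - χᵀ Z`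
  set A : Matrix (Fin m) (Fin m) ℝ :=
    Matrix.of fun α β => -∑ b, ⟪χ1 b, B (Sum.inr α)⟫_ℝ * slopeMatrix B q b β with hA
  set A' : Matrix (Fin m) (Fin m) ℝ :=
    Matrix.of fun α β => -∑ b, ⟪χ2 b, B (Sum.inr α)⟫_ℝ * slopeMatrix B q b β with hA'
  have hY : HasJet (fun s => (1 - (normalCoeff B fun b => χ b s).transpose *
      slopeMatrix B q).det) A.trace (A.trace ^ 2 - (A * A).trace + A'.trace) := by
    refine HasJet.det (by simp [hc0]) fun α β => ?_
    have h1 := HasJet.sum Finset.univ fun b _ => (hc b α).const_smul (-slopeMatrix B q b β)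
    refine ((HasJet.const ((1 : Matrix (Fin m) (Fin m) ℝ) α β)).add h1).congr ?_ |>.cast ?_ ?_
    · refine Filter.Eventually.of_forall fun s => ?_
      simp [Matrix.sub_apply, Matrix.mul_apply, normalCoeff, sub_eq_add_neg, mul_comm]
    · simp [hA, mul_comm]
    · simp [hA', mul_comm]
  have htrA : A.trace = -∑ b, ⟪χ1 b, slope B q b⟫_ℝ := by
    simp only [Matrix.trace, Matrix.diag_apply, hA, Matrix.of_apply, inner_slope,
      Finset.sum_neg_distrib]
    rw [Finset.sum_comm]
  have htrA' : A'.trace = -∑ b, ⟪χ2 b, slope B q b⟫_ℝ := by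
    simp only [Matrix.trace, Matrix.diag_apply, hA', Matrix.of_apply, inner_slope,
      Finset.sum_neg_distrib]
    rw [Finset.sum_comm]
  -- Cyclicity and transposition turn a trace over normal indices into one over the indices b, c,
  -- where the matrix entries are inner products with the slopes.
  have htrAA : (A * A).trace = ∑ b, ∑ c, ⟪χ1 b, slope B q c⟫_ℝ * ⟪χ1 c, slope B q b⟫_ℝ := by
    have h1 : A = -((normalCoeff B χ1).transpose * slopeMatrix B q) := by
      ext α β
      simp [hA, normalCoeff, Matrix.mul_apply]
    have h2 : ∀ b c, (normalCoeff B χ1 * (slopeMatrix B q).transpose) b c =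
        ⟪χ1 b, slope B q c⟫_ℝ := by
      intro b c
      simp only [inner_slope, Matrix.mul_apply, normalCoeff, Matrix.of_apply,
        Matrix.transpose_apply]
    calc (A * A).trace = ((slopeMatrix B q * (normalCoeff B χ1).transpose) *
          (slopeMatrix B q * (normalCoeff B χ1).transpose)).trace := by
          rw [h1, neg_mul_neg, Matrix.mul_assoc, Matrix.trace_mul_comm]
          simp only [Matrix.mul_assoc]
      _ = ((normalCoeff B χ1 * (slopeMatrix B q).transpose) *
          (normalCoeff B χ1 * (slopeMatrix B q).transpose)).trace := by
          rw [← Matrix.trace_transpose]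
          simp only [Matrix.transpose_mul, Matrix.transpose_transpose]
      _ = _ := by
          simp only [← h2]
          rfl
  -- the matrix `1 + χᵀ χ`
  have hΓ : HasJet (fun s => (1 + (normalCoeff B fun b => χ b s).transpose *
      normalCoeff B fun b => χ b s).det) 0 (2 * ∑ b, ‖χ1 b‖ ^ 2) := by
    have h1 := HasJet.det (Y := fun s => 1 + (normalCoeff B fun b => χ b s).transpose *
      normalCoeff B fun b => χ b s) (A := 0)
      (B := Matrix.of fun α β => ∑ b, 2 * (⟪χ1 b, B (Sum.inr α)⟫_ℝ * ⟪χ1 b, B (Sum.inr β)⟫_ℝ))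
      (by simp [hc0]) (fun α β => by
        have h1 := HasJet.sum Finset.univ fun b _ => (hc b α).mul (hc b β)
        refine ((HasJet.const ((1 : Matrix (Fin m) (Fin m) ℝ) α β)).add h1).congr ?_ |>.cast ?_ ?_
        · refine Filter.Eventually.of_forall fun s => ?_
          simp [Matrix.mul_apply, normalCoeff]
        · simp [hχ0]
        · simp [hχ0])
    refine h1.cast (by simp) ?_
    simp only [Matrix.trace, Matrix.diag_apply, Matrix.of_apply, mul_zero, Matrix.zero_apply,
      Finset.sum_const_zero]
    rw [Finset.sum_comm, Finset.mul_sum]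
    simp only [← Finset.mul_sum, ← sum_inner_normal_sq (hχ1 _), sq]
    ring
  have hinv : ∀ y : ℝ, y ≠ 0 → HasDerivAt (fun y : ℝ => (y ^ 2)⁻¹) (-2 * (y ^ 3)⁻¹) y := by
    intro y hy
    refine ((hasDerivAt_pow 2 y).inv (pow_ne_zero 2 hy)).congr_deriv ?_
    field_simp
    norm_num [mul_comm]
  have hinv2 : HasDerivAt (fun y : ℝ => -2 * (y ^ 3)⁻¹) 6 1 := by
    refine (((hasDerivAt_pow 3 (1 : ℝ)).inv (by norm_num)).const_mul (-2)).congr_deriv ?_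
    norm_num
  have hY0 : (1 - (normalCoeff B fun b => χ b 0).transpose * slopeMatrix B q).det = 1 := by
    simp [hc0]
  have h1 := hY.comp (φ := fun y => (y ^ 2)⁻¹) (φ' := fun y => -2 * (y ^ 3)⁻¹) (c := 6)
    (by rw [hY0]; filter_upwards [eventually_ne_nhds one_ne_zero] with y hy using hinv y hy)
    (by rw [hY0]; exact hinv2)
  refine (hΓ.mul h1).cast ?_ ?_
  · rw [hY0, htrA, hc0]; simp; ring
  · rw [hY0, htrA, htrA', htrAA, hc0]; simp; ring

end Graph

/-! ### Second derivatives and changes of coordinates -/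

/-- The ambient Euclidean space. -/
abbrev Ambient (n m : ℕ) : Type := EuclideanSpace ℝ (Fin (n + m + 1))

/-- The model space of the manifold. -/
abbrev Model (n : ℕ) : Type := EuclideanSpace ℝ (Fin n)

section SecondDerivative

variable {E F W : Type*} [NormedAddCommGroup E] [NormedSpace ℝ E] [NormedAddCommGroup F]
  [NormedSpace ℝ F] [NormedAddCommGroup W] [InnerProductSpace ℝ W]

theorem fderiv_inner_const {G : E → W} {u : E} (hG : DifferentiableAt ℝ G u) (v : W) (a : E) :
    fderiv ℝ (fun y => ⟪v, G y⟫_ℝ) u a = ⟪v, fderiv ℝ G u a⟫_ℝ := by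
  have := ((innerSL ℝ v).hasFDerivAt.comp u hG.hasFDerivAt).fderiv
  simp only [Function.comp_def, innerSL_apply_apply] at this
  rw [this]
  simp

theorem fderiv_fderiv_inner_const {G : E → W} {u : E} (hG : ContDiffAt ℝ 2 G u) (v : W) (a b : E) :
    fderiv ℝ (fderiv ℝ fun y => ⟪v, G y⟫_ℝ) u a b = ⟪v, fderiv ℝ (fderiv ℝ G) u a b⟫_ℝ := by
  have h1 : ∀ᶠ y in 𝓝 u, DifferentiableAt ℝ G y :=
    (hG.eventually (by simp)).mono fun y hy => hy.differentiableAt (by simp)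
  have h2 : (fderiv ℝ fun y => ⟪v, G y⟫_ℝ) =ᶠ[𝓝 u] fun y => (innerSL ℝ v).comp (fderiv ℝ G y) := by
    filter_upwards [h1] with y hy
    ext c
    rw [fderiv_inner_const hy]
    simp
  have h3 : DifferentiableAt ℝ (fderiv ℝ G) u :=
    (hG.fderiv_right (m := 1) (by norm_num)).differentiableAt (by simp)
  rw [h2.fderiv_eq]
  have h4 := ((ContinuousLinearMap.compL ℝ E W ℝ (innerSL ℝ v)).hasFDerivAt.comp u
    h3.hasFDerivAt).fderiv
  simp only [Function.comp_def, ContinuousLinearMap.compL_apply] at h4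
  rw [h4]
  simp

theorem fderiv_fderiv_apply {G : E → F} {u : E} (hG : ContDiffAt ℝ 2 G u) (a b : E) :
    fderiv ℝ (fun y => fderiv ℝ G y b) u a = fderiv ℝ (fderiv ℝ G) u a b := by
  have h3 : DifferentiableAt ℝ (fderiv ℝ G) u :=
    (hG.fderiv_right (m := 1) (by norm_num)).differentiableAt (by simp)
  rw [fderiv_clm_apply h3 (differentiableAt_const b)]
  simp

theorem fderiv_fderiv_comm {G : E → F} {u : E} (hG : ContDiffAt ℝ 2 G u) (a b : E) :
    fderiv ℝ (fderiv ℝ G) u a b = fderiv ℝ (fderiv ℝ G) u b a :=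
  (hG.isSymmSndFDerivAt (by simp)) a b

/-- At a critical zero of `k`, the second derivative of `μ * (k ∘ κ)` is tensorial. -/
theorem fderiv_fderiv_mul_comp {k : F → ℝ} {κ : E → F} {μ : E → ℝ} {u : E}
    (hk : ContDiffAt ℝ 2 k (κ u)) (hκ : ContDiffAt ℝ 2 κ u) (hμ : ContDiffAt ℝ 2 μ u)
    (hk0 : k (κ u) = 0) (hk1 : fderiv ℝ k (κ u) = 0) (a b : E) :
    fderiv ℝ (fderiv ℝ fun y => μ y * k (κ y)) u a b =
      μ u * fderiv ℝ (fderiv ℝ k) (κ u) (fderiv ℝ κ u a) (fderiv ℝ κ u b) := by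
  have hkκ : ContDiffAt ℝ 2 (fun y => k (κ y)) u := hk.comp u hκ
  have hprod : ContDiffAt ℝ 2 (fun y => μ y * k (κ y)) u := hμ.mul hkκ
  rw [← fderiv_fderiv_apply hprod]
  have hκ1 : ∀ᶠ y in 𝓝 u, DifferentiableAt ℝ κ y :=
    (hκ.eventually (by simp)).mono fun y hy => hy.differentiableAt (by simp)
  have hμ1 : ∀ᶠ y in 𝓝 u, DifferentiableAt ℝ μ y :=
    (hμ.eventually (by simp)).mono fun y hy => hy.differentiableAt (by simp)
  have hk2 : ∀ᶠ y in 𝓝 u, DifferentiableAt ℝ k (κ y) :=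
    hκ.continuousAt.eventually
      ((hk.eventually (by simp)).mono fun y hy => hy.differentiableAt (by simp))
  have h1 : (fun y => fderiv ℝ (fun y => μ y * k (κ y)) y b) =ᶠ[𝓝 u]
      fun y => μ y * fderiv ℝ k (κ y) (fderiv ℝ κ y b) + k (κ y) * fderiv ℝ μ y b := by
    filter_upwards [hκ1, hμ1, hk2] with y h1 h2 h3
    have h4 : HasFDerivAt (fun y => k (κ y)) ((fderiv ℝ k (κ y)).comp (fderiv ℝ κ y)) y :=
      h3.hasFDerivAt.comp y h1.hasFDerivAt
    have h5 : fderiv ℝ (fun y => μ y * k (κ y)) y = _ := (h2.hasFDerivAt.mul h4).fderiv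
    rw [h5]
    simp
  rw [h1.fderiv_eq]
  have dκ : DifferentiableAt ℝ κ u := hκ1.self_of_nhds
  have dDk : HasFDerivAt (fderiv ℝ k) (fderiv ℝ (fderiv ℝ k) (κ u)) (κ u) :=
    ((hk.fderiv_right (m := 1) (by norm_num)).differentiableAt (by simp)).hasFDerivAt
  have dDkκ := dDk.comp u dκ.hasFDerivAt
  have dDκ : DifferentiableAt ℝ (fderiv ℝ κ) u :=
    (hκ.fderiv_right (m := 1) (by norm_num)).differentiableAt (by simp)
  have dDκb := dDκ.hasFDerivAt.clm_apply (hasFDerivAt_const b u)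
  have dDμ : DifferentiableAt ℝ (fderiv ℝ μ) u :=
    (hμ.fderiv_right (m := 1) (by norm_num)).differentiableAt (by simp)
  have dDμb := dDμ.hasFDerivAt.clm_apply (hasFDerivAt_const b u)
  have dkκ : HasFDerivAt (fun y => k (κ y)) ((fderiv ℝ k (κ u)).comp (fderiv ℝ κ u)) u :=
    hk2.self_of_nhds.hasFDerivAt.comp u dκ.hasFDerivAt
  have h5 := ((hμ1.self_of_nhds.hasFDerivAt.mul (dDkκ.clm_apply dDκb)).add (dkκ.mul dDμb)).fderiv
  simp only [Function.comp_def] at h5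
  refine (congrArg (fun L => L a) h5).trans ?_
  simp [hk0, hk1]

end SecondDerivative

section Charts

variable {n m : ℕ} {M : Type*} [TopologicalSpace M] [ChartedSpace (Model n) M]

/-- The immersion `f` in the chart at `x`. -/
def inChart (f : M → Ambient n m) (x : M) : Model n → Ambient n m :=
  f ∘ (extChartAt (𝓡 n) x).symm

theorem inChart_extChartAt (f : M → Ambient n m) (x : M) :
    inChart f x (extChartAt (𝓡 n) x x) = f x := by
  simp [inChart]

theorem inChart_eventuallyEq (f : M → Ambient n m) (x : M) :
    ∀ᶠ y in 𝓝 x, inChart f x (extChartAt (𝓡 n) x y) = f y := by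
  filter_upwards [extChartAt_source_mem_nhds (I := 𝓡 n) x] with y hy
  simp only [inChart, Function.comp_apply]
  rw [(extChartAt (𝓡 n) x).left_inv hy]

theorem IsSphereImmersion.contDiffAt_inChart {f : M → Ambient n m} (hf : IsSphereImmersion f)
    (x : M) : ContDiffAt ℝ ∞ (inChart f x) (extChartAt (𝓡 n) x x) := by
  have h := ((contMDiffAt_iff (I := 𝓡 n) (I' := 𝓘(ℝ, Ambient n m))).1 (hf.contMDiff x)).2
  rw [ModelWithCorners.range_eq_univ, contDiffWithinAt_univ] at h
  simpa only [extChartAt_model_space_eq_id, PartialEquiv.refl_coe, Function.id_comp, inChart] using h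

theorem IsSphereImmersion.mdifferentiableAt {f : M → Ambient n m} (hf : IsSphereImmersion f)
    (x : M) : MDifferentiableAt (𝓡 n) 𝓘(ℝ, Ambient n m) f x :=
  hf.contMDiff.mdifferentiableAt (by simp)

theorem differential_eq_fderiv {f : M → Ambient n m} (hf : IsSphereImmersion f) (x : M)
    (u : TangentSpace (𝓡 n) x) :
    differential f x u = fderiv ℝ (inChart f x) (extChartAt (𝓡 n) x x) u := by
  have h := (hf.mdifferentiableAt x).mfderiv
  simp only [differential]
  rw [h]
  simp only [writtenInExtChartAt, extChartAt_model_space_eq_id, PartialEquiv.refl_coe,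
    Function.id_comp, ModelWithCorners.range_eq_univ, fderivWithin_univ]
  rfl

theorem mem_normalSpace_iff {f : M → Ambient n m} {x : M} {v : Ambient n m} :
    v ∈ normalSpace f x ↔ ⟪v, f x⟫_ℝ = 0 ∧ ∀ u, ⟪v, differential f x u⟫_ℝ = 0 := by
  rw [normalSpace, Submodule.mem_orthogonal']
  constructor
  · intro h
    exact ⟨h _ (Submodule.mem_sup_left (Submodule.mem_span_singleton_self _)),
      fun u => h _ (Submodule.mem_sup_right (LinearMap.mem_range_self _ u))⟩
  · rintro ⟨h1, h2⟩ y hy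
    obtain ⟨y1, hy1, y2, ⟨u, rfl⟩, rfl⟩ := Submodule.mem_sup.1 hy
    obtain ⟨c, rfl⟩ := Submodule.mem_span_singleton.1 hy1
    rw [inner_add_right, real_inner_smul_right, h1, h2]
    simp

theorem inner_secondFundamentalForm {f : M → Ambient n m} {x : M} {v : Ambient n m}
    (hv : v ∈ normalSpace f x) (a b : TangentSpace (𝓡 n) x) :
    ⟪v, secondFundamentalForm f x a b⟫_ℝ =
      ⟪v, fderiv ℝ (fderiv ℝ (inChart f x)) (extChartAt (𝓡 n) x x) a b⟫_ℝ := by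
  rw [secondFundamentalForm, ← Submodule.inner_starProjection_left_eq_right,
    Submodule.starProjection_eq_self_iff.2 hv]
  rfl

theorem secondFundamentalForm_mem {f : M → Ambient n m} (x : M) (a b : TangentSpace (𝓡 n) x) :
    secondFundamentalForm f x a b ∈ normalSpace f x :=
  Submodule.starProjection_apply_mem _ _

/-- The differential of a parametrization of `M`. -/
def paramDeriv (X : Model n → M) (u : Model n) : Model n →ₗ[ℝ] TangentSpace (𝓡 n) (X u) :=
  (mfderiv 𝓘(ℝ, Model n) (𝓡 n) X u).toLinearMap

theorem paramDeriv_eq_fderiv {X : Model n → M} {u : Model n}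
    (hX : ContMDiffAt 𝓘(ℝ, Model n) (𝓡 n) 3 X u) (a : Model n) :
    (paramDeriv X u a : Model n) =
      fderiv ℝ (fun y => extChartAt (𝓡 n) (X u) (X y)) u a := by
  rw [paramDeriv, (hX.mdifferentiableAt (by simp)).mfderiv]
  simp only [writtenInExtChartAt, extChartAt_model_space_eq_id, PartialEquiv.refl_symm,
    PartialEquiv.refl_coe, Function.comp_id, modelWithCornersSelf_coe, Set.range_id,
    fderivWithin_univ, id_eq]
  rfl

theorem contDiffAt_chart_param {X : Model n → M} {u : Model n}
    (hX : ContMDiffAt 𝓘(ℝ, Model n) (𝓡 n) 3 X u) :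
    ContDiffAt ℝ 3 (fun y => extChartAt (𝓡 n) (X u) (X y)) u :=
  (ContMDiffAt.comp u (contMDiffAt_extChartAt (I := 𝓡 n) (n := 3) (x := X u)) hX).contDiffAt

theorem fderiv_comp_param {f : M → Ambient n m} (hf : IsSphereImmersion f) {X : Model n → M}
    {u : Model n} (hX : ContMDiffAt 𝓘(ℝ, Model n) (𝓡 n) 3 X u) (a : Model n) :
    fderiv ℝ (fun y => f (X y)) u a =
      differential f (X u) (paramDeriv X u a) := by
  have h := mfderiv_comp u (hf.mdifferentiableAt (X u)) (hX.mdifferentiableAt (by simp))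
  rw [mfderiv_eq_fderiv] at h
  exact congrArg (fun L => L a) h

/-- The normal part of the second derivative of a positive multiple of `f ∘ X` is given by the
second fundamental form. -/
theorem inner_fderiv_fderiv_param {f : M → Ambient n m} (hf : IsSphereImmersion f)
    {X : Model n → M} {u : Model n} (hX : ContMDiffAt 𝓘(ℝ, Model n) (𝓡 n) 3 X u)
    {μ : Model n → ℝ} (hμ : ContDiffAt ℝ 2 μ u) {v : Ambient n m}
    (hv : v ∈ normalSpace f (X u)) (a b : Model n) :
    ⟪v, fderiv ℝ (fderiv ℝ fun y => μ y • f (X y)) u a b⟫_ℝ =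
      μ u * ⟪v, secondFundamentalForm f (X u) (paramDeriv X u a)
        (paramDeriv X u b)⟫_ℝ := by
  set κ : Model n → Model n := fun y => extChartAt (𝓡 n) (X u) (X y) with hκdef
  have hκ : ContDiffAt ℝ 2 κ u := (contDiffAt_chart_param hX).of_le (by norm_num)
  have hF : ContDiffAt ℝ 2 (inChart f (X u)) (κ u) :=
    (hf.contDiffAt_inChart (X u)).of_le (by norm_cast)
  obtain ⟨hv1, hv2⟩ := mem_normalSpace_iff.1 hv
  have hcomp : (fun y => f (X y)) =ᶠ[𝓝 u] fun y => inChart f (X u) (κ y) := by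
    filter_upwards [hX.continuousAt.eventually (inChart_eventuallyEq f (X u))] with y hy
    exact hy.symm
  have hfX : ContDiffAt ℝ 2 (fun y => f (X y)) u :=
    (hF.comp u hκ).congr_of_eventuallyEq hcomp
  have hG : ContDiffAt ℝ 2 (fun y => μ y • f (X y)) u := hμ.smul hfX
  rw [← fderiv_fderiv_inner_const hG v a b]
  -- For normal v the function ⟪v, f⟫ vanishes to first order at the point. Its Hessian is therefore
  -- a tensor: rescaling by μ only multiplies it, and the second derivative of the change of chart κ
  -- does not enter.
  have hfun : (fun y => ⟪v, μ y • f (X y)⟫_ℝ) =ᶠ[𝓝 u]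
      fun y => μ y * (fun p => ⟪v, inChart f (X u) p⟫_ℝ) (κ y) := by
    filter_upwards [hcomp] with y hy
    rw [real_inner_smul_right, hy]
  have hfun2 := hfun.fderiv (𝕜 := ℝ)
  rw [hfun2.fderiv_eq, fderiv_fderiv_mul_comp (k := fun p => ⟪v, inChart f (X u) p⟫_ℝ)
    (contDiffAt_const.inner ℝ hF) hκ hμ, fderiv_fderiv_inner_const hF,
    inner_secondFundamentalForm hv, paramDeriv_eq_fderiv hX, paramDeriv_eq_fderiv hX]
  · simp only [κ, inChart_extChartAt, hv1]
  · ext c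
    rw [fderiv_inner_const (hF.differentiableAt (by simp))]
    exact (congrArg (fun y => ⟪v, y⟫_ℝ) (differential_eq_fderiv hf (X u) c)).symm.trans (hv2 c)

end Charts

/-! ### Central projection charts -/

section Param

variable {n m : ℕ} {M : Type*} [TopologicalSpace M] [ChartedSpace (Model n) M]

/-- The coordinates of the central projection of `M` to the tangent plane spanned by `t`. -/
def gnomonic (f : M → Ambient n m) (x : M) (t : Fin n → Ambient n m) (y : M) : Model n :=
  WithLp.toLp 2 fun i => ⟪f y, t i⟫_ℝ / ⟪f y, f x⟫_ℝ

/-- `t` is an orthonormal basis of the image of the tangent space at `x`. -/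
structure IsTangentFrame (f : M → Ambient n m) (x : M) (t : Fin n → Ambient n m) : Prop where
  orthonormal : Orthonormal ℝ t
  mem : ∀ i, t i ∈ LinearMap.range (differential f x)

theorem IsSphereImmersion.inner_self {f : M → Ambient n m} (hf : IsSphereImmersion f) (x : M) :
    ⟪f x, f x⟫_ℝ = 1 := by
  rw [real_inner_self_eq_norm_sq, hf.norm_eq_one]; norm_num

theorem finrank_range_differential {f : M → Ambient n m} (hf : IsSphereImmersion f) (x : M) :
    Module.finrank ℝ (LinearMap.range (differential f x)) = n := by
  rw [LinearMap.finrank_range_of_inj (hf.injective x)]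
  exact finrank_euclideanSpace_fin

namespace IsTangentFrame

variable {f : M → Ambient n m} {x : M} {t : Fin n → Ambient n m}

theorem span_eq (ht : IsTangentFrame f x t) (hf : IsSphereImmersion f) :
    Submodule.span ℝ (Set.range t) = LinearMap.range (differential f x) := by
  refine Submodule.eq_of_le_of_finrank_eq ?_ ?_
  · rw [Submodule.span_le]
    rintro _ ⟨i, rfl⟩
    exact ht.mem i
  · rw [finrank_span_eq_card ht.orthonormal.linearIndependent, finrank_range_differential hf,
      Fintype.card_fin]

theorem inner_left (ht : IsTangentFrame f x t) (hf : IsSphereImmersion f) (i : Fin n) :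
    ⟪f x, t i⟫_ℝ = 0 := by
  obtain ⟨u, hu⟩ := ht.mem i
  rw [← hu, inner_differential hf]

theorem eq_zero_of_inner_eq_zero (ht : IsTangentFrame f x t) (hf : IsSphereImmersion f)
    {v : Ambient n m} (hv : v ∈ LinearMap.range (differential f x))
    (h : ∀ i, ⟪v, t i⟫_ℝ = 0) : v = 0 := by
  rw [← ht.span_eq hf] at hv
  obtain ⟨c, rfl⟩ := (Submodule.mem_span_range_iff_exists_fun ℝ).1 hv
  refine Finset.sum_eq_zero fun i _ => ?_
  have := h i
  rw [ht.orthonormal.inner_left_fintype] at this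
  simp only [conj_trivial] at this
  rw [this, zero_smul]

theorem mem_normalSpace_iff (ht : IsTangentFrame f x t) (hf : IsSphereImmersion f)
    {v : Ambient n m} : v ∈ normalSpace f x ↔ ⟪v, f x⟫_ℝ = 0 ∧ ∀ i, ⟪v, t i⟫_ℝ = 0 := by
  rw [BernsteinSphere.mem_normalSpace_iff]
  refine and_congr_right fun _ => ⟨fun h i => ?_, fun h u => ?_⟩
  · obtain ⟨u, hu⟩ := ht.mem i
    rw [← hu, h]
  · have hu : differential f x u ∈ Submodule.span ℝ (Set.range t) := by
      rw [ht.span_eq hf]; exact LinearMap.mem_range_self _ u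
    obtain ⟨c, hc⟩ := (Submodule.mem_span_range_iff_exists_fun ℝ).1 hu
    rw [← hc, inner_sum]
    simp [real_inner_smul_right, h]

end IsTangentFrame

variable [IsManifold (𝓡 n) ∞ M]

/-- `M` is locally parametrized by its central projection to the tangent plane. -/
theorem exists_gnomonic_param {f : M → Ambient n m} (hf : IsSphereImmersion f) {x : M}
    {t : Fin n → Ambient n m} (ht : IsTangentFrame f x t) :
    ∃ X : Model n → M, X 0 = x ∧ (∀ᶠ u in 𝓝 0, ContMDiffAt 𝓘(ℝ, Model n) (𝓡 n) 3 X u) ∧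
      (∀ᶠ u in 𝓝 0, 0 < ⟪f (X u), f x⟫_ℝ ∧ gnomonic f x t (X u) = u) ∧
      ∀ᶠ y in 𝓝 x, X (gnomonic f x t y) = y := by
  set G := inChart f x with hG
  set p := extChartAt (𝓡 n) x x with hp
  have hG3 : ContDiffAt ℝ 3 G p := (hf.contDiffAt_inChart x).of_le (by norm_cast)
  have hGp : G p = f x := inChart_extChartAt f x
  set Ψ : Model n → Model n := fun v => WithLp.toLp 2 fun i => ⟪G v, t i⟫_ℝ / ⟪G v, f x⟫_ℝ with hΨ
  have hc0 : ⟪G p, f x⟫_ℝ = 1 := by rw [hGp, hf.inner_self]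
  have hΨ0 : Ψ p = 0 := by
    ext i
    simp [hΨ, hGp, ht.inner_left hf]
  have hΨ3 : ContDiffAt ℝ 3 Ψ p := by
    rw [contDiffAt_euclidean]
    intro i
    exact (hG3.inner ℝ contDiffAt_const).div (hG3.inner ℝ contDiffAt_const) (by rw [hc0]; norm_num)
  have hdΨ : DifferentiableAt ℝ Ψ p := hΨ3.differentiableAt (by simp)
  have hdG : DifferentiableAt ℝ G p := hG3.differentiableAt (by simp)
  set A := fderiv ℝ Ψ p with hA
  -- At p the component Ψ_i vanishes and the denominator equals 1, so differentiating Ψ_i ⟪G, f x⟫ =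
  -- ⟪G, t_i⟫ leaves only the derivative of Ψ_i on the left.
  have hAi : ∀ w i, A w i = ⟪fderiv ℝ G p w, t i⟫_ℝ := by
    intro w i
    have h1 : HasFDerivAt (fun v => Ψ v i) ((EuclideanSpace.proj i).comp A) p :=
      (EuclideanSpace.proj (𝕜 := ℝ) i).hasFDerivAt.comp p hdΨ.hasFDerivAt
    have h2 : HasFDerivAt (fun v => ⟪G v, f x⟫_ℝ) _ p :=
      hdG.hasFDerivAt.inner ℝ (hasFDerivAt_const (f x) p)
    have h3 : HasFDerivAt (fun v => ⟪G v, t i⟫_ℝ) _ p :=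
      hdG.hasFDerivAt.inner ℝ (hasFDerivAt_const (t i) p)
    have h4 : (fun v => Ψ v i * ⟪G v, f x⟫_ℝ) =ᶠ[𝓝 p] fun v => ⟪G v, t i⟫_ℝ := by
      have : ∀ᶠ v in 𝓝 p, ⟪G v, f x⟫_ℝ ≠ 0 :=
        (hdG.continuousAt.inner continuousAt_const).eventually_ne (by rw [hc0]; norm_num)
      filter_upwards [this] with v hv
      simp only [hΨ]
      exact div_mul_cancel₀ _ hv
    have h5 := congrArg (fun L => L w) ((h1.mul h2).unique (h3.congr_of_eventuallyEq h4))
    simp only [add_apply, smul_apply, hc0, hΨ0] at h5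
    simpa [fderivInnerCLM_apply] using h5
  have hAinj : Function.Injective A := by
    rw [injective_iff_map_eq_zero]
    intro w hw
    refine (injective_iff_map_eq_zero (differential f x)).1 (hf.injective x) w ?_
    refine ht.eq_zero_of_inner_eq_zero hf (LinearMap.mem_range_self _ _) fun i => ?_
    have := hAi w i
    rw [hw] at this
    exact (congrArg (fun y => ⟪y, t i⟫_ℝ) (differential_eq_fderiv hf x w)).trans this.symm
  let e : Model n ≃L[ℝ] Model n :=
    (LinearEquiv.ofInjectiveEndo A.toLinearMap hAinj).toContinuousLinearEquiv
  have he : (e : Model n →L[ℝ] Model n) = A := by ext w; rfl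
  have hstrict : HasStrictFDerivAt Ψ (e : Model n →L[ℝ] Model n) p := by
    rw [he]
    exact hΨ3.hasStrictFDerivAt (by simp)
  have hloc3 : ContDiffAt ℝ 3 (hstrict.localInverse Ψ e p) 0 := by
    have := hΨ3.to_localInverse (f' := e) hstrict.hasFDerivAt (by simp)
    rw [hΨ0] at this
    exact this
  set g := hstrict.localInverse Ψ e p with hg
  have hg0 : g 0 = p := by
    have := hstrict.eventually_left_inverse.self_of_nhds
    rwa [hΨ0] at this
  have hgcont : ContinuousAt g 0 := hloc3.continuousAt
  have hgp : Filter.Tendsto g (𝓝 0) (𝓝 p) := by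
    have := hgcont.tendsto
    rwa [hg0] at this
  refine ⟨fun u => (extChartAt (𝓡 n) x).symm (g u), ?_, ?_, ?_, ?_⟩
  · exact (congrArg _ hg0).trans (extChartAt_to_inv (I := 𝓡 n) x)
  · have h1 : ∀ᶠ u in 𝓝 (0 : Model n), ContDiffAt ℝ 3 g u := hloc3.eventually (by simp)
    have h2 : ∀ᶠ u in 𝓝 (0 : Model n), g u ∈ (extChartAt (𝓡 n) x).target :=
      hgp.eventually (extChartAt_target_mem_nhds (I := 𝓡 n) x)
    filter_upwards [h1, h2] with u hu1 hu2
    have h3 : ContMDiffAt 𝓘(ℝ, Model n) (𝓡 n) 3 (extChartAt (𝓡 n) x).symm (g u) :=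
      (contMDiffOn_extChartAt_symm (I := 𝓡 n) x).contMDiffAt
        ((isOpen_extChartAt_target (I := 𝓡 n) x).mem_nhds hu2)
    exact ContMDiffAt.comp u h3 hu1.contMDiffAt
  · have h1 : ∀ᶠ v in 𝓝 p, 0 < ⟪G v, f x⟫_ℝ :=
      (hdG.continuousAt.inner continuousAt_const).eventually_const_lt
        (show 0 < ⟪G p, f x⟫_ℝ by rw [hc0]; norm_num)
    have h2 : ∀ᶠ u in 𝓝 (0 : Model n), Ψ (g u) = u := by
      have := hstrict.eventually_right_inverse
      rwa [hΨ0] at this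
    filter_upwards [hgp.eventually h1, h2] with u hu1 hu2
    exact ⟨hu1, hu2⟩
  · have h1 : ∀ᶠ y in 𝓝 x, g (Ψ (extChartAt (𝓡 n) x y)) = extChartAt (𝓡 n) x y :=
      (continuousAt_extChartAt (I := 𝓡 n) x).eventually hstrict.eventually_left_inverse
    filter_upwards [h1, inChart_eventuallyEq f x, extChartAt_source_mem_nhds (I := 𝓡 n) x]
      with y hy1 hy2 hy3
    have h4 : gnomonic f x t y = Ψ (extChartAt (𝓡 n) x y) := by
      simp only [gnomonic, hΨ, hG, hy2]
    rw [h4, hy1, (extChartAt (𝓡 n) x).left_inv hy3]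

end Param

/-! ### Coordinate independence of the mean curvature vector -/

section MeanCurvature

variable {n m : ℕ} {M : Type*} [TopologicalSpace M] [ChartedSpace (Model n) M]

/-- The second fundamental form as a bilinear map. -/
def secondFundamentalFormₗ (f : M → Ambient n m) (x : M) :
    Model n →ₗ[ℝ] Model n →ₗ[ℝ] Ambient n m :=
  LinearMap.mk₂ ℝ (fun a b => secondFundamentalForm f x a b)
    (fun a a' b => by
      change (normalSpace f x).starProjection (fderiv ℝ (fderiv ℝ _) _ (_ + _) _) = _
      rw [map_add, add_apply, map_add]; rfl)
    (fun c a b => by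
      change (normalSpace f x).starProjection (fderiv ℝ (fderiv ℝ _) _ (_ • _) _) = _
      rw [map_smul, smul_apply, map_smul]; rfl)
    (fun a b b' => by
      change (normalSpace f x).starProjection (fderiv ℝ (fderiv ℝ _) _ _ (_ + _)) = _
      rw [map_add, map_add]; rfl)
    (fun c a b => by
      change (normalSpace f x).starProjection (fderiv ℝ (fderiv ℝ _) _ _ (_ • _)) = _
      rw [map_smul, map_smul]; rfl)

/-- The standard basis vectors of the model space. -/
abbrev stdVec (i : Fin n) : Model n := EuclideanSpace.single i (1 : ℝ)

theorem sum_smul_stdVec (a : Model n) : ∑ i, a i • stdVec i = a := by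
  ext j
  simp [stdVec, Pi.single_apply]

/-- The trace of β with respect to γ does not depend on the basis: if A is the matrix of J, the Gram
matrix becomes AᵀgA, and A (AᵀgA)⁻¹ Aᵀ = g⁻¹. Only A has to be invertible. -/
theorem sum_inv_smul_bilinear {W : Type*} [AddCommGroup W] [Module ℝ W]
    (β : Model n →ₗ[ℝ] Model n →ₗ[ℝ] W) (γ : Model n →ₗ[ℝ] Model n →ₗ[ℝ] ℝ)
    (J : Model n →ₗ[ℝ] Model n) (hJ : Function.Injective J) :
    ∑ i, ∑ j, (Matrix.of fun i j => γ (J (stdVec i)) (J (stdVec j)))⁻¹ i j •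
        β (J (stdVec i)) (J (stdVec j)) =
      ∑ i, ∑ j, (Matrix.of fun i j => γ (stdVec i) (stdVec j))⁻¹ i j •
        β (stdVec i) (stdVec j) := by
  set A : Matrix (Fin n) (Fin n) ℝ := Matrix.of fun k i => J (stdVec i) k with hA
  set g : Matrix (Fin n) (Fin n) ℝ := Matrix.of fun i j => γ (stdVec i) (stdVec j) with hg
  have hJA : ∀ i, J (stdVec i) = ∑ k, A k i • stdVec k := fun i => (sum_smul_stdVec _).symm
  have hdet : IsUnit A.det := by
    have h1 : A = LinearMap.toMatrix (EuclideanSpace.basisFun (Fin n) ℝ).toBasis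
        (EuclideanSpace.basisFun (Fin n) ℝ).toBasis J := by
      ext k i
      simp [hA, LinearMap.toMatrix_apply, stdVec]
    rw [h1, LinearMap.det_toMatrix]
    have h2 : IsUnit J := (LinearMap.isUnit_iff_ker_eq_bot J).2 (LinearMap.ker_eq_bot.2 hJ)
    exact h2.map LinearMap.det
  have hG : (Matrix.of fun i j => γ (J (stdVec i)) (J (stdVec j))) = A.transpose * g * A := by
    ext i j
    rw [Matrix.of_apply, hJA i, hJA j]
    simp only [map_sum, LinearMap.sum_apply, map_smul, LinearMap.smul_apply, smul_eq_mul,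
      Matrix.mul_apply, Matrix.transpose_apply, hg, Matrix.of_apply, Finset.sum_mul]
    refine Finset.sum_congr rfl fun k _ => ?_
    rw [Finset.mul_sum]
    exact Finset.sum_congr rfl fun l _ => by ring
  have hinv : A * (A.transpose * g * A)⁻¹ * A.transpose = g⁻¹ := by
    rw [Matrix.mul_inv_rev, Matrix.mul_inv_rev, ← Matrix.mul_assoc, Matrix.mul_nonsing_inv _ hdet,
      Matrix.one_mul, Matrix.mul_assoc, Matrix.nonsing_inv_mul _ (by rwa [Matrix.det_transpose]),
      Matrix.mul_one]
  rw [hG]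
  set H := (A.transpose * g * A)⁻¹ with hH
  calc ∑ i, ∑ j, H i j • β (J (stdVec i)) (J (stdVec j))
      = ∑ i, ∑ j, ∑ k, ∑ l, (A k i * H i j * A l j) • β (stdVec k) (stdVec l) := by
        refine Finset.sum_congr rfl fun i _ => Finset.sum_congr rfl fun j _ => ?_
        rw [hJA i, hJA j]
        simp only [map_sum, LinearMap.sum_apply, map_smul, LinearMap.smul_apply, Finset.smul_sum,
          smul_smul]
        rw [Finset.sum_comm]
        refine Finset.sum_congr rfl fun k _ => Finset.sum_congr rfl fun l _ => ?_
        congr 1; ring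
    _ = ∑ i, ∑ k, ∑ j, ∑ l, (A k i * H i j * A l j) • β (stdVec k) (stdVec l) :=
        Finset.sum_congr rfl fun i _ => Finset.sum_comm
    _ = ∑ k, ∑ i, ∑ l, ∑ j, (A k i * H i j * A l j) • β (stdVec k) (stdVec l) := by
        rw [Finset.sum_comm]
        exact Finset.sum_congr rfl fun k _ => Finset.sum_congr rfl fun i _ => Finset.sum_comm
    _ = ∑ k, ∑ l, ∑ i, ∑ j, (A k i * H i j * A l j) • β (stdVec k) (stdVec l) :=
        Finset.sum_congr rfl fun k _ => Finset.sum_comm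
    _ = _ := by
        refine Finset.sum_congr rfl fun k _ => Finset.sum_congr rfl fun l _ => ?_
        rw [← hinv]
        simp only [← Finset.sum_smul]
        congr 1
        simp only [Matrix.mul_apply, Matrix.transpose_apply, Finset.sum_mul]
        rw [Finset.sum_comm]

theorem meanCurvature_eq_of_injective (f : M → Ambient n m) (y : M)
    (J : Model n →ₗ[ℝ] TangentSpace (𝓡 n) y) (hJ : Function.Injective J) :
    ∑ i, ∑ j, (Matrix.of fun i j => ⟪differential f y (J (stdVec i)),
      differential f y (J (stdVec j))⟫_ℝ)⁻¹ i j •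
        secondFundamentalForm f y (J (stdVec i)) (J (stdVec j)) = meanCurvature f y := by
  let D : Model n →ₗ[ℝ] Ambient n m := differential f y
  exact sum_inv_smul_bilinear (secondFundamentalFormₗ f y)
    ((innerₗ (Ambient n m)).compl₁₂ D D) J hJ

end MeanCurvature

/-! ### The cone over the submanifold as a graph over its tangent space -/

section GraphMap

variable {n m : ℕ} {M : Type*} [TopologicalSpace M] [ChartedSpace (Model n) M]

/-- `X` parametrizes `M` near `x` by the central projection to the plane spanned by `t`. -/
structure IsGnomonicParam (f : M → Ambient n m) (x : M) (t : Fin n → Ambient n m)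
    (X : Model n → M) : Prop where
  frame : IsTangentFrame f x t
  map_zero : X 0 = x
  contMDiffAt : ∀ᶠ u in 𝓝 0, ContMDiffAt 𝓘(ℝ, Model n) (𝓡 n) 3 X u
  inner_pos : ∀ᶠ u in 𝓝 0, 0 < ⟪f (X u), f x⟫_ℝ
  right_inv : ∀ᶠ u in 𝓝 0, gnomonic f x t (X u) = u
  left_inv : ∀ᶠ y in 𝓝 x, X (gnomonic f x t y) = y

/-- The factor by which `f ∘ X` has to be scaled. -/
def scaleFactor (f : M → Ambient n m) (x : M) (X : Model n → M) (u : Model n) : ℝ :=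
  (⟪f (X u), f x⟫_ℝ)⁻¹

/-- The affine part of the central projection. -/
def affinePart (f : M → Ambient n m) (x : M) (t : Fin n → Ambient n m) (u : Model n) :
    Ambient n m := f x + ∑ i, u i • t i

/-- The cone over `M` is the graph of this function over the tangent plane. -/
def graphMap (f : M → Ambient n m) (x : M) (t : Fin n → Ambient n m) (X : Model n → M)
    (u : Model n) : Ambient n m :=
  scaleFactor f x X u • f (X u) - affinePart f x t u

theorem exists_isGnomonicParam [IsManifold (𝓡 n) ∞ M] {f : M → Ambient n m}
    (hf : IsSphereImmersion f) {x : M} {t : Fin n → Ambient n m} (ht : IsTangentFrame f x t) :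
    ∃ X, IsGnomonicParam f x t X := by
  obtain ⟨X, h1, h2, h3, h4⟩ := exists_gnomonic_param hf ht
  exact ⟨X, ht, h1, h2, h3.mono fun u hu => hu.1, h3.mono fun u hu => hu.2, h4⟩

theorem hasFDerivAt_affinePart (f : M → Ambient n m) (x : M) (t : Fin n → Ambient n m)
    (u : Model n) : HasFDerivAt (affinePart f x t)
      (∑ i, (EuclideanSpace.proj (𝕜 := ℝ) i : Model n →L[ℝ] ℝ).smulRight (t i)) u := by
  refine HasFDerivAt.const_add _ (HasFDerivAt.fun_sum fun i _ => ?_)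
  exact ((EuclideanSpace.proj (𝕜 := ℝ) i : Model n →L[ℝ] ℝ).hasFDerivAt).smul_const (t i)

theorem contDiff_affinePart (f : M → Ambient n m) (x : M) (t : Fin n → Ambient n m) {k : ℕ∞ω} :
    ContDiff ℝ k (affinePart f x t) := by
  unfold affinePart
  refine contDiff_const.add (ContDiff.sum fun i _ => ?_)
  exact (EuclideanSpace.proj (𝕜 := ℝ) i : Model n →L[ℝ] ℝ).contDiff.smul contDiff_const

namespace IsGnomonicParam

variable {f : M → Ambient n m} {x : M} {t : Fin n → Ambient n m} {X : Model n → M}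

theorem contDiffAt_comp (h : IsGnomonicParam f x t X) (hf : IsSphereImmersion f) :
    ∀ᶠ u in 𝓝 0, ContDiffAt ℝ 3 (fun y => f (X y)) u := by
  filter_upwards [h.contMDiffAt] with u hu
  have h1 : ContMDiffAt (𝓡 n) 𝓘(ℝ, Ambient n m) 3 f (X u) :=
    (hf.contMDiff (X u)).of_le (by norm_cast)
  exact (ContMDiffAt.comp u h1 hu).contDiffAt

theorem contDiffAt_scaleFactor (h : IsGnomonicParam f x t X) (hf : IsSphereImmersion f) :
    ∀ᶠ u in 𝓝 0, ContDiffAt ℝ 3 (scaleFactor f x X) u := by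
  filter_upwards [h.contDiffAt_comp hf, h.inner_pos] with u h1 h2
  exact (h1.inner ℝ contDiffAt_const).inv h2.ne'

theorem contDiffAt_scaled (h : IsGnomonicParam f x t X) (hf : IsSphereImmersion f) :
    ∀ᶠ u in 𝓝 0, ContDiffAt ℝ 3 (fun y => scaleFactor f x X y • f (X y)) u := by
  filter_upwards [h.contDiffAt_comp hf, h.contDiffAt_scaleFactor hf] with u h1 h2
  exact h2.smul h1

theorem contDiffAt_graphMap (h : IsGnomonicParam f x t X) (hf : IsSphereImmersion f) :
    ∀ᶠ u in 𝓝 0, ContDiffAt ℝ 3 (graphMap f x t X) u := by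
  filter_upwards [h.contDiffAt_scaled hf] with u h1
  exact h1.sub (contDiff_affinePart f x t).contDiffAt

theorem inner_frame (h : IsGnomonicParam f x t X) :
    ∀ᶠ u in 𝓝 0, ∀ i, ⟪f (X u), t i⟫_ℝ = u i * ⟪f (X u), f x⟫_ℝ := by
  filter_upwards [h.inner_pos, h.right_inv] with u h1 h2 i
  have h3 := congrArg (fun v : Model n => v i) h2
  simp only [gnomonic] at h3
  rw [div_eq_iff h1.ne'] at h3
  exact h3

theorem graphMap_mem (h : IsGnomonicParam f x t X) (hf : IsSphereImmersion f) :
    ∀ᶠ u in 𝓝 0, graphMap f x t X u ∈ normalSpace f x := by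
  filter_upwards [h.inner_pos, h.inner_frame] with u h1 h2
  rw [h.frame.mem_normalSpace_iff hf]
  have ht0 : ∀ i, ⟪t i, f x⟫_ℝ = 0 := fun i => by
    rw [real_inner_comm]; exact h.frame.inner_left hf i
  constructor
  · simp only [graphMap, scaleFactor, affinePart, inner_sub_left, inner_add_left,
      real_inner_smul_left, sum_inner, ht0, hf.inner_self]
    rw [inv_mul_cancel₀ h1.ne']
    simp
  · intro i
    simp only [graphMap, scaleFactor, affinePart, inner_sub_left, inner_add_left,
      real_inner_smul_left, sum_inner, h2 i, h.frame.inner_left hf,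
      orthonormal_iff_ite.1 h.frame.orthonormal]
    field_simp
    simp

theorem fderiv_scaled (h : IsGnomonicParam f x t X) (hf : IsSphereImmersion f) :
    ∀ᶠ u in 𝓝 0, ∀ a : Model n, fderiv ℝ (fun y => scaleFactor f x X y • f (X y)) u a =
      ∑ i, a i • t i + fderiv ℝ (graphMap f x t X) u a := by
  filter_upwards [h.contDiffAt_graphMap hf] with u h1 a
  have h2 : (fun y => scaleFactor f x X y • f (X y)) =
      fun y => affinePart f x t y + graphMap f x t X y := by
    funext y; simp [graphMap]
  have h3 := ((hasFDerivAt_affinePart f x t u).add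
    (h1.differentiableAt (by simp)).hasFDerivAt).fderiv
  rw [h2]
  refine (congrArg (fun L => L a) h3).trans ?_
  simp [sum_apply]

theorem fderiv_fderiv_scaled (h : IsGnomonicParam f x t X) (hf : IsSphereImmersion f) :
    ∀ᶠ u in 𝓝 0, fderiv ℝ (fderiv ℝ fun y => scaleFactor f x X y • f (X y)) u =
      fderiv ℝ (fderiv ℝ (graphMap f x t X)) u := by
  have h1 : ∀ᶠ u in 𝓝 0, (fderiv ℝ fun y => scaleFactor f x X y • f (X y)) u =
      (∑ i, (EuclideanSpace.proj (𝕜 := ℝ) i : Model n →L[ℝ] ℝ).smulRight (t i)) +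
        fderiv ℝ (graphMap f x t X) u := by
    filter_upwards [h.fderiv_scaled hf] with u hu
    ext1 a
    rw [hu a]
    simp [sum_apply]
  filter_upwards [h1.eventually_nhds, h.contDiffAt_graphMap hf] with u hu hu2
  rw [Filter.EventuallyEq.fderiv_eq hu]
  exact fderiv_const_add _

/-- Derivatives of a function with values in a subspace of the form `vᗮ` stay in it. -/
theorem eventually_inner_fderiv {G : Model n → Ambient n m} {v : Ambient n m}
    (hG : ∀ᶠ u in 𝓝 0, DifferentiableAt ℝ G u) (hv : ∀ᶠ u in 𝓝 0, ⟪v, G u⟫_ℝ = 0) :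
    ∀ᶠ u in 𝓝 0, ∀ a, ⟪v, fderiv ℝ G u a⟫_ℝ = 0 := by
  filter_upwards [hG, hv.eventually_nhds] with u h1 h2 a
  rw [← fderiv_inner_const h1, Filter.EventuallyEq.fderiv_eq (f := fun _ => (0 : ℝ)) h2]
  simp

theorem fderiv_mem (h : IsGnomonicParam f x t X) (hf : IsSphereImmersion f)
    {G : Model n → Ambient n m} (hG : ∀ᶠ u in 𝓝 0, DifferentiableAt ℝ G u)
    (hmem : ∀ᶠ u in 𝓝 0, G u ∈ normalSpace f x) :
    ∀ᶠ u in 𝓝 0, ∀ a, fderiv ℝ G u a ∈ normalSpace f x := by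
  have h1 := eventually_inner_fderiv (v := f x) hG (hmem.mono fun u hu => by
    rw [real_inner_comm]; exact ((h.frame.mem_normalSpace_iff hf).1 hu).1)
  have h2 := fun i => eventually_inner_fderiv (v := t i) hG (hmem.mono fun u hu => by
    rw [real_inner_comm]; exact ((h.frame.mem_normalSpace_iff hf).1 hu).2 i)
  filter_upwards [h1, Filter.eventually_all.2 h2] with u hu1 hu2 a
  refine (h.frame.mem_normalSpace_iff hf).2 ⟨?_, fun i => ?_⟩
  · rw [real_inner_comm]; exact hu1 a
  · rw [real_inner_comm]; exact hu2 i a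

theorem fderiv_graphMap_mem (h : IsGnomonicParam f x t X) (hf : IsSphereImmersion f) :
    ∀ᶠ u in 𝓝 0, ∀ a, fderiv ℝ (graphMap f x t X) u a ∈ normalSpace f x :=
  h.fderiv_mem hf ((h.contDiffAt_graphMap hf).mono fun u hu => hu.differentiableAt (by simp))
    (h.graphMap_mem hf)

theorem contDiffAt_fderiv_graphMap (h : IsGnomonicParam f x t X) (hf : IsSphereImmersion f) :
    ∀ᶠ u in 𝓝 0, ∀ a, ContDiffAt ℝ 2 (fun y => fderiv ℝ (graphMap f x t X) y a) u := by
  filter_upwards [h.contDiffAt_graphMap hf] with u hu a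
  exact (hu.fderiv_right (m := 2) (by norm_num)).clm_apply contDiffAt_const

theorem fderiv_fderiv_graphMap_mem (h : IsGnomonicParam f x t X) (hf : IsSphereImmersion f) :
    ∀ᶠ u in 𝓝 0, ∀ a (i : Fin n),
      fderiv ℝ (fderiv ℝ (graphMap f x t X)) u a (stdVec i) ∈ normalSpace f x := by
  have h1 := fun i : Fin n => h.fderiv_mem hf
    (G := fun y => fderiv ℝ (graphMap f x t X) y (stdVec i))
    ((h.contDiffAt_fderiv_graphMap hf).mono fun u hu => (hu _).differentiableAt (by simp))
    ((h.fderiv_graphMap_mem hf).mono fun u hu => hu _)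
  filter_upwards [Filter.eventually_all.2 h1, h.contDiffAt_graphMap hf] with u hu hu2 a i
  rw [← fderiv_fderiv_apply (hu2.of_le (by norm_num))]
  exact hu i a

/-- The derivative of the parametrization is injective. -/
theorem injective_fderiv (h : IsGnomonicParam f x t X) (hf : IsSphereImmersion f) :
    ∀ᶠ u in 𝓝 0, Function.Injective (fderiv ℝ (fun y => f (X y)) u) := by
  filter_upwards [h.inner_frame.eventually_nhds, h.contDiffAt_comp hf, h.inner_pos] with u h1 h2 h3
  rw [injective_iff_map_eq_zero]
  intro a ha
  have hd : DifferentiableAt ℝ (fun y => f (X y)) u := h2.differentiableAt (by simp)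
  have hdc := fderiv_inner_const hd (f x) a
  rw [ha, inner_zero_right] at hdc
  ext i
  have hdi := fderiv_inner_const hd (t i) a
  rw [ha, inner_zero_right] at hdi
  have heq : (fun y => ⟪t i, f (X y)⟫_ℝ) =ᶠ[𝓝 u] fun y : Model n => y i * ⟪f x, f (X y)⟫_ℝ := by
    filter_upwards [h1] with y hy
    rw [real_inner_comm, hy i, real_inner_comm]
  rw [heq.fderiv_eq] at hdi
  have hprod := ((EuclideanSpace.proj (𝕜 := ℝ) i : Model n →L[ℝ] ℝ).hasFDerivAt (x := u)).mul
    ((differentiableAt_const (f x)).inner ℝ hd).hasFDerivAt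
  have h5 : fderiv ℝ (fun y : Model n => y i * ⟪f x, f (X y)⟫_ℝ) u = _ := hprod.fderiv
  rw [h5] at hdi
  simp only [add_apply, smul_apply, PiLp.proj_apply, smul_eq_mul, hdc, mul_zero,
    zero_add] at hdi
  rw [real_inner_comm] at hdi
  exact (mul_eq_zero.1 hdi).resolve_left h3.ne'

theorem injective_paramDeriv (h : IsGnomonicParam f x t X) (hf : IsSphereImmersion f) :
    ∀ᶠ u in 𝓝 0, Function.Injective (paramDeriv X u) := by
  filter_upwards [h.injective_fderiv hf, h.contMDiffAt] with u h1 h2 a b hab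
  refine h1 ?_
  rw [fderiv_comp_param hf h2, fderiv_comp_param hf h2, hab]

theorem surjective_paramDeriv (h : IsGnomonicParam f x t X) (hf : IsSphereImmersion f) :
    ∀ᶠ u in 𝓝 0, Function.Surjective (paramDeriv X u) := by
  filter_upwards [h.injective_paramDeriv hf] with u h1
  exact (LinearMap.injective_iff_surjective (f := (paramDeriv X u : Model n →ₗ[ℝ] Model n))).1 h1

/-- Differentiating the scaling factor adds only a multiple of f (X u), to which a normal vector is
already orthogonal; moreover the derivative of X is onto the tangent space. -/
theorem mem_normalSpace_iff_scaled (h : IsGnomonicParam f x t X) (hf : IsSphereImmersion f) :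
    ∀ᶠ u in 𝓝 0, ∀ v, v ∈ normalSpace f (X u) ↔
      ⟪v, scaleFactor f x X u • f (X u)⟫_ℝ = 0 ∧
        ∀ a, ⟪v, fderiv ℝ (fun y => scaleFactor f x X y • f (X y)) u a⟫_ℝ = 0 := by
  filter_upwards [h.surjective_paramDeriv hf, h.contMDiffAt, h.inner_pos, h.contDiffAt_comp hf,
    h.contDiffAt_scaleFactor hf] with u h1 h2 h3 h4 h5 v
  have hs : scaleFactor f x X u ≠ 0 := inv_ne_zero h3.ne'
  rw [BernsteinSphere.mem_normalSpace_iff, real_inner_smul_right, mul_eq_zero]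
  simp only [hs, false_or]
  refine and_congr_right fun hv => ?_
  have hder : ∀ a, ⟪v, fderiv ℝ (fun y => scaleFactor f x X y • f (X y)) u a⟫_ℝ =
      scaleFactor f x X u * ⟪v, differential f (X u) (paramDeriv X u a)⟫_ℝ := by
    intro a
    have h6 : fderiv ℝ (fun y => scaleFactor f x X y • f (X y)) u = _ :=
      ((h5.differentiableAt (by simp)).hasFDerivAt.smul
        (h4.differentiableAt (by simp)).hasFDerivAt).fderiv
    rw [h6, ← fderiv_comp_param hf h2]
    simp [inner_add_right, real_inner_smul_right, hv]
  simp only [hder, mul_eq_zero, hs, false_or]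
  exact ⟨fun hh a => hh _, fun hh b => by obtain ⟨a, rfl⟩ := h1 b; exact hh a⟩

/-- The tangent space of the cone is spanned by its point and the n coordinate derivatives.
Subtracting u_i times the i-th derivative from the point leaves f x plus a vector of N_x. In this
basis the tangent space is visibly a graph over the position and tangent directions at x. -/
theorem mem_normalSpace_param_iff (h : IsGnomonicParam f x t X) (hf : IsSphereImmersion f) :
    ∀ᶠ u in 𝓝 0, ∀ v, v ∈ normalSpace f (X u) ↔
      ⟪v, f x + (graphMap f x t X u - fderiv ℝ (graphMap f x t X) u u)⟫_ℝ = 0 ∧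
        ∀ i, ⟪v, t i + fderiv ℝ (graphMap f x t X) u (stdVec i)⟫_ℝ = 0 := by
  filter_upwards [h.mem_normalSpace_iff_scaled hf, h.fderiv_scaled hf] with u h1 h2 v
  rw [h1]
  simp only [h2]
  have hval : scaleFactor f x X u • f (X u) =
      f x + (graphMap f x t X u - fderiv ℝ (graphMap f x t X) u u) +
        ∑ i, u i • (t i + fderiv ℝ (graphMap f x t X) u (stdVec i)) := by
    have h3 : fderiv ℝ (graphMap f x t X) u u =
        ∑ i, u i • fderiv ℝ (graphMap f x t X) u (stdVec i) := by
      calc fderiv ℝ (graphMap f x t X) u u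
          = fderiv ℝ (graphMap f x t X) u (∑ i, u i • stdVec i) := by rw [sum_smul_stdVec]
        _ = _ := by simp only [map_sum, map_smul]
    simp only [smul_add, Finset.sum_add_distrib, ← h3]
    simp only [graphMap, affinePart]
    abel
  have hvec : ∀ a : Model n, ∑ i, a i • t i + fderiv ℝ (graphMap f x t X) u a =
      ∑ i, a i • (t i + fderiv ℝ (graphMap f x t X) u (stdVec i)) := by
    intro a
    simp only [smul_add, Finset.sum_add_distrib]
    congr 1
    calc fderiv ℝ (graphMap f x t X) u a
        = fderiv ℝ (graphMap f x t X) u (∑ i, a i • stdVec i) := by rw [sum_smul_stdVec]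
      _ = _ := by simp only [map_sum, map_smul]
  constructor
  · rintro ⟨h3, h4⟩
    have h5 : ∀ i, ⟪v, t i + fderiv ℝ (graphMap f x t X) u (stdVec i)⟫_ℝ = 0 := by
      intro i
      have h6 := h4 (stdVec i)
      rw [hvec, Finset.sum_eq_single i] at h6
      · simpa only [stdVec, PiLp.single_apply, if_true, one_smul] using h6
      · intro j _ hj
        simp only [stdVec, PiLp.single_apply, if_neg hj, zero_smul]
      · simp
    refine ⟨?_, h5⟩
    rw [hval, inner_add_right, inner_sum] at h3
    simpa only [real_inner_smul_right, h5, mul_zero, Finset.sum_const_zero, add_zero] using h3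
  · rintro ⟨h3, h4⟩
    refine ⟨?_, fun a => ?_⟩
    · rw [hval, inner_add_right, inner_sum, h3]
      simp only [real_inner_smul_right, h4, mul_zero, Finset.sum_const_zero, add_zero]
    · rw [hvec, inner_sum]
      simp only [real_inner_smul_right, h4, mul_zero, Finset.sum_const_zero]

end IsGnomonicParam

end GraphMap

/-! ### Second and third derivatives of the graph map at the centre, and the minimal surface system
-/

theorem HasJet.unique {V : Type*} [NormedAddCommGroup V] [NormedSpace ℝ V] {g : ℝ → V}
    {a b a' b' : V} (h : HasJet g a b) (h' : HasJet g a' b') : a = a' ∧ b = b' := by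
  refine ⟨h.hasDerivAt.unique h'.hasDerivAt, ?_⟩
  obtain ⟨g₁, h1, -, h3⟩ := h
  obtain ⟨g₂, k1, -, k3⟩ := h'
  have h4 : g₁ =ᶠ[𝓝 0] g₂ := by
    filter_upwards [h1, k1] with s hs hs'
    exact hs.unique hs'
  exact h3.unique (k3.congr_of_eventuallyEq h4)

theorem hasDerivAt_adjugate_of_deriv_eq_zero {ι : Type*} [Fintype ι] [DecidableEq ι]
    {Y : ℝ → Matrix ι ι ℝ} {s : ℝ} (h : ∀ i j, HasDerivAt (fun s => Y s i j) 0 s) (i j : ι) :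
    HasDerivAt (fun s => (Y s).adjugate i j) 0 s := by
  simp only [Matrix.adjugate_apply]
  have h1 := hasDerivAt_det (Y := fun s => (Y s).updateRow j (Pi.single i 1)) (Y' := 0) (s := s)
    (fun k l => by
      by_cases hk : k = j
      · subst hk
        simpa using hasDerivAt_const s ((Pi.single i (1 : ℝ) : ι → ℝ) l)
      · simpa [Matrix.updateRow_apply, hk] using h k l)
  simpa using h1

namespace IsGnomonicParam

variable {n m : ℕ} {M : Type*} [TopologicalSpace M] [ChartedSpace (Model n) M]
  {f : M → Ambient n m} {x : M} {t : Fin n → Ambient n m} {X : Model n → M}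

theorem scaleFactor_zero (h : IsGnomonicParam f x t X) (hf : IsSphereImmersion f) :
    scaleFactor f x X 0 = 1 := by
  simp [scaleFactor, h.map_zero, hf.norm_eq_one]

theorem graphMap_zero (h : IsGnomonicParam f x t X) (hf : IsSphereImmersion f) :
    graphMap f x t X 0 = 0 := by
  simp [graphMap, affinePart, h.scaleFactor_zero hf, h.map_zero]

/-- At the centre, ∑ a_i t_i plus the derivative of the graph map along a is tangent to the cone,
hence orthogonal to N_x. That derivative itself lies in N_x, so pairing the two shows that it has
norm zero. -/
theorem fderiv_graphMap_zero (h : IsGnomonicParam f x t X) (hf : IsSphereImmersion f) :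
    fderiv ℝ (graphMap f x t X) 0 = 0 := by
  ext1 a
  have h1 := (h.fderiv_graphMap_mem hf).self_of_nhds a
  have h2 := (h.fderiv_scaled hf).self_of_nhds a
  have h3 := ((h.mem_normalSpace_iff_scaled hf).self_of_nhds
    (fderiv ℝ (graphMap f x t X) 0 a)).1 (by rw [h.map_zero]; exact h1)
  have h4 := h3.2 a
  have h5 := ((h.frame.mem_normalSpace_iff hf).1 h1).2
  rw [h2, inner_add_right, inner_sum] at h4
  simp only [real_inner_smul_right, h5, mul_zero, Finset.sum_const_zero, zero_add] at h4
  exact inner_self_eq_zero.1 h4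

theorem fderiv_comp_zero (h : IsGnomonicParam f x t X) (hf : IsSphereImmersion f) (a : Model n) :
    fderiv ℝ (fun y => f (X y)) 0 a = ∑ i, a i • t i := by
  have h2 := (h.fderiv_scaled hf).self_of_nhds a
  rw [h.fderiv_graphMap_zero hf] at h2
  have h4 := (h.contDiffAt_comp hf).self_of_nhds
  have h5 := (h.contDiffAt_scaleFactor hf).self_of_nhds
  have h6 : fderiv ℝ (fun y => scaleFactor f x X y • f (X y)) 0 = _ :=
    ((h5.differentiableAt (by simp)).hasFDerivAt.smul
      (h4.differentiableAt (by simp)).hasFDerivAt).fderiv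
  rw [h6] at h2
  simp only [h.scaleFactor_zero hf, h.map_zero, add_apply, one_smul,
    ContinuousLinearMap.smulRight_apply, zero_apply, add_zero] at h2
  have h7 : ⟪f x, fderiv ℝ (fun y => f (X y)) 0 a⟫_ℝ = 0 := by
    rw [fderiv_comp_param hf h.contMDiffAt.self_of_nhds]
    have := inner_differential hf (X 0) (paramDeriv X 0 a)
    rwa [congrArg f h.map_zero] at this
  have h8 := congrArg (fun y => ⟪f x, y⟫_ℝ) h2
  simp only [inner_add_right, h7, zero_add, real_inner_smul_right, hf.inner_self, mul_one,
    inner_sum, h.frame.inner_left hf, mul_zero, Finset.sum_const_zero] at h8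
  rw [h8, zero_smul, add_zero] at h2
  exact h2

theorem differential_paramDeriv (h : IsGnomonicParam f x t X) (hf : IsSphereImmersion f)
    (a : Model n) : differential f (X 0) (paramDeriv X 0 a) = ∑ i, a i • t i := by
  rw [← fderiv_comp_param hf h.contMDiffAt.self_of_nhds, h.fderiv_comp_zero hf]

theorem fderiv_fderiv_graphMap_zero_mem (h : IsGnomonicParam f x t X) (hf : IsSphereImmersion f)
    (a b : Model n) : fderiv ℝ (fderiv ℝ (graphMap f x t X)) 0 a b ∈ normalSpace f x := by
  have h1 := h.fderiv_mem hf (G := fun y => fderiv ℝ (graphMap f x t X) y b)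
    ((h.contDiffAt_fderiv_graphMap hf).mono fun u hu => (hu _).differentiableAt (by simp))
    ((h.fderiv_graphMap_mem hf).mono fun u hu => hu _)
  rw [← fderiv_fderiv_apply ((h.contDiffAt_graphMap hf).self_of_nhds.of_le (by norm_num))]
  exact h1.self_of_nhds a

theorem fderiv_fderiv_graphMap_zero (h : IsGnomonicParam f x t X) (hf : IsSphereImmersion f)
    (a b : Model n) : fderiv ℝ (fderiv ℝ (graphMap f x t X)) 0 a b =
      secondFundamentalForm f (X 0) (paramDeriv X 0 a) (paramDeriv X 0 b) := by
  have h1 := h.fderiv_fderiv_graphMap_zero_mem hf a b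
  have h2 := secondFundamentalForm_mem (f := f) (X 0) (paramDeriv X 0 a) (paramDeriv X 0 b)
  rw [← sub_eq_zero, ← inner_self_eq_zero (𝕜 := ℝ)]
  set d := fderiv ℝ (fderiv ℝ (graphMap f x t X)) 0 a b -
    secondFundamentalForm f (X 0) (paramDeriv X 0 a) (paramDeriv X 0 b) with hd
  have hN : normalSpace f (X 0) = normalSpace f x := by rw [h.map_zero]
  have hdm : d ∈ normalSpace f (X 0) := sub_mem (by rw [hN]; exact h1) h2
  have h3 := inner_fderiv_fderiv_param hf h.contMDiffAt.self_of_nhds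
    ((h.contDiffAt_scaleFactor hf).self_of_nhds.of_le (by norm_num)) hdm a b
  rw [(h.fderiv_fderiv_scaled hf).self_of_nhds, h.scaleFactor_zero hf, one_mul] at h3
  conv_lhs => rw [hd]
  rw [inner_sub_right, h3, sub_self]

/-- Two normal vectors which are orthogonal to the nearby normal space vanish. -/
theorem eq_zero_of_mem_normalSpace (h : IsGnomonicParam f x t X) (hf : IsSphereImmersion f) :
    ∀ᶠ u in 𝓝 0, ∀ y ∈ normalSpace f x, (∀ v ∈ normalSpace f (X u), ⟪v, y⟫_ℝ = 0) → y = 0 := by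
  filter_upwards [h.mem_normalSpace_param_iff hf, h.graphMap_mem hf, h.fderiv_graphMap_mem hf]
    with u h1 h2 h3 y hy hv
  let A : Option (Fin n) → Ambient n m := fun o => o.elim
    (f x + (graphMap f x t X u - fderiv ℝ (graphMap f x t X) u u))
    fun i => t i + fderiv ℝ (graphMap f x t X) u (stdVec i)
  -- Being orthogonal to the normal space at X u, the vector y is tangent to the cone there. The
  -- tangent space is a graph over the position and tangent directions at x, so membership of y in
  -- N_x kills all coefficients.
  have hK : y ∈ Submodule.span ℝ (Set.range A) := by
    rw [← Submodule.orthogonal_orthogonal (Submodule.span ℝ (Set.range A)),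
      Submodule.mem_orthogonal]
    intro v hvK
    refine hv v ((h1 v).2 ⟨?_, fun i => ?_⟩)
    · exact (Submodule.mem_orthogonal' _ _).1 hvK _ (Submodule.subset_span ⟨none, rfl⟩)
    · exact (Submodule.mem_orthogonal' _ _).1 hvK _ (Submodule.subset_span ⟨some i, rfl⟩)
  obtain ⟨c, hc⟩ := (Submodule.mem_span_range_iff_exists_fun ℝ).1 hK
  rw [Fintype.sum_option] at hc
  simp only [A, Option.elim] at hc
  have hmem := h.frame.mem_normalSpace_iff hf (v := y)
  have hy' := hmem.1 hy
  have hg := (h.frame.mem_normalSpace_iff hf).1 (sub_mem h2 (h3 u))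
  have hg' := fun i => (h.frame.mem_normalSpace_iff hf).1 (h3 (stdVec i))
  have hft := h.frame.inner_left hf
  have htf : ∀ i, ⟪t i, f x⟫_ℝ = 0 := fun i => by rw [real_inner_comm]; exact hft i
  have hnone : c none = 0 := by
    have := hy'.1
    rw [← hc] at this
    simpa only [inner_add_left, real_inner_smul_left, sum_inner, hf.inner_self, hg.1, htf,
      (hg' _).1, mul_zero, add_zero, mul_one, Finset.sum_const_zero] using this
  have hsome : ∀ i, c (some i) = 0 := by
    intro i
    have := hy'.2 i
    rw [← hc] at this
    simpa [inner_add_left, real_inner_smul_left, sum_inner, hft, hg.2, (hg' _).2,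
      orthonormal_iff_ite.1 h.frame.orthonormal, hnone] using this
  rw [← hc, hnone]
  simp [hsome]

/-- The induced metric in the parametrization. -/
def _root_.BernsteinSphere.paramMetric (f : M → Ambient n m) (X : Model n → M) (u : Model n) :
    Matrix (Fin n) (Fin n) ℝ :=
  Matrix.of fun i j => ⟪fderiv ℝ (fun y => f (X y)) u (stdVec i),
    fderiv ℝ (fun y => f (X y)) u (stdVec j)⟫_ℝ

theorem fderiv_comp_zero_stdVec (h : IsGnomonicParam f x t X) (hf : IsSphereImmersion f)
    (i : Fin n) : fderiv ℝ (fun y => f (X y)) 0 (stdVec i) = t i := by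
  rw [h.fderiv_comp_zero hf, Finset.sum_eq_single i]
  · simp [stdVec]
  · intro j _ hj
    simp [stdVec, hj]
  · simp

theorem paramMetric_zero (h : IsGnomonicParam f x t X) (hf : IsSphereImmersion f) :
    paramMetric f X 0 = 1 := by
  ext i j
  simp only [paramMetric, Matrix.of_apply, h.fderiv_comp_zero_stdVec hf,
    orthonormal_iff_ite.1 h.frame.orthonormal, Matrix.one_apply]

/-- The Christoffel symbols of a central projection vanish at its centre. Along a line, ⟪f X, t_k⟫
is the linear function u_k times ⟪f X, f x⟫, and the last factor is stationary at 0; the mixed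
derivatives follow by polarization. -/
theorem inner_fderiv_fderiv_comp_frame (h : IsGnomonicParam f x t X) (hf : IsSphereImmersion f)
    (a b : Model n) (k : Fin n) :
    ⟪t k, fderiv ℝ (fderiv ℝ fun y => f (X y)) 0 a b⟫_ℝ = 0 := by
  have hF : ContDiffAt ℝ 2 (fun y => f (X y)) 0 :=
    (h.contDiffAt_comp hf).self_of_nhds.of_le (by norm_num)
  have hdiag : ∀ a : Model n, ⟪t k, fderiv ℝ (fderiv ℝ fun y => f (X y)) 0 a a⟫_ℝ = 0 := by
    intro a
    have hj := HasJet.of_contDiffAt hF a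
    have h1 := hj.clm (innerSL ℝ (t k))
    have h2 := hj.clm (innerSL ℝ (f x))
    have h3 : HasJet (fun s : ℝ => s * a k) (a k) 0 := by
      have := HasJet.of_contDiffAt (φ := fun y : ℝ => y * a k) (by fun_prop) 1
      refine ⟨fun _ => a k, Filter.Eventually.of_forall fun s => ?_, rfl, hasDerivAt_const _ _⟩
      simpa using (hasDerivAt_id s).mul_const (a k)
    have h4 := h3.mul h2
    have hline : Filter.Tendsto (fun s : ℝ => s • a) (𝓝 0) (𝓝 0) := by
      have : ContinuousAt (fun s : ℝ => s • a) 0 := by fun_prop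
      simpa [ContinuousAt] using this
    have h5 := h1.congr (h := fun s : ℝ => s * a k * innerSL ℝ (f x) (f (X (s • a)))) (by
      filter_upwards [hline.eventually h.inner_frame] with s hs
      simp only [innerSL_apply_apply]
      rw [real_inner_comm, real_inner_comm _ (t k), hs k]
      simp)
    have h6 := (h5.unique h4).2
    simp only [innerSL_apply_apply, zero_mul, zero_add, add_zero] at h6
    rw [h6, h.fderiv_comp_zero hf, inner_sum]
    simp only [real_inner_smul_right, h.frame.inner_left hf]
    simp
  have h1 := hdiag (a + b)
  simp only [map_add, add_apply, inner_add_right, hdiag, zero_add, add_zero,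
    fderiv_fderiv_comm hF b a] at h1
  linarith

theorem hasDerivAt_line (a : Model n) {V : Type*} [NormedAddCommGroup V] [NormedSpace ℝ V]
    {G : Model n → V} (hG : DifferentiableAt ℝ G 0) :
    HasDerivAt (fun s : ℝ => G (s • a)) (fderiv ℝ G 0 a) 0 := by
  have hline : HasDerivAt (fun s : ℝ => s • a) a 0 := by
    simpa using (hasDerivAt_id (0 : ℝ)).smul_const a
  have h0 : HasFDerivAt G (fderiv ℝ G 0) ((fun s : ℝ => s • a) 0) := by
    simpa using hG.hasFDerivAt
  exact h0.comp_hasDerivAt 0 hline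

theorem hasDerivAt_paramMetric (h : IsGnomonicParam f x t X) (hf : IsSphereImmersion f)
    (a : Model n) (i j : Fin n) :
    HasDerivAt (fun s : ℝ => paramMetric f X (s • a) i j) 0 0 := by
  have hF : ContDiffAt ℝ 2 (fun y => f (X y)) 0 :=
    (h.contDiffAt_comp hf).self_of_nhds.of_le (by norm_num)
  have hd : ∀ c : Model n, DifferentiableAt ℝ (fun y => fderiv ℝ (fun y => f (X y)) y c) 0 :=
    fun c => ((hF.fderiv_right (m := 1) (by norm_num)).clm_apply
      contDiffAt_const).differentiableAt (by simp)
  have h1 := (hasDerivAt_line a (hd (stdVec i))).inner ℝ (hasDerivAt_line a (hd (stdVec j)))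
  refine h1.congr_deriv ?_
  simp only [zero_smul, h.fderiv_comp_zero_stdVec hf, fderiv_fderiv_apply hF,
    h.inner_fderiv_fderiv_comp_frame hf]
  rw [real_inner_comm, h.inner_fderiv_fderiv_comp_frame hf, add_zero]

/-- The minimal surface system. -/
theorem sum_inv_paramMetric_smul (h : IsGnomonicParam f x t X) (hf : IsSphereImmersion f)
    (hmin : ∀ x, meanCurvature f x = 0) :
    ∀ᶠ u in 𝓝 0, ∑ i, ∑ j, (paramMetric f X u)⁻¹ i j •
      fderiv ℝ (fderiv ℝ (graphMap f x t X)) u (stdVec i) (stdVec j) = 0 := by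
  filter_upwards [h.eq_zero_of_mem_normalSpace hf, h.fderiv_fderiv_graphMap_mem hf,
    h.contMDiffAt, h.fderiv_fderiv_scaled hf, h.contDiffAt_scaleFactor hf,
    h.injective_paramDeriv hf] with u h1 h2 h3 h4 h5 h6
  -- The sum lies in N_x. Against a vector v normal at X u it equals the scaling factor times ⟪v, H⟫
  -- = 0, so `eq_zero_of_mem_normalSpace` applies.
  refine h1 _ (Submodule.sum_mem _ fun i _ => Submodule.sum_mem _ fun j _ =>
    Submodule.smul_mem _ _ (h2 _ _)) fun v hv => ?_
  have hG : paramMetric f X u = Matrix.of fun i j =>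
      ⟪differential f (X u) (paramDeriv X u (stdVec i)),
        differential f (X u) (paramDeriv X u (stdVec j))⟫_ℝ := by
    ext i j
    simp only [paramMetric, Matrix.of_apply, fderiv_comp_param hf h3]
  have h7 := meanCurvature_eq_of_injective f (X u) (paramDeriv X u) h6
  rw [← hG, hmin] at h7
  have h8 := congrArg (fun y => scaleFactor f x X u * ⟪v, y⟫_ℝ) h7
  simp only [inner_sum, real_inner_smul_right, inner_zero_right, mul_zero, Finset.mul_sum] at h8
  simp only [inner_sum, real_inner_smul_right]
  rw [← h8]
  refine Finset.sum_congr rfl fun i _ => Finset.sum_congr rfl fun j _ => ?_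
  rw [← h4, inner_fderiv_fderiv_param hf h3 (h5.of_le (by norm_num)) hv]
  ring

theorem sum_fderiv_fderiv_graphMap_zero (h : IsGnomonicParam f x t X) (hf : IsSphereImmersion f)
    (hmin : ∀ x, meanCurvature f x = 0) :
    ∑ i, fderiv ℝ (fderiv ℝ (graphMap f x t X)) 0 (stdVec i) (stdVec i) = 0 := by
  have h1 := (h.sum_inv_paramMetric_smul hf hmin).self_of_nhds
  simpa [h.paramMetric_zero hf, Matrix.one_apply] using h1

/-- Multiplying the system by the determinant replaces the inverse metric by its adjugate, whose
entries are determinants and thus easy to differentiate. -/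
theorem sum_adjugate_paramMetric_smul (h : IsGnomonicParam f x t X) (hf : IsSphereImmersion f)
    (hmin : ∀ x, meanCurvature f x = 0) (a : Model n) :
    ∀ᶠ s : ℝ in 𝓝 0, ∑ i, ∑ j, (paramMetric f X (s • a)).adjugate i j •
      fderiv ℝ (fderiv ℝ (graphMap f x t X)) (s • a) (stdVec i) (stdVec j) = 0 := by
  have hline : Filter.Tendsto (fun s : ℝ => s • a) (𝓝 0) (𝓝 0) := by
    have : ContinuousAt (fun s : ℝ => s • a) 0 := by fun_prop
    simpa [ContinuousAt] using this
  have hdet : ∀ᶠ s : ℝ in 𝓝 0, (paramMetric f X (s • a)).det ≠ 0 := by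
    have h1 := hasDerivAt_det (Y := fun s : ℝ => paramMetric f X (s • a)) (Y' := 0) (s := 0)
      (h.hasDerivAt_paramMetric hf a)
    refine h1.continuousAt.eventually_ne ?_
    simp [h.paramMetric_zero hf]
  filter_upwards [hdet, hline.eventually (h.sum_inv_paramMetric_smul hf hmin)] with s h1 h2
  have h3 : (paramMetric f X (s • a)).adjugate =
      (paramMetric f X (s • a)).det • (paramMetric f X (s • a))⁻¹ := by
    rw [Matrix.inv_def, smul_smul, Ring.mul_inverse_cancel _ (isUnit_iff_ne_zero.2 h1), one_smul]
  rw [h3]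
  simp only [Matrix.smul_apply, smul_assoc, ← Finset.smul_sum, h2, smul_zero]

/-- Differentiate the minimal surface system in direction k. The metric, and so its adjugate, is
stationary at the centre, and only the third derivatives of the graph map survive; the rest is
symmetry of derivatives. -/
theorem sum_third_deriv_graphMap_zero (h : IsGnomonicParam f x t X) (hf : IsSphereImmersion f)
    (hmin : ∀ x, meanCurvature f x = 0) (k : Fin n) :
    ∑ i, fderiv ℝ (fderiv ℝ fun y => fderiv ℝ (graphMap f x t X) y (stdVec k)) 0
      (stdVec i) (stdVec i) = 0 := by
  have hφ := h.contDiffAt_graphMap hf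
  have hG := fun c : Model n => (h.contDiffAt_fderiv_graphMap hf).self_of_nhds c
  have hφ2 : ∀ᶠ y in 𝓝 0, ∀ b c, fderiv ℝ (fun y => fderiv ℝ (graphMap f x t X) y c) y b =
      fderiv ℝ (fderiv ℝ (graphMap f x t X)) y b c :=
    hφ.mono fun y hy b c => fderiv_fderiv_apply (hy.of_le (by norm_num)) b c
  have hswap : ∀ i, fderiv ℝ (fderiv ℝ fun y => fderiv ℝ (graphMap f x t X) y (stdVec k)) 0
      (stdVec i) (stdVec i) =
      fderiv ℝ (fun y => fderiv ℝ (fderiv ℝ (graphMap f x t X)) y (stdVec i) (stdVec i)) 0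
        (stdVec k) := by
    intro i
    have e1 : (fun y => fderiv ℝ (fun y => fderiv ℝ (graphMap f x t X) y (stdVec k)) y
        (stdVec i)) =ᶠ[𝓝 0] fun y => fderiv ℝ (fun y => fderiv ℝ (graphMap f x t X) y (stdVec i)) y
        (stdVec k) := by
      filter_upwards [hφ, hφ2] with y hy hy2
      rw [hy2, hy2, fderiv_fderiv_comm (hy.of_le (by norm_num))]
    have e2 : (fun y => fderiv ℝ (fun y => fderiv ℝ (graphMap f x t X) y (stdVec i)) y
        (stdVec i)) =ᶠ[𝓝 0] fun y => fderiv ℝ (fderiv ℝ (graphMap f x t X)) y (stdVec i)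
          (stdVec i) := by
      filter_upwards [hφ2] with y hy2
      rw [hy2]
    rw [← fderiv_fderiv_apply (hG (stdVec k)), e1.fderiv_eq,
      fderiv_fderiv_apply (hG (stdVec i)), fderiv_fderiv_comm (hG (stdVec i)),
      ← fderiv_fderiv_apply (hG (stdVec i)), e2.fderiv_eq]
  simp only [hswap]
  have hd : ∀ i j : Fin n, DifferentiableAt ℝ
      (fun y => fderiv ℝ (fderiv ℝ (graphMap f x t X)) y (stdVec i) (stdVec j)) 0 := by
    intro i j
    have h1 : ContDiffAt ℝ 1 (fderiv ℝ (fderiv ℝ (graphMap f x t X))) 0 :=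
      (hφ.self_of_nhds.fderiv_right (m := 2) (by norm_num)).fderiv_right (by norm_num)
    exact ((h1.clm_apply contDiffAt_const).clm_apply contDiffAt_const).differentiableAt (by simp)
  have hder := HasDerivAt.fun_sum (u := Finset.univ) fun (i : Fin n) _ =>
    HasDerivAt.fun_sum (u := Finset.univ) fun (j : Fin n) _ =>
      (hasDerivAt_adjugate_of_deriv_eq_zero (h.hasDerivAt_paramMetric hf (stdVec k)) i j).smul
        (hasDerivAt_line (stdVec k) (hd i j))
  have h0 := (hasDerivAt_const (0 : ℝ) (0 : Ambient n m)).congr_of_eventuallyEq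
    (h.sum_adjugate_paramMetric_smul hf hmin (stdVec k))
  have := hder.unique h0
  simpa [h.paramMetric_zero hf, Matrix.one_apply] using this

end IsGnomonicParam

/-! ### Pairings as linear functions of the Plücker coordinates -/

section Pairing

variable {k N : ℕ}

/-- `q ↦ ⟨e₁ ∧ ⋯ ∧ e_k, q₁ ∧ ⋯ ∧ q_k⟩` as an alternating map. -/
def gramAlternating (e : Fin k → EuclideanSpace ℝ (Fin N)) :
    EuclideanSpace ℝ (Fin N) [⋀^Fin k]→ₗ[ℝ] ℝ :=
  (Matrix.detRowAlternating : (Fin k → ℝ) [⋀^Fin k]→ₗ[ℝ] ℝ).compLinearMap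
    (LinearMap.pi fun i => innerₗ (EuclideanSpace ℝ (Fin N)) (e i))

theorem gramAlternating_apply (e q : Fin k → EuclideanSpace ℝ (Fin N)) :
    gramAlternating e q = (gram e q).det := by
  rw [← Matrix.det_transpose]
  rfl

/-- Sorting the indices changes the minor by the sign of a permutation, and a repeated index gives
zero. -/
theorem exists_linear_pairing_single (J : Fin k → Fin N) :
    ∃ Λ : ((Fin k ↪o Fin N) → ℝ) →ₗ[ℝ] ℝ, ∀ e : Frame k N,
      gramAlternating e.1 (fun j => EuclideanSpace.single (J j) (1 : ℝ)) =
        Λ (plucker (Quotient.mk _ e)) := by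
  by_cases hJ : Function.Injective J
  · have hcard : (Finset.univ.image J).card = k := by
      rw [Finset.card_image_of_injective _ hJ, Finset.card_univ, Fintype.card_fin]
    let ε : Fin k ↪o Fin N := (Finset.univ.image J).orderEmbOfFin hcard
    have hσ : ∀ j, ∃ i, ε i = J j := by
      intro j
      have : J j ∈ Set.range ε := by
        rw [Finset.range_orderEmbOfFin]
        simp
      exact this
    choose σ hσ using hσ
    have hinj : Function.Injective σ := fun i j hij => hJ (by rw [← hσ, ← hσ, hij])
    let τ : Equiv.Perm (Fin k) := Equiv.ofBijective σ (Finite.injective_iff_bijective.1 hinj)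
    refine ⟨((Equiv.Perm.sign τ : ℤ) : ℝ) • LinearMap.proj ε, fun e => ?_⟩
    have h1 : (fun j => EuclideanSpace.single (J j) (1 : ℝ) : Fin k → EuclideanSpace ℝ (Fin N)) =
        (fun j => EuclideanSpace.single (ε j) (1 : ℝ)) ∘ τ := by
      funext j
      simp [τ, hσ]
    rw [h1, AlternatingMap.map_perm, gramAlternating_apply]
    have h2 : gram e.1 (fun j => EuclideanSpace.single (ε j) (1 : ℝ)) =
        Matrix.of fun i j => e.1 i (ε j) := by
      ext i j
      simp [gram, EuclideanSpace.inner_single_right]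
    rw [h2]
    simp only [LinearMap.smul_apply, LinearMap.proj_apply, smul_eq_mul, Units.smul_def,
      zsmul_eq_mul]
    rfl
  · refine ⟨0, fun e => ?_⟩
    simp only [Function.Injective, not_forall] at hJ
    obtain ⟨i, j, hij, hne⟩ := hJ
    simpa using (gramAlternating e.1).map_eq_zero_of_eq _ (by simp only [hij]) hne

/-- All pairings are linear functions of the Plücker coordinates. -/
theorem exists_linear_pairing (q : Fin k → EuclideanSpace ℝ (Fin N)) :
    ∃ Λ : ((Fin k ↪o Fin N) → ℝ) →ₗ[ℝ] ℝ, ∀ G : Grassmannian k N, pairing G q = Λ (plucker G) := by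
  choose Λ hΛ using exists_linear_pairing_single (k := k) (N := N)
  refine ⟨∑ J, (∏ j, q j (J j)) • Λ J, fun G => ?_⟩
  induction G using Quotient.inductionOn
  rename_i e
  have hq : q = fun j => ∑ l, q j l • EuclideanSpace.single l (1 : ℝ) := by
    funext j
    have := (EuclideanSpace.basisFun (Fin N) ℝ).sum_repr (q j)
    simpa using this.symm
  have h1 : gramAlternating e.1 q = ∑ J : Fin k → Fin N, (∏ j, q j (J j)) *
      gramAlternating e.1 (fun j => EuclideanSpace.single (J j) (1 : ℝ)) := by
    conv_lhs => rw [hq]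
    change (gramAlternating e.1).toMultilinearMap _ = _
    rw [MultilinearMap.map_sum]
    refine Finset.sum_congr rfl fun J _ => ?_
    rw [MultilinearMap.map_smul_univ, smul_eq_mul]
    rfl
  rw [pairing_mk, ← gramAlternating_apply, h1, LinearMap.sum_apply]
  refine Finset.sum_congr rfl fun J _ => ?_
  rw [hΛ J e]
  rfl

/-- The tuple e need not be orthonormal: passing from an oriented orthonormal basis of G to e
multiplies every pairing by the same factor, which the normalization against p removes. -/
theorem pairing_eq_mul_of_mem {e : Fin k → EuclideanSpace ℝ (Fin N)} {G : Grassmannian k N}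
    (he : ∀ i, e i ∈ toSubmodule G) {p : Fin k → EuclideanSpace ℝ (Fin N)}
    (hp : (gram e p).det = 1) (q : Fin k → EuclideanSpace ℝ (Fin N)) :
    pairing G q = (gram e q).det * pairing G p := by
  induction G using Quotient.inductionOn
  rename_i g
  have h1 := det_gram_of_mem_span g.2 (v := e) he p
  have h2 := det_gram_of_mem_span g.2 (v := e) he q
  rw [pairing_mk, pairing_mk, h2]
  rw [hp] at h1
  linear_combination (-(gram g.1 q).det) * (-h1)

theorem pairing_sq_mul_of_mem {e : Fin k → EuclideanSpace ℝ (Fin N)} {G : Grassmannian k N}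
    (he : ∀ i, e i ∈ toSubmodule G) {p : Fin k → EuclideanSpace ℝ (Fin N)}
    (hp : (gram e p).det = 1) : pairing G p ^ 2 * (gram e e).det = 1 := by
  induction G using Quotient.inductionOn
  rename_i g
  have h1 := det_gram_of_mem_span g.2 (v := e) he p
  have h2 := det_gram_of_mem_span g.2 (v := e) he e
  rw [hp] at h1
  rw [pairing_mk, h2, gram_comm g.1 e, Matrix.det_transpose]
  linear_combination ((gram e g.1).det * (gram g.1 p).det + 1) * (-h1)

end Pairing

/-! ### Normal spaces and adapted orthonormal bases -/

section NormalSpace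

variable {n m : ℕ} {M : Type*} [TopologicalSpace M] [ChartedSpace (Model n) M]
  {f : M → Ambient n m}

theorem finrank_normalSpace (hf : IsSphereImmersion f) (x : M) :
    Module.finrank ℝ (normalSpace f x) = m := by
  have hne : f x ≠ 0 := fun h => by have := hf.norm_eq_one x; simp [h] at this
  have h1 := Submodule.finrank_sup_add_finrank_inf_eq (Submodule.span ℝ {f x})
    (LinearMap.range (differential f x))
  have h2 : Submodule.span ℝ {f x} ⊓ LinearMap.range (differential f x) = ⊥ := by
    rw [Submodule.eq_bot_iff]
    rintro y ⟨hy1, u, rfl⟩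
    obtain ⟨c, hc⟩ := Submodule.mem_span_singleton.1 hy1
    have h3 := inner_differential hf x u
    rw [← hc, real_inner_smul_right, hf.inner_self, mul_one] at h3
    rw [← hc, h3, zero_smul]
  rw [h2, finrank_bot, finrank_span_singleton hne, finrank_range_differential hf] at h1
  have h4 := Submodule.finrank_add_finrank_orthogonal
    (Submodule.span ℝ {f x} ⊔ LinearMap.range (differential f x))
  have h5 := h4.trans (finrank_euclideanSpace_fin (𝕜 := ℝ) (n := n + m + 1))
  have h6 := h1.symm.trans (add_zero _)
  rw [← h6] at h5
  change Module.finrank ℝ ↥(Submodule.span ℝ {f x} ⊔ LinearMap.range (differential f x))ᗮ = m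
  omega

theorem span_eq_normalSpace (hf : IsSphereImmersion f) {x : M}
    {ν : Fin m → Ambient n m} (hν : Orthonormal ℝ ν) (hmem : ∀ i, ν i ∈ normalSpace f x) :
    Submodule.span ℝ (Set.range ν) = normalSpace f x := by
  refine Submodule.eq_of_le_of_finrank_eq ?_ ?_
  · rw [Submodule.span_le]
    rintro _ ⟨i, rfl⟩
    exact hmem i
  · rw [finrank_span_eq_card hν.linearIndependent, finrank_normalSpace hf, Fintype.card_fin]

/-- `B` is an orthonormal basis consisting of the position vector, tangent vectors and normal
vectors. -/
structure IsAdapted (f : M → Ambient n m) (x : M)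
    (B : OrthonormalBasis (Option (Fin n) ⊕ Fin m) ℝ (Ambient n m)) : Prop where
  position : B (Sum.inl none) = f x
  tangent : ∀ i, B (Sum.inl (some i)) ∈ LinearMap.range (differential f x)
  normal : ∀ α, B (Sum.inr α) ∈ normalSpace f x

theorem exists_isAdapted (hf : IsSphereImmersion f) {x : M} {t : Fin n → Ambient n m}
    (ht : IsTangentFrame f x t) {ν : Fin m → Ambient n m} (hν : Orthonormal ℝ ν)
    (hmem : ∀ i, ν i ∈ normalSpace f x) :
    ∃ B : OrthonormalBasis (Option (Fin n) ⊕ Fin m) ℝ (Ambient n m), IsAdapted f x B ∧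
      (∀ i, B (Sum.inl (some i)) = t i) ∧ normalPart B = ν := by
  let v : Option (Fin n) ⊕ Fin m → Ambient n m := Sum.elim (fun o => o.elim (f x) t) ν
  have hN := fun α => (ht.mem_normalSpace_iff hf).1 (hmem α)
  have hv : Orthonormal ℝ v := by
    rw [orthonormal_iff_ite]
    rintro ((_ | i) | α) ((_ | j) | β)
    · simp [v, hf.norm_eq_one]
    · simp [v, ht.inner_left hf]
    · simpa [v] using (real_inner_comm _ _).trans (hN β).1
    · simpa [v] using (real_inner_comm _ _).trans (ht.inner_left hf i)
    · simp [v, orthonormal_iff_ite.1 ht.orthonormal]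
    · simpa [v] using (real_inner_comm _ _).trans ((hN β).2 i)
    · simp [v, (hN α).1]
    · simp [v, (hN α).2]
    · simp [v, orthonormal_iff_ite.1 hν]
  have hcard : Module.finrank ℝ (Ambient n m) = Fintype.card (Option (Fin n) ⊕ Fin m) := by
    simp; omega
  obtain ⟨B, hB⟩ := Orthonormal.exists_orthonormalBasis_extension_of_card_eq (v := v)
    (s := Set.univ) hcard (hv.comp _ Subtype.val_injective)
  have hB' : ∀ i, B i = v i := fun i => hB i (Set.mem_univ i)
  refine ⟨B, ⟨hB' _, fun i => ?_, fun α => ?_⟩, fun i => hB' _, ?_⟩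
  · rw [hB']; exact ht.mem i
  · rw [hB']; exact hmem α
  · funext α; exact hB' _

theorem IsAdapted.isTangentFrame {x : M}
    {B : OrthonormalBasis (Option (Fin n) ⊕ Fin m) ℝ (Ambient n m)} (hB : IsAdapted f x B) :
    IsTangentFrame f x fun i => B (Sum.inl (some i)) :=
  ⟨B.orthonormal.comp (fun i => Sum.inl (some i)) fun i j hij => by simpa using hij, hB.tangent⟩

theorem IsAdapted.mem_normalSpace_iff (hf : IsSphereImmersion f) {x : M}
    {B : OrthonormalBasis (Option (Fin n) ⊕ Fin m) ℝ (Ambient n m)} (hB : IsAdapted f x B)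
    {v : Ambient n m} : v ∈ normalSpace f x ↔ ∀ b, ⟪v, B (Sum.inl b)⟫_ℝ = 0 := by
  rw [hB.isTangentFrame.mem_normalSpace_iff hf, Option.forall, hB.position]

variable [IsManifold (𝓡 n) ∞ M] [NeZero n] [NeZero m]

/-- The frame defining the normal Gauss map. -/
def normalFrame (o : ManifoldOrientation n M) (hf : IsSphereImmersion f) (x : M) :
    Frame m (n + m + 1) := (exists_orientedNormalFrame o hf x).choose

theorem isOrientedNormalFrame (o : ManifoldOrientation n M) (hf : IsSphereImmersion f) (x : M) :
    IsOrientedNormalFrame o f x (normalFrame o hf x) :=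
  (exists_orientedNormalFrame o hf x).choose_spec

theorem normalGaussMap_eq (o : ManifoldOrientation n M) (hf : IsSphereImmersion f) (x : M) :
    normalGaussMap o hf x = Quotient.mk _ (normalFrame o hf x) := rfl

theorem toSubmodule_normalGaussMap (o : ManifoldOrientation n M) (hf : IsSphereImmersion f)
    (x : M) : toSubmodule (normalGaussMap o hf x) = normalSpace f x :=
  span_eq_normalSpace hf (normalFrame o hf x).2 (isOrientedNormalFrame o hf x).1

theorem exists_isAdapted_normalFrame (o : ManifoldOrientation n M) (hf : IsSphereImmersion f)
    {x : M} {t : Fin n → Ambient n m} (ht : IsTangentFrame f x t) :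
    ∃ B : OrthonormalBasis (Option (Fin n) ⊕ Fin m) ℝ (Ambient n m), IsAdapted f x B ∧
      (∀ i, B (Sum.inl (some i)) = t i) ∧ normalPart B = (normalFrame o hf x).1 :=
  exists_isAdapted hf ht (normalFrame o hf x).2 (isOrientedNormalFrame o hf x).1

end NormalSpace

/-! ### Determinants of frames made of position, tangent and normal vectors -/

section Determinant

theorem basisFun_det_mul_det {N : ℕ} (A A' : Fin N → EuclideanSpace ℝ (Fin N)) :
    (EuclideanSpace.basisFun (Fin N) ℝ).toBasis.det A *
      (EuclideanSpace.basisFun (Fin N) ℝ).toBasis.det A' = (gram A A').det := by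
  rw [Module.Basis.det_apply, Module.Basis.det_apply, ← Matrix.det_transpose, ← Matrix.det_mul]
  congr 1
  ext i j
  simp [gram, Matrix.mul_apply, Module.Basis.toMatrix_apply, PiLp.inner_apply, mul_comm]

/-- The positions of the vectors in `(p, a₁, …, a_n, ν₁, …, ν_m)`. -/
def consAppendEquiv (n m : ℕ) : (Unit ⊕ Fin n) ⊕ Fin m ≃ Fin (n + m + 1) :=
  Equiv.ofBijective (Sum.elim (Sum.elim (fun _ => 0) fun i => (Fin.castAdd m i).succ)
    fun α => (Fin.natAdd n α).succ) <| by
      rw [Fintype.bijective_iff_surjective_and_card]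
      refine ⟨fun i => ?_, by simp; omega⟩
      refine Fin.cases ⟨Sum.inl (Sum.inl ()), rfl⟩ (fun j => ?_) i
      refine Fin.addCases (fun k => ⟨Sum.inl (Sum.inr k), rfl⟩) (fun k => ⟨Sum.inr k, rfl⟩) j

theorem cons_append_consAppendEquiv {V : Type*} {n m : ℕ} (p : V) (a : Fin n → V) (ν : Fin m → V)
    (s : (Unit ⊕ Fin n) ⊕ Fin m) :
    (Fin.cons p (Fin.append a ν) : Fin (n + m + 1) → V) (consAppendEquiv n m s) =
      Sum.elim (Sum.elim (fun _ => p) a) ν s := by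
  rcases s with ((_ | i) | α)
  · rfl
  · change (Fin.cons p (Fin.append a ν) : Fin (n + m + 1) → V) (Fin.castAdd m i).succ = _
    simp
  · change (Fin.cons p (Fin.append a ν) : Fin (n + m + 1) → V) (Fin.natAdd n α).succ = _
    simp

/-- The product is the determinant of a matrix of inner products, which the orthogonality relations
make block triangular. The tuple ν' is arbitrary because its products with p and a only fill the
block above the diagonal. -/
theorem det_cons_append_mul_det {n m : ℕ} {p : Ambient n m} {a a' : Fin n → Ambient n m}
    {ν : Fin m → Ambient n m} (hp : ⟪p, p⟫_ℝ = 1) (ha : ∀ i, ⟪p, a i⟫_ℝ = 0)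
    (ha' : ∀ i, ⟪p, a' i⟫_ℝ = 0) (hν : ∀ α, ⟪ν α, p⟫_ℝ = 0) (hνa : ∀ α i, ⟪ν α, a' i⟫_ℝ = 0)
    (ν' : Fin m → Ambient n m) :
    (EuclideanSpace.basisFun (Fin (n + m + 1)) ℝ).toBasis.det (Fin.cons p (Fin.append a ν)) *
      (EuclideanSpace.basisFun (Fin (n + m + 1)) ℝ).toBasis.det
        (Fin.cons p (Fin.append a' ν')) =
      (Matrix.of fun i j => ⟪a i, a' j⟫_ℝ).det * (gram ν ν').det := by
  rw [basisFun_det_mul_det, ← Matrix.det_submatrix_equiv_self (consAppendEquiv n m)]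
  have h : (gram (Fin.cons p (Fin.append a ν) : Fin (n + m + 1) → Ambient n m)
      (Fin.cons p (Fin.append a' ν'))).submatrix (consAppendEquiv n m) (consAppendEquiv n m) =
      Matrix.fromBlocks
        (Matrix.fromBlocks (1 : Matrix Unit Unit ℝ) 0 0 (Matrix.of fun i j => ⟪a i, a' j⟫_ℝ))
        (Matrix.of fun s α => ⟪Sum.elim (fun _ => p) a s, ν' α⟫_ℝ) 0 (gram ν ν') := by
    ext s s'
    simp only [gram, Matrix.submatrix_apply, Matrix.of_apply, cons_append_consAppendEquiv]
    rcases s with ((_ | i) | α) <;> rcases s' with ((_ | j) | β)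
    · simpa [inner_self_eq_norm_sq_to_K] using hp
    · simp [ha']
    · simp
    · simpa using (real_inner_comm _ _).trans (ha i)
    · simp
    · simp
    · simp [hν]
    · simp [hνa]
    · simp
  rw [h, Matrix.det_fromBlocks_zero₂₁, Matrix.det_fromBlocks_zero₂₁, Matrix.det_one, one_mul]

end Determinant

/-! ### Orientation and the local sign of the Gauss map -/

section Orientation

variable {n m : ℕ} {M : Type*} [TopologicalSpace M] [ChartedSpace (Model n) M]
  {f : M → Ambient n m}

/-- The determinant of `(f y, df c₁, …, df c_n, q₁, …, q_m)`. -/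
def frameDet (f : M → Ambient n m) (y : M) (a : Fin n → Ambient n m)
    (q : Fin m → Ambient n m) : ℝ :=
  (EuclideanSpace.basisFun (Fin (n + m + 1)) ℝ).toBasis.det (Fin.cons (f y) (Fin.append a q))

theorem frameDet_mul_frameDet (hf : IsSphereImmersion f) {y : M}
    (b c : Fin n → TangentSpace (𝓡 n) y) {ν : Fin m → Ambient n m}
    (hν : ∀ α, ν α ∈ normalSpace f y) (q : Fin m → Ambient n m) :
    frameDet f y (fun i => differential f y (b i)) ν *
        frameDet f y (fun i => differential f y (c i)) q =
      (Matrix.of fun i j => ⟪differential f y (b i), differential f y (c j)⟫_ℝ).det *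
        (gram ν q).det :=
  det_cons_append_mul_det (hf.inner_self y) (fun _ => inner_differential hf y _)
    (fun _ => inner_differential hf y _) (fun α => (mem_normalSpace_iff.1 (hν α)).1)
    (fun α _ => (mem_normalSpace_iff.1 (hν α)).2 _) q

theorem det_inner_differential_basis (y : M)
    (b c : Module.Basis (Fin n) ℝ (TangentSpace (𝓡 n) y)) :
    (Matrix.of fun i j => ⟪differential f y (b i), differential f y (c j)⟫_ℝ).det =
      (Matrix.of fun i j => ⟪differential f y (b i), differential f y (b j)⟫_ℝ).det * b.det c := by
  rw [Module.Basis.det_apply, ← Matrix.det_mul]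
  congr 1
  ext i j
  rw [Matrix.mul_apply]
  simp only [Matrix.of_apply]
  have h1 : differential f y (c j) = ∑ k, b.toMatrix c k j • differential f y (b k) := by
    conv_lhs => rw [← b.sum_toMatrix_smul_self c j]
    rw [map_sum]
    exact Finset.sum_congr rfl fun k _ => map_smul _ _ _
  rw [h1, inner_sum]
  exact Finset.sum_congr rfl fun k _ => by rw [real_inner_smul_right, mul_comm]

variable [IsManifold (𝓡 n) ∞ M]

theorem IsOrientedNormalFrame.frameDet_pos {o : ManifoldOrientation n M}
    (hf : IsSphereImmersion f) {y : M} {ν : Frame m (n + m + 1)}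
    (hν : IsOrientedNormalFrame o f y ν) (c : Module.Basis (Fin n) ℝ (TangentSpace (𝓡 n) y))
    (hc : c.orientation = o.orient y) :
    0 < frameDet f y (fun i => differential f y (c i)) ν.1 := by
  obtain ⟨hmem, b, hb, hpos⟩ := hν
  have hpos' : 0 < frameDet f y (fun i => differential f y (b i)) ν.1 := hpos
  have h1 := frameDet_mul_frameDet hf b b hmem ν.1
  have h2 := frameDet_mul_frameDet hf b c hmem ν.1
  rw [gram_self_of_orthonormal ν.2, Matrix.det_one, mul_one] at h1 h2
  rw [det_inner_differential_basis, ← h1] at h2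
  have h3 : 0 < b.det c := (Module.Basis.orientation_eq_iff_det_pos b c).1 (hb.trans hc.symm)
  have h4 : 0 < frameDet f y (fun i => differential f y (b i)) ν.1 *
      frameDet f y (fun i => differential f y (c i)) ν.1 := by
    rw [h2]; positivity
  exact (pos_iff_pos_of_mul_pos h4).1 hpos'

/-- The inverse of the trivialization of the tangent bundle at `x`, composed with the
differential, is the derivative of `f` in the chart at `x`. -/
theorem differential_trivialization_symm {x y : M}
    (hy : y ∈ (trivializationAt (Model n) (TangentSpace (𝓡 n)) x).baseSet)
    (hd : DifferentiableAt ℝ (inChart f x) (extChartAt (𝓡 n) x y)) (v : Model n) :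
    differential f y (((trivializationAt (Model n) (TangentSpace (𝓡 n)) x).continuousLinearEquivAt
      ℝ y hy).symm v) = fderiv ℝ (inChart f x) (extChartAt (𝓡 n) x y) v := by
  set L := (trivializationAt (Model n) (TangentSpace (𝓡 n)) x).continuousLinearEquivAt ℝ y hy
  have hy' : y ∈ (chartAt (Model n) x).source := by
    simpa using hy
  have h1 : mfderiv (𝓡 n) 𝓘(ℝ, Model n) (extChartAt (𝓡 n) x) y (L.symm v) = v := by
    rw [← TangentBundle.continuousLinearMapAt_trivializationAt hy']
    have : ((trivializationAt (Model n) (TangentSpace (𝓡 n)) x).continuousLinearMapAt ℝ y)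
        (L.symm v) = L (L.symm v) := by
      rw [Bundle.Trivialization.coe_continuousLinearEquivAt_eq _ hy]
    exact this.trans (L.apply_symm_apply v)
  have h2 : f =ᶠ[𝓝 y] inChart f x ∘ extChartAt (𝓡 n) x := by
    have : (extChartAt (𝓡 n) x).source ∈ 𝓝 y :=
      (isOpen_extChartAt_source (I := 𝓡 n) x).mem_nhds (by rwa [extChartAt_source])
    filter_upwards [this] with z hz
    simp only [inChart, Function.comp_apply]
    rw [(extChartAt (𝓡 n) x).left_inv hz]
  have h3 := mfderiv_comp y (I'' := 𝓘(ℝ, Ambient n m)) hd.mdifferentiableAt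
    (mdifferentiableAt_extChartAt (I := 𝓡 n) hy')
  rw [← h2.mfderiv_eq] at h3
  have h4 := congrArg (fun A => A (L.symm v)) h3
  refine Eq.trans h4 ?_
  have h5 := congrArg (mfderiv 𝓘(ℝ, Model n) 𝓘(ℝ, Ambient n m) (inChart f x)
    (extChartAt (𝓡 n) x y)) h1
  refine Eq.trans h5 ?_
  exact congrArg (fun A : Model n →L[ℝ] Ambient n m => A v)
    (mfderiv_eq_fderiv (f := inChart f x) (x := extChartAt (𝓡 n) x y))

variable [NeZero n] [NeZero m]

/-- The normal frames are chosen pointwise, with no continuity built in. The determinant D of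
position, a locally transported positive tangent basis, and the normal frame frozen at x is
continuous and positive at x. Its product with the positive determinant formed with the frame at y
is a positive Gram determinant times w(N_y, N_x). -/
theorem eventually_w_normalGaussMap_pos (o : ManifoldOrientation n M) (hf : IsSphereImmersion f)
    (x : M) : ∀ᶠ y in 𝓝 x, 0 < w (normalGaussMap o hf y) (normalGaussMap o hf x) := by
  obtain ⟨o₀, ho⟩ := o.locally_constant x
  set e := trivializationAt (Model n) (TangentSpace (𝓡 n)) x with he
  have hx : x ∈ e.baseSet := mem_baseSet_trivializationAt _ _ x
  obtain ⟨b₀, hb₀⟩ : ∃ b₀ : Module.Basis (Fin n) ℝ (Model n), b₀.orientation = o₀ :=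
    ⟨Module.Basis.adjustToOrientation (EuclideanSpace.basisFun (Fin n) ℝ).toBasis o₀,
      Module.Basis.orientation_adjustToOrientation _ _⟩
  have hbasis : ∀ᶠ y in 𝓝 x, ∀ hy : y ∈ e.baseSet,
      (b₀.map (e.continuousLinearEquivAt ℝ y hy).symm.toLinearEquiv).orientation =
        o.orient y := by
    filter_upwards [ho] with y hy hy'
    rw [Module.Basis.orientation_map, hb₀, ← hy hy']
    have : ((e.continuousLinearEquivAt ℝ y hy').symm.toLinearEquiv) =
      (e.continuousLinearEquivAt ℝ y hy').toLinearEquiv.symm := rfl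
    rw [this, ← Orientation.map_symm, Equiv.symm_apply_apply]
  set p := extChartAt (𝓡 n) x x with hp
  have hsm := (hf.contDiffAt_inChart x).of_le (show (1 : ℕ∞ω) ≤ ∞ by norm_cast)
  have hdiff : ∀ᶠ y in 𝓝 x, DifferentiableAt ℝ (inChart f x) (extChartAt (𝓡 n) x y) := by
    refine (continuousAt_extChartAt (I := 𝓡 n) x).eventually ?_
    exact (hsm.eventually (by simp)).mono fun z hz => hz.differentiableAt (by simp)
  let D : M → ℝ := fun y => frameDet f y
    (fun i => fderiv ℝ (inChart f x) (extChartAt (𝓡 n) x y) (b₀ i)) (normalFrame o hf x).1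
  have hcont : ContinuousAt D x := by
    have h1 : ContinuousAt (fun y => fderiv ℝ (inChart f x) (extChartAt (𝓡 n) x y)) x :=
      ContinuousAt.comp (f := extChartAt (𝓡 n) x) (g := fderiv ℝ (inChart f x))
        ((hsm.fderiv_right (m := 0) (by norm_num)).continuousAt)
        (continuousAt_extChartAt (I := 𝓡 n) x)
    have h2 : ContinuousAt (fun y => (EuclideanSpace.basisFun (Fin (n + m + 1)) ℝ).toBasis.toMatrix
        (Fin.cons (f y) (Fin.append (fun i => fderiv ℝ (inChart f x) (extChartAt (𝓡 n) x y) (b₀ i))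
          (normalFrame o hf x).1))) x := by
      refine continuousAt_pi.2 fun i => continuousAt_pi.2 fun j => ?_
      simp only [Module.Basis.toMatrix_apply, OrthonormalBasis.coe_toBasis_repr_apply,
        EuclideanSpace.basisFun_repr]
      have h3 : ∀ F : M → Ambient n m, ContinuousAt F x → ContinuousAt (fun y => F y i) x :=
        fun F hF => ((EuclideanSpace.proj (𝕜 := ℝ) i).continuous.continuousAt).comp hF
      refine h3 (fun y => (Fin.cons (f y) (Fin.append (fun i => fderiv ℝ (inChart f x)
        (extChartAt (𝓡 n) x y) (b₀ i)) (normalFrame o hf x).1) :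
          Fin (n + m + 1) → Ambient n m) j) ?_
      refine Fin.cases ?_ (fun j => ?_) j
      · simpa using hf.contMDiff.continuous.continuousAt
      · simp only [Fin.cons_succ]
        refine Fin.addCases (fun k => ?_) (fun k => ?_) j
        · simp only [Fin.append_left]
          exact h1.clm_apply continuousAt_const
        · simp only [Fin.append_right]
          exact continuousAt_const
    have h4 : D = fun y => ((EuclideanSpace.basisFun (Fin (n + m + 1)) ℝ).toBasis.toMatrix
        (Fin.cons (f y) (Fin.append (fun i => fderiv ℝ (inChart f x) (extChartAt (𝓡 n) x y) (b₀ i))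
          (normalFrame o hf x).1))).det := by
      funext y
      rw [← Module.Basis.det_apply]; rfl
    rw [h4]
    exact ContinuousAt.comp (g := Matrix.det) (continuous_id.matrix_det).continuousAt h2
  have hDx : ∀ y, (hy : y ∈ e.baseSet) →
      DifferentiableAt ℝ (inChart f x) (extChartAt (𝓡 n) x y) →
      (fun i => fderiv ℝ (inChart f x) (extChartAt (𝓡 n) x y) (b₀ i)) =
        fun i => differential f y
          (b₀.map (e.continuousLinearEquivAt ℝ y hy).symm.toLinearEquiv i) := by
    intro y hy hdy
    funext i
    rw [← differential_trivialization_symm hy hdy, Module.Basis.map_apply]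
    rfl
  have hpos : 0 < D x := by
    simp only [D]
    rw [hDx x hx hdiff.self_of_nhds]
    exact (isOrientedNormalFrame o hf x).frameDet_pos hf _ (hbasis.self_of_nhds hx)
  filter_upwards [hcont.eventually (lt_mem_nhds hpos), hbasis, hdiff,
    e.open_baseSet.mem_nhds hx] with y h1 h2 h3 h4
  set c := b₀.map (e.continuousLinearEquivAt ℝ y h4).symm.toLinearEquiv with hc
  have h5 := (isOrientedNormalFrame o hf y).frameDet_pos hf c (h2 h4)
  have h6 := frameDet_mul_frameDet hf c c (isOrientedNormalFrame o hf y).1 (normalFrame o hf x).1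
  have h7 := frameDet_mul_frameDet hf c c (isOrientedNormalFrame o hf y).1 (normalFrame o hf y).1
  rw [gram_self_of_orthonormal (normalFrame o hf y).2, Matrix.det_one, mul_one] at h7
  have h8 : D y = frameDet f y (fun i => differential f y (c i)) (normalFrame o hf x).1 := by
    simp only [D]
    rw [hDx y h4 h3]
  rw [← h8, ← h7] at h6
  have h9 : 0 < frameDet f y (fun i => differential f y (c i)) (normalFrame o hf y).1 * D y :=
    mul_pos h5 h1
  rw [h6] at h9
  exact (pos_iff_pos_of_mul_pos h9).1 (mul_pos h5 h5)

end Orientation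

/-! ### Second order expansion of the Gauss map in a graph chart -/

section LocalModel

variable {n m : ℕ} {M : Type*} [TopologicalSpace M] [ChartedSpace (Model n) M]

/-- The displacement of the position vector and of the tangent vectors of the cone over `M`. -/
def tilt (f : M → Ambient n m) (x : M) (t : Fin n → Ambient n m) (X : Model n → M)
    (b : Option (Fin n)) (u : Model n) : Ambient n m :=
  b.elim (graphMap f x t X u - fderiv ℝ (graphMap f x t X) u u)
    fun i => fderiv ℝ (graphMap f x t X) u (stdVec i)

/-- The second derivative of the graph map at the origin. -/
def hess (f : M → Ambient n m) (x : M) (t : Fin n → Ambient n m) (X : Model n → M)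
    (i j : Fin n) : Ambient n m :=
  fderiv ℝ (fderiv ℝ (graphMap f x t X)) 0 (stdVec i) (stdVec j)

theorem tendsto_line (a : Model n) : Filter.Tendsto (fun s : ℝ => s • a) (𝓝 0) (𝓝 0) := by
  have : ContinuousAt (fun s : ℝ => s • a) 0 := by fun_prop
  simpa [ContinuousAt] using this

namespace IsGnomonicParam

variable {f : M → Ambient n m} {x : M} {t : Fin n → Ambient n m} {X : Model n → M}

theorem tilt_zero (h : IsGnomonicParam f x t X) (hf : IsSphereImmersion f) (b : Option (Fin n)) :
    tilt f x t X b 0 = 0 := by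
  cases b <;> simp [tilt, h.graphMap_zero hf, h.fderiv_graphMap_zero hf]

theorem contDiffAt_tilt (h : IsGnomonicParam f x t X) (hf : IsSphereImmersion f)
    (b : Option (Fin n)) : ContDiffAt ℝ 2 (tilt f x t X b) 0 := by
  have h1 := (h.contDiffAt_graphMap hf).self_of_nhds
  cases b with
  | none =>
    exact (h1.of_le (by norm_num)).sub
      ((h1.fderiv_right (m := 2) (by norm_num)).clm_apply contDiffAt_id)
  | some i => exact (h.contDiffAt_fderiv_graphMap hf).self_of_nhds _

theorem tilt_mem (h : IsGnomonicParam f x t X) (hf : IsSphereImmersion f) :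
    ∀ᶠ u in 𝓝 0, ∀ b, tilt f x t X b u ∈ normalSpace f x := by
  filter_upwards [h.graphMap_mem hf, h.fderiv_graphMap_mem hf] with u h1 h2 b
  cases b with
  | none => exact sub_mem h1 (h2 u)
  | some i => exact h2 _

/-- The graph map contributes its second derivative once, while s times its derivative along the
line contributes it twice with the opposite sign; hence the minus sign. -/
theorem hasJet_tilt_none (h : IsGnomonicParam f x t X) (hf : IsSphereImmersion f) (a : Model n) :
    HasJet (fun s : ℝ => tilt f x t X none (s • a)) 0
      (-fderiv ℝ (fderiv ℝ (graphMap f x t X)) 0 a a) := by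
  have h1 := (h.contDiffAt_graphMap hf).self_of_nhds
  have h2 : ContDiffAt ℝ 2 (graphMap f x t X) 0 := h1.of_le (by norm_num)
  have j1 := HasJet.of_contDiffAt h2 a
  have h3 : ContDiffAt ℝ 2 (fun y => fderiv ℝ (graphMap f x t X) y a) 0 :=
    (h.contDiffAt_fderiv_graphMap hf).self_of_nhds _
  have j2 := HasJet.of_contDiffAt h3 a
  have j3 : HasJet (fun s : ℝ => s) 1 0 :=
    ⟨fun _ => 1, Filter.Eventually.of_forall fun s => hasDerivAt_id s, rfl, hasDerivAt_const _ _⟩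
  have j4 := j1.add ((j3.smul j2).const_smul (-1))
  refine (j4.congr (Filter.Eventually.of_forall fun s => ?_)).cast ?_ ?_
  · simp [tilt, sub_eq_add_neg]
  · simp [h.fderiv_graphMap_zero hf]
  · rw [fderiv_fderiv_apply h2]
    simp only [zero_smul, add_zero, zero_add, one_smul]
    module

theorem hasJet_tilt_some (h : IsGnomonicParam f x t X) (hf : IsSphereImmersion f) (i : Fin n)
    (a : Model n) :
    HasJet (fun s : ℝ => tilt f x t X (some i) (s • a))
      (fderiv ℝ (fderiv ℝ (graphMap f x t X)) 0 a (stdVec i))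
      (fderiv ℝ (fderiv ℝ fun y => fderiv ℝ (graphMap f x t X) y (stdVec i)) 0 a a) := by
  have h1 := (h.contDiffAt_graphMap hf).self_of_nhds
  have h3 : ContDiffAt ℝ 2 (fun y => fderiv ℝ (graphMap f x t X) y (stdVec i)) 0 :=
    (h.contDiffAt_fderiv_graphMap hf).self_of_nhds _
  refine (HasJet.of_contDiffAt h3 a).cast ?_ rfl
  rw [fderiv_fderiv_apply (h1.of_le (by norm_num))]

theorem hess_comm (h : IsGnomonicParam f x t X) (hf : IsSphereImmersion f) (i j : Fin n) :
    hess f x t X i j = hess f x t X j i :=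
  fderiv_fderiv_comm ((h.contDiffAt_graphMap hf).self_of_nhds.of_le (by norm_num)) _ _

theorem secondFundamentalForm_eq_zero (h : IsGnomonicParam f x t X) (hf : IsSphereImmersion f)
    (hb : ∀ i j, hess f x t X i j = 0) (u v : TangentSpace (𝓡 n) x) :
    secondFundamentalForm f x u v = 0 := by
  have h1 : ∀ a b : Model n, fderiv ℝ (fderiv ℝ (graphMap f x t X)) 0 a b = 0 := by
    intro a b
    rw [← sum_smul_stdVec a, ← sum_smul_stdVec b]
    simp only [map_sum, map_smul, sum_apply, smul_apply]
    exact Finset.sum_eq_zero fun i _ => by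
      rw [Finset.sum_eq_zero, smul_zero]
      intro j _
      have := hb j i
      rw [hess] at this
      rw [this, smul_zero]
  have h2 : ∀ u v : TangentSpace (𝓡 n) (X 0), secondFundamentalForm f (X 0) u v = 0 := by
    intro u v
    obtain ⟨a, rfl⟩ := (h.surjective_paramDeriv hf).self_of_nhds u
    obtain ⟨b, rfl⟩ := (h.surjective_paramDeriv hf).self_of_nhds v
    rw [← h.fderiv_fderiv_graphMap_zero hf, h1]
  have h3 : ∀ y, y = x → (∀ u v : TangentSpace (𝓡 n) y, secondFundamentalForm f y u v = 0) →
      ∀ u v : TangentSpace (𝓡 n) x, secondFundamentalForm f x u v = 0 := by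
    rintro y rfl hy
    exact hy
  exact h3 _ h.map_zero h2 u v

/-- Second order expansion of the immersion along a coordinate line. -/
theorem hasJet_comp (h : IsGnomonicParam f x t X) (hf : IsSphereImmersion f) (i : Fin n) :
    HasJet (fun s : ℝ => f (X (s • stdVec i))) (t i) (hess f x t X i i - f x) := by
  have hF : ContDiffAt ℝ 2 (fun y => f (X y)) 0 :=
    (h.contDiffAt_comp hf).self_of_nhds.of_le (by norm_num)
  have j1 := HasJet.of_contDiffAt hF (stdVec i)
  refine j1.cast (h.fderiv_comp_zero_stdVec hf i).symm ?_
  set d := fderiv ℝ (fderiv ℝ fun y => f (X y)) 0 (stdVec i) (stdVec i) with hd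
  have hx : ⟪f x, d⟫_ℝ = -1 := by
    -- the norm of the curve is constant
    have h1 : ∀ s : ℝ, ⟪f (X (s • stdVec i)), f (X (s • stdVec i))⟫_ℝ = 1 := fun s =>
      hf.inner_self _
    obtain ⟨g', k1, k2, k3⟩ := j1
    have k4 : ∀ᶠ s in 𝓝 (0 : ℝ), ⟪f (X (s • stdVec i)), g' s⟫_ℝ = 0 := by
      filter_upwards [k1] with s hs
      have h2 := hs.inner ℝ hs
      simp only [h1] at h2
      have h3 := h2.unique (hasDerivAt_const s (1 : ℝ))
      rw [real_inner_comm (f (X (s • stdVec i)))] at h3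
      linarith [real_inner_comm (f (X (s • stdVec i))) (g' s)]
    have k5 := (k1.self_of_nhds.inner ℝ k3).unique
      ((hasDerivAt_const (0 : ℝ) (0 : ℝ)).congr_of_eventuallyEq k4)
    rw [k2, h.fderiv_comp_zero_stdVec hf] at k5
    simp only [zero_smul, h.map_zero] at k5
    rw [real_inner_self_eq_norm_sq, h.frame.orthonormal.1 i] at k5
    linarith
  have hmem : d + f x ∈ normalSpace f x := by
    rw [h.frame.mem_normalSpace_iff hf]
    constructor
    · rw [inner_add_left, hf.inner_self, real_inner_comm, hx]; norm_num
    · intro k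
      rw [inner_add_left, real_inner_comm, hd, h.inner_fderiv_fderiv_comp_frame hf,
        h.frame.inner_left hf, add_zero]
  have hN : normalSpace f (X 0) = normalSpace f x := by rw [h.map_zero]
  have hb := h.fderiv_fderiv_graphMap_zero_mem hf (stdVec i) (stdVec i)
  rw [sub_eq_iff_eq_add, eq_comm, ← sub_eq_zero, ← inner_self_eq_zero (𝕜 := ℝ)]
  set v := d + f x - hess f x t X i i with hv
  have hvm : v ∈ normalSpace f (X 0) := by rw [hN]; exact sub_mem hmem hb
  have h4 := inner_fderiv_fderiv_param hf h.contMDiffAt.self_of_nhds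
    (μ := fun _ => 1) contDiffAt_const hvm (stdVec i) (stdVec i)
  simp only [one_smul, one_mul] at h4
  rw [← h.fderiv_fderiv_graphMap_zero hf] at h4
  have h5 : ⟪v, f x⟫_ℝ = 0 := by
    rw [hN] at hvm
    exact ((h.frame.mem_normalSpace_iff hf).1 hvm).1
  change ⟪v, d + f x - hess f x t X i i⟫_ℝ = 0
  rw [inner_sub_right, inner_add_right, h4, h5, hess]
  ring

theorem tendsto (h : IsGnomonicParam f x t X) : Filter.Tendsto X (𝓝 0) (𝓝 x) := by
  have := h.contMDiffAt.self_of_nhds.continuousAt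
  rwa [ContinuousAt, h.map_zero] at this

end IsGnomonicParam

variable [IsManifold (𝓡 n) ∞ M] [NeZero n] [NeZero m]

/-- A graph parametrization together with an adapted basis of the ambient space. -/
structure IsLocalModel (o : ManifoldOrientation n M) {f : M → Ambient n m}
    (hf : IsSphereImmersion f) (x : M) (t : Fin n → Ambient n m)
    (B : OrthonormalBasis (Option (Fin n) ⊕ Fin m) ℝ (Ambient n m)) (X : Model n → M) : Prop
    extends IsGnomonicParam f x t X where
  adapted : IsAdapted f x B
  tangent_eq : ∀ i, B (Sum.inl (some i)) = t i
  normal_eq : normalPart B = (normalFrame o hf x).1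

theorem exists_isLocalModel (o : ManifoldOrientation n M) {f : M → Ambient n m}
    (hf : IsSphereImmersion f) {x : M} {t : Fin n → Ambient n m} (ht : IsTangentFrame f x t) :
    ∃ B X, IsLocalModel o hf x t B X := by
  obtain ⟨B, h1, h2, h3⟩ := exists_isAdapted_normalFrame o hf ht
  obtain ⟨X, hX⟩ := exists_isGnomonicParam hf ht
  exact ⟨B, X, { hX with adapted := h1, tangent_eq := h2, normal_eq := h3 }⟩

namespace IsLocalModel

variable {o : ManifoldOrientation n M} {f : M → Ambient n m} {hf : IsSphereImmersion f} {x : M}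
  {t : Fin n → Ambient n m} {B : OrthonormalBasis (Option (Fin n) ⊕ Fin m) ℝ (Ambient n m)}
  {X : Model n → M}

theorem inner_inl (h : IsLocalModel o hf x t B X) {v : Ambient n m} (hv : v ∈ normalSpace f x)
    (b : Option (Fin n)) : ⟪v, B (Sum.inl b)⟫_ℝ = 0 :=
  (h.adapted.mem_normalSpace_iff hf).1 hv b

theorem w_eq (h : IsLocalModel o hf x t B X) (G : Grassmannian m (n + m + 1)) :
    w G (normalGaussMap o hf x) = pairing G (normalPart B) := by
  rw [normalGaussMap_eq, w_mk_right, h.normal_eq]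

theorem w_eq' (h : IsLocalModel o hf x t B X) (p : Frame m (n + m + 1)) :
    w (normalGaussMap o hf x) (Quotient.mk _ p) = (gram (normalPart B) p.1).det := by
  rw [w_mk_right, normalGaussMap_eq, h.normal_eq]
  exact pairing_mk _ _

theorem graphNormal_mem (h : IsLocalModel o hf x t B X) : ∀ᶠ u in 𝓝 0, ∀ α,
    graphNormal B (fun b => tilt f x t X b u) α ∈ toSubmodule (normalGaussMap o hf (X u)) := by
  filter_upwards [h.mem_normalSpace_param_iff hf, h.tilt_mem hf] with u h1 h2 α
  rw [toSubmodule_normalGaussMap, h1]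
  have h3 := inner_graphNormal (B := B) (χ := fun b => tilt f x t X b u)
    (fun b c => h.inner_inl (h2 b) c) α
  refine ⟨?_, fun i => ?_⟩
  · have := h3 none
    rwa [h.adapted.position] at this
  · have := h3 (some i)
    rwa [h.tangent_eq] at this

theorem eventually_pairing (h : IsLocalModel o hf x t B X) : ∀ᶠ u in 𝓝 0, ∀ q,
    pairing (normalGaussMap o hf (X u)) q =
      (gram (graphNormal B fun b => tilt f x t X b u) q).det *
        w (normalGaussMap o hf (X u)) (normalGaussMap o hf x) := by
  filter_upwards [h.graphNormal_mem] with u h1 q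
  rw [h.w_eq]
  exact pairing_eq_mul_of_mem h1 (by rw [gram_graphNormal_normalPart, Matrix.det_one]) q

theorem eventually_w_sq (h : IsLocalModel o hf x t B X) : ∀ᶠ u in 𝓝 0,
    w (normalGaussMap o hf (X u)) (normalGaussMap o hf x) ^ 2 *
      (1 + (normalCoeff B fun b => tilt f x t X b u).transpose *
        normalCoeff B fun b => tilt f x t X b u).det = 1 := by
  filter_upwards [h.graphNormal_mem] with u h1
  rw [h.w_eq, ← gram_graphNormal_self]
  exact pairing_sq_mul_of_mem h1 (by rw [gram_graphNormal_normalPart, Matrix.det_one])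

theorem eventually_w_pos (h : IsLocalModel o hf x t B X) : ∀ᶠ u in 𝓝 0,
    0 < w (normalGaussMap o hf (X u)) (normalGaussMap o hf x) :=
  h.tendsto.eventually (eventually_w_normalGaussMap_pos o hf x)

/-- Second order expansion of `w⁻²` at a point of `M`. -/
theorem exists_hasJet (h : IsLocalModel o hf x t B X) (hmin : ∀ x, meanCurvature f x = 0)
    (p : Frame m (n + m + 1)) (hp : w (normalGaussMap o hf x) (Quotient.mk _ p) ≠ 0) :
    ∃ second : Fin n → ℝ,
      (∀ i, HasJet (fun s : ℝ =>
        (w (normalGaussMap o hf (X (s • stdVec i))) (Quotient.mk _ p) ^ 2)⁻¹)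
        (2 * (w (normalGaussMap o hf x) (Quotient.mk _ p) ^ 2)⁻¹ *
          ∑ j, ⟪hess f x t X i j, slope B p.1 (some j)⟫_ℝ) (second i)) ∧
      ∑ i, second i = 2 * (w (normalGaussMap o hf x) (Quotient.mk _ p) ^ 2)⁻¹ *
        (∑ i, ∑ j, ‖hess f x t X i j‖ ^ 2 +
          slopeForm (hess f x t X) (fun j => slope B p.1 (some j)) +
          2 * ∑ i, (∑ j, ⟪hess f x t X i j, slope B p.1 (some j)⟫_ℝ) ^ 2) := by
  set w₀ := w (normalGaussMap o hf x) (Quotient.mk _ p) with hw₀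
  let χ1 : Fin n → Option (Fin n) → Ambient n m := fun i b => b.elim 0 fun j => hess f x t X i j
  let χ2 : Fin n → Option (Fin n) → Ambient n m := fun i b => b.elim (-hess f x t X i i) fun j =>
    fderiv ℝ (fderiv ℝ fun y => fderiv ℝ (graphMap f x t X) y (stdVec j)) 0 (stdVec i) (stdVec i)
  have hχ : ∀ i b, HasJet (fun s : ℝ => tilt f x t X b (s • stdVec i)) (χ1 i b) (χ2 i b) := by
    intro i b
    cases b with
    | none => exact h.hasJet_tilt_none hf _
    | some j => exact h.hasJet_tilt_some hf _ _
  have hχ1 : ∀ i b c, ⟪χ1 i b, B (Sum.inl c)⟫_ℝ = 0 := by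
    intro i b c
    cases b with
    | none => exact inner_zero_left _
    | some j => exact h.inner_inl (h.fderiv_fderiv_graphMap_zero_mem hf _ _) c
  have hjet := fun i => (hasJet_graph (B := B) (q := p.1) (hχ i)
    (fun b => by rw [zero_smul]; exact h.tilt_zero hf b) (hχ1 i)).const_smul (w₀ ^ 2)⁻¹
  refine ⟨_, fun i => ((hjet i).congr ?_).cast ?_ rfl, ?_⟩
  · filter_upwards [(tendsto_line (stdVec i)).eventually h.eventually_pairing,
      (tendsto_line (stdVec i)).eventually h.eventually_w_sq] with s h1 h2
    rw [w_mk_right, h1, det_gram_graphNormal _ (by rw [← h.w_eq']; exact hp), ← h.w_eq', ← hw₀]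
    set D := (1 + (normalCoeff B fun b => tilt f x t X b (s • stdVec i)).transpose *
      normalCoeff B fun b => tilt f x t X b (s • stdVec i)).det
    set y := w (normalGaussMap o hf (X (s • stdVec i))) (normalGaussMap o hf x)
    have hD : D = (y ^ 2)⁻¹ := eq_inv_of_mul_eq_one_right h2
    rw [hD, smul_eq_mul, mul_pow, mul_pow, mul_inv, mul_inv]
    ring
  · simp only [Fintype.sum_option, χ1, Option.elim, inner_zero_left, zero_add, smul_eq_mul]
    ring
  -- Minimality enters here: summed over i, the second order tilts of the position vector vanish by
  -- the trace identity, and those of the tangent vectors by the third derivative identity. Only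
  -- terms quadratic in the Hessian remain.
  · have htr : ∑ i, ⟪χ2 i none, slope B p.1 none⟫_ℝ = 0 := by
      rw [← sum_inner]
      have : ∑ i, χ2 i none = 0 := by
        simp only [χ2, Option.elim, Finset.sum_neg_distrib]
        rw [neg_eq_zero]
        exact h.sum_fderiv_fderiv_graphMap_zero hf hmin
      rw [this, inner_zero_left]
    have htr' : ∑ i, ∑ j, ⟪χ2 i (some j), slope B p.1 (some j)⟫_ℝ = 0 := by
      rw [Finset.sum_comm]
      refine Finset.sum_eq_zero fun j _ => ?_
      rw [← sum_inner]
      simp only [χ2, Option.elim]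
      rw [h.sum_third_deriv_graphMap_zero hf hmin, inner_zero_left]
    simp only [Finset.sum_add_distrib, ← Finset.mul_sum, Fintype.sum_option,
      htr, htr', smul_eq_mul]
    simp only [χ1, Option.elim, inner_zero_left, zero_add, zero_mul, norm_zero, mul_zero,
      Finset.sum_const_zero, slopeForm, ne_eq, OfNat.ofNat_ne_zero, not_false_eq_true, zero_pow,
      add_zero]
    ring

end IsLocalModel

end LocalModel

/-! ### Tangent frames adapted to a subspace or to a linear map -/

section Frames

variable {n m : ℕ} {M : Type*} [TopologicalSpace M] [ChartedSpace (Model n) M]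
  {f : M → Ambient n m}

/-- Placing the basis of K first means that, when K has codimension at most 2 in T, only the last
two indices can lie outside K. -/
theorem exists_orthonormal_extending {V : Type*} [NormedAddCommGroup V] [InnerProductSpace ℝ V]
    [FiniteDimensional ℝ V] {K T : Submodule ℝ V} (hKT : K ≤ T)
    (hT : Module.finrank ℝ T = n) :
    ∃ t : Fin n → V, Orthonormal ℝ t ∧ (∀ i, t i ∈ T) ∧
      ∀ i : Fin n, i.1 < Module.finrank ℝ K → t i ∈ K := by
  let b := stdOrthonormalBasis ℝ K
  let v : Fin n → T := fun i =>
    if h : i.1 < Module.finrank ℝ K then ⟨b ⟨i, h⟩, hKT (b ⟨i, h⟩).2⟩ else 0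
  have hv : Orthonormal ℝ (Set.domRestrict {i : Fin n | i.1 < Module.finrank ℝ K} v) := by
    rw [orthonormal_iff_ite]
    rintro ⟨i, hi⟩ ⟨j, hj⟩
    have hi' : i.1 < Module.finrank ℝ K := hi
    have hj' : j.1 < Module.finrank ℝ K := hj
    have h1 := orthonormal_iff_ite.1 b.orthonormal ⟨i, hi'⟩ ⟨j, hj'⟩
    have h2 : ∀ (k : Fin n) (hk : k.1 < Module.finrank ℝ K) (hk' : k ∈ {i : Fin n |
        i.1 < Module.finrank ℝ K}), ((Set.domRestrict {i : Fin n | i.1 < Module.finrank ℝ K} v)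
          ⟨k, hk'⟩ : V) = b ⟨k, hk⟩ := by
      intro k hk hk'
      simp [v, hk]
    rw [Submodule.coe_inner] at h1 ⊢
    rw [h2 i hi', h2 j hj', h1]
    simp [Fin.ext_iff]
  obtain ⟨c, hc⟩ := hv.exists_orthonormalBasis_extension_of_card_eq (by rw [hT, Fintype.card_fin])
  refine ⟨fun i => c i, c.orthonormal.comp_linearIsometry T.subtypeₗᵢ, fun i => (c i).2,
    fun i hi => ?_⟩
  have h2 : c i = v i := hc i hi
  simp only [h2, v, dif_pos hi]
  exact (b ⟨i, hi⟩).2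

/-- Singular value decomposition: an orthonormal eigenbasis of S*S has mutually orthogonal images
under S. -/
theorem exists_orthonormal_diagonalizing {V W : Type*} [NormedAddCommGroup V]
    [InnerProductSpace ℝ V] [FiniteDimensional ℝ V] [NormedAddCommGroup W]
    [InnerProductSpace ℝ W] [FiniteDimensional ℝ W] {T : Submodule ℝ V}
    (hT : Module.finrank ℝ T = n) (L : V →ₗ[ℝ] W) :
    ∃ t : Fin n → V, Orthonormal ℝ t ∧ (∀ i, t i ∈ T) ∧
      ∀ i j, i ≠ j → ⟪L (t i), L (t j)⟫_ℝ = 0 := by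
  let S : T →ₗ[ℝ] W := L ∘ₗ T.subtype
  have hS : (LinearMap.adjoint S ∘ₗ S).IsSymmetric := fun u v => by
    simp only [LinearMap.comp_apply, LinearMap.adjoint_inner_left, LinearMap.adjoint_inner_right]
  let c := hS.eigenvectorBasis hT
  refine ⟨fun i => c i, c.orthonormal.comp_linearIsometry T.subtypeₗᵢ, fun i => (c i).2,
    fun i j hij => ?_⟩
  have h1 : ⟪S (c i), S (c j)⟫_ℝ = ⟪(LinearMap.adjoint S ∘ₗ S) (c i), c j⟫_ℝ := by
    exact (LinearMap.adjoint_inner_left S (c j) (S (c i))).symm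
  have h2 : ⟪L (c i), L (c j)⟫_ℝ = ⟪S (c i), S (c j)⟫_ℝ := rfl
  rw [h2, h1, hS.apply_eigenvectorBasis, real_inner_smul_left, c.orthonormal.2 hij, mul_zero]

theorem exists_isTangentFrame (hf : IsSphereImmersion f) (x : M) :
    ∃ t, IsTangentFrame f x t := by
  obtain ⟨t, h1, h2, -⟩ := exists_orthonormal_extending (n := n) bot_le
    (finrank_range_differential hf x)
  exact ⟨t, h1, h2⟩

theorem contMDiffAt_gnomonic (hf : IsSphereImmersion f) (x : M) (t : Fin n → Ambient n m) :
    ContMDiffAt (𝓡 n) 𝓘(ℝ, Model n) ∞ (gnomonic f x t) x := by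
  have h1 : ContDiffAt ℝ ∞ (fun v : Ambient n m =>
      (WithLp.toLp 2 fun i => ⟪v, t i⟫_ℝ / ⟪v, f x⟫_ℝ : Model n)) (f x) := by
    refine contDiffAt_piLp' 2 fun i => ?_
    refine ContDiffAt.div ?_ ?_ ?_
    · exact contDiffAt_id.inner ℝ contDiffAt_const
    · exact contDiffAt_id.inner ℝ contDiffAt_const
    · rw [hf.inner_self]; exact one_ne_zero
  exact h1.contMDiffAt.comp x (hf.contMDiff x)

theorem IsTangentFrame.gnomonic_self {x : M} {t : Fin n → Ambient n m} (ht : IsTangentFrame f x t)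
    (hf : IsSphereImmersion f) : gnomonic f x t x = 0 := by
  ext i
  simp [gnomonic, ht.inner_left hf]

end Frames

/-! ### Regularity of the normal Gauss map and the kernel of its differential -/

section GaussMap

variable {n m : ℕ} {M : Type*} [TopologicalSpace M] [ChartedSpace (Model n) M]
  [IsManifold (𝓡 n) ∞ M] [NeZero n] [NeZero m] {o : ManifoldOrientation n M}
  {f : M → Ambient n m} {hf : IsSphereImmersion f} {x : M}
  {t : Fin n → Ambient n m} {B : OrthonormalBasis (Option (Fin n) ⊕ Fin m) ℝ (Ambient n m)}
  {X : Model n → M}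

theorem _root_.DifferentiableAt.matrix_det {E ι : Type*} [NormedAddCommGroup E] [NormedSpace ℝ E]
    [Fintype ι] [DecidableEq ι] {Y : E → Matrix ι ι ℝ} {u : E}
    (h : ∀ i j, DifferentiableAt ℝ (fun u => Y u i j) u) :
    DifferentiableAt ℝ (fun u => (Y u).det) u := by
  simp only [Matrix.det_apply]
  refine DifferentiableAt.fun_sum fun σ _ => ?_
  simp only [Units.smul_def, zsmul_eq_mul]
  refine (differentiableAt_const _).mul ?_
  exact (HasFDerivAt.finsetProd fun i _ => (h (σ i) i).hasFDerivAt).differentiableAt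

namespace IsLocalModel

theorem differentiableAt_tilt_inner (h : IsLocalModel o hf x t B X) (b : Option (Fin n))
    (v : Ambient n m) : DifferentiableAt ℝ (fun u => ⟪tilt f x t X b u, v⟫_ℝ) 0 :=
  ((h.contDiffAt_tilt hf b).differentiableAt (by simp)).inner ℝ (differentiableAt_const v)

theorem exists_differentiableAt_pairing (h : IsLocalModel o hf x t B X)
    (q : Fin m → Ambient n m) : ∃ Ψ : Model n → ℝ, DifferentiableAt ℝ Ψ 0 ∧
      ∀ᶠ u in 𝓝 0, pairing (normalGaussMap o hf (X u)) q = Ψ u := by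
  let D : Model n → ℝ := fun u => (1 + (normalCoeff B fun b => tilt f x t X b u).transpose *
        normalCoeff B fun b => tilt f x t X b u).det
  have hD0 : D 0 = 1 := by
    have : (normalCoeff B fun b => tilt f x t X b 0) = 0 := by
      ext b α
      simp [normalCoeff, h.tilt_zero hf]
    simp [D, this]
  have hD : DifferentiableAt ℝ D 0 := by
    refine DifferentiableAt.matrix_det fun α β => ?_
    simp only [Matrix.add_apply, Matrix.mul_apply, Matrix.transpose_apply, normalCoeff,
      Matrix.of_apply]
    refine (differentiableAt_const _).add (DifferentiableAt.fun_sum fun b _ => ?_)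
    exact (h.differentiableAt_tilt_inner b _).mul (h.differentiableAt_tilt_inner b _)
  have hE : DifferentiableAt ℝ (fun u =>
      (gram (graphNormal B fun b => tilt f x t X b u) q).det) 0 := by
    refine DifferentiableAt.matrix_det fun α β => ?_
    simp only [gram_graphNormal, Matrix.sub_apply, Matrix.mul_apply, Matrix.transpose_apply,
      normalCoeff, Matrix.of_apply]
    refine (differentiableAt_const _).sub (DifferentiableAt.fun_sum fun b _ => ?_)
    exact (h.differentiableAt_tilt_inner b _).mul (differentiableAt_const _)
  -- The Gram determinant D determines w(N_u, N_x) only up to sign. The local positivity of w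
  -- selects the root (√D)⁻¹, which is differentiable because D 0 = 1.
  refine ⟨fun u => (gram (graphNormal B fun b => tilt f x t X b u) q).det * (√(D u))⁻¹,
    hE.mul ((hD.sqrt (by rw [hD0]; exact one_ne_zero)).inv (by simp [hD0])), ?_⟩
  filter_upwards [h.eventually_pairing, h.eventually_w_sq, h.eventually_w_pos] with u h1 h2 h3
  rw [h1]
  congr 1
  have h4 : D u = ((w (normalGaussMap o hf (X u)) (normalGaussMap o hf x))⁻¹) ^ 2 := by
    rw [inv_pow]; exact eq_inv_of_mul_eq_one_right h2
  rw [h4, Real.sqrt_sq (inv_nonneg.2 h3.le), inv_inv]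

end IsLocalModel

theorem mdifferentiableAt_pairing (o : ManifoldOrientation n M) (hf : IsSphereImmersion f)
    (q : Fin m → Ambient n m) (x : M) :
    MDifferentiableAt (𝓡 n) 𝓘(ℝ, ℝ) (fun y => pairing (normalGaussMap o hf y) q) x := by
  obtain ⟨t, ht⟩ := exists_isTangentFrame hf x
  obtain ⟨B, X, h⟩ := exists_isLocalModel o hf ht
  obtain ⟨Ψ, h1, h2⟩ := h.exists_differentiableAt_pairing q
  have hg := contMDiffAt_gnomonic hf x t
  have hg0 := ht.gnomonic_self hf
  have h3 : MDifferentiableAt (𝓡 n) 𝓘(ℝ, ℝ) (Ψ ∘ gnomonic f x t) x := by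
    refine MDifferentiableAt.comp x (I' := 𝓘(ℝ, Model n)) ?_ (hg.mdifferentiableAt (by simp))
    rw [hg0]
    exact h1.mdifferentiableAt
  refine h3.congr_of_eventuallyEq ?_
  have h4 := hg.continuousAt
  rw [ContinuousAt, hg0] at h4
  filter_upwards [h.left_inv, h4.eventually h2] with y h5 h6
  rw [h5] at h6
  exact h6

theorem continuous_w_normalGaussMap (o : ManifoldOrientation n M) (hf : IsSphereImmersion f)
    (P : Grassmannian m (n + m + 1)) : Continuous fun y => w (normalGaussMap o hf y) P := by
  induction P using Quotient.inductionOn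
  rename_i p
  simp only [w_mk_right]
  exact continuous_iff_continuousAt.2 fun x => (mdifferentiableAt_pairing o hf p.1 x).continuousAt

theorem mdifferentiableAt_plucker (o : ManifoldOrientation n M) (hf : IsSphereImmersion f)
    (x : M) : MDifferentiableAt (𝓡 n) 𝓘(ℝ, (Fin m ↪o Fin (n + m + 1)) → ℝ)
      (fun y => plucker (normalGaussMap o hf y)) x := by
  have key : ∀ J, MDifferentiableAt (𝓡 n) 𝓘(ℝ, ℝ)
      (fun y => plucker (normalGaussMap o hf y) J) x := by
    intro J
    refine (mdifferentiableAt_pairing o hf (fun j => EuclideanSpace.single (J j) (1 : ℝ))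
      x).congr_of_eventuallyEq (Filter.Eventually.of_forall fun y => ?_)
    simp only
    rw [normalGaussMap_eq]
    have h1 : gram (normalFrame o hf y).1 (fun j => EuclideanSpace.single (J j) (1 : ℝ)) =
        Matrix.of fun i j => (normalFrame o hf y).1 i (J j) := by
      ext i j
      simp [gram, EuclideanSpace.inner_single_right]
    refine Eq.trans ?_ (pairing_mk (normalFrame o hf y) _).symm
    rw [h1]
    rfl
  rw [mdifferentiableAt_iff]
  refine ⟨continuousAt_pi.2 fun J => (key J).continuousAt, differentiableWithinAt_pi.2 fun J => ?_⟩
  exact ((mdifferentiableAt_iff _ _).1 (key J)).2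

/-- The image in the ambient space of the kernel of the differential of the normal Gauss map. -/
def gaussKernel (o : ManifoldOrientation n M) (hf : IsSphereImmersion f) (x : M) :
    Submodule ℝ (Ambient n m) :=
  (LinearMap.ker (mfderiv (𝓡 n) 𝓘(ℝ, (Fin m ↪o Fin (n + m + 1)) → ℝ)
    (fun y => plucker (normalGaussMap o hf y)) x).toLinearMap).map (differential f x)

theorem gaussKernel_le (o : ManifoldOrientation n M) (hf : IsSphereImmersion f) (x : M) :
    gaussKernel o hf x ≤ LinearMap.range (differential f x) := LinearMap.map_le_range

theorem finrank_gaussKernel (o : ManifoldOrientation n M) (hf : IsSphereImmersion f) (x : M) :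
    normalGaussRank o hf x + Module.finrank ℝ (gaussKernel o hf x) = n := by
  have : FiniteDimensional ℝ (TangentSpace (𝓡 n) x) :=
    inferInstanceAs (FiniteDimensional ℝ (EuclideanSpace ℝ (Fin n)))
  have h1 := LinearMap.finrank_range_add_finrank_ker
    (mfderiv (𝓡 n) 𝓘(ℝ, (Fin m ↪o Fin (n + m + 1)) → ℝ)
      (fun y => plucker (normalGaussMap o hf y)) x).toLinearMap
  have h2 : Module.finrank ℝ (TangentSpace (𝓡 n) x) = n := finrank_euclideanSpace_fin
  rw [h2] at h1
  rw [gaussKernel, ← (Submodule.equivMapOfInjective _ (hf.injective x) _).finrank_eq]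
  exact h1

namespace IsLocalModel

/-- Exchanging one normal vector for t_j leaves the identity matrix with one column replaced. Such a
pairing reads off a single entry of the tilt, which allows the Hessian to be recovered from the
differential of the Gauss map. -/
theorem det_gram_graphNormal_update (h : IsLocalModel o hf x t B X) (u : Model n) (α : Fin m)
    (j : Fin n) :
    (gram (graphNormal B fun b => tilt f x t X b u)
      (Function.update (normalPart B) α (t j))).det = -⟪tilt f x t X (some j) u, B (Sum.inr α)⟫_ℝ := by
  have h1 : gram (graphNormal B fun b => tilt f x t X b u)
      (Function.update (normalPart B) α (t j)) =
      (1 : Matrix (Fin m) (Fin m) ℝ).updateCol α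
        fun β => -⟪tilt f x t X (some j) u, B (Sum.inr β)⟫_ℝ := by
    ext β γ
    rw [Matrix.updateCol_apply]
    split_ifs with hγ
    · subst hγ
      simp only [gram, Matrix.of_apply, Function.update_self, graphNormal, ← h.tangent_eq,
        inner_sub_left, inner_inr_inl, sum_inner, real_inner_smul_left, inner_inl_inl]
      simp
    · rw [← gram_graphNormal_normalPart (B := B) fun b => tilt f x t X b u]
      simp only [gram, Matrix.of_apply, Function.update_of_ne hγ]
  rw [h1, ← Matrix.cramer_apply, Matrix.cramer_one]
  rfl

/-- The kernel of the differential of the normal Gauss map lies in the nullity of the second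
fundamental form. -/
theorem fderiv_fderiv_graphMap_eq_zero (h : IsLocalModel o hf x t B X) {a : Model n}
    (ha : ∑ i, a i • t i ∈ gaussKernel o hf x) (j : Fin n) :
    fderiv ℝ (fderiv ℝ (graphMap f x t X)) 0 a (stdVec j) = 0 := by
  rw [← h.map_zero] at ha
  obtain ⟨v, hv, hva⟩ := ha
  rw [← h.differential_paramDeriv hf] at hva
  have hv' := hf.injective _ hva
  rw [hv'] at hv
  have hXd := h.contMDiffAt.self_of_nhds.mdifferentiableAt (by simp)
  have hder : fderiv ℝ (fun u => plucker (normalGaussMap o hf (X u))) 0 a = 0 := by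
    have h1 := mfderiv_comp (0 : Model n) (mdifferentiableAt_plucker o hf (X 0)) hXd
    rw [mfderiv_eq_fderiv] at h1
    exact (congrArg (fun L : Model n →L[ℝ] ((Fin m ↪o Fin (n + m + 1)) → ℝ) => L a) h1).trans hv
  have hdiff : DifferentiableAt ℝ (fun u => plucker (normalGaussMap o hf (X u))) 0 :=
    mdifferentiableAt_iff_differentiableAt.1
      ((mdifferentiableAt_plucker o hf (X 0)).comp (0 : Model n) hXd)
  -- Every pairing is linear in the Plücker coordinates, so all of them are stationary in a kernel
  -- direction of the differential.
  have hpair : ∀ q, HasDerivAt (fun s : ℝ => pairing (normalGaussMap o hf (X (s • a))) q) 0 0 := by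
    intro q
    obtain ⟨Λ, hΛ⟩ := exists_linear_pairing q
    have h2 := (Λ.toContinuousLinearMap.hasFDerivAt).comp_hasDerivAt (0 : ℝ)
      (IsGnomonicParam.hasDerivAt_line a hdiff)
    rw [hder, map_zero] at h2
    refine h2.congr_of_eventuallyEq (Filter.Eventually.of_forall fun s => ?_)
    exact hΛ _
  have hW := hpair (normalPart B)
  have h0 : ∀ α, ⟪fderiv ℝ (fderiv ℝ (graphMap f x t X)) 0 a (stdVec j), B (Sum.inr α)⟫_ℝ = 0 := by
    intro α
    have h3 := (h.hasJet_tilt_some hf j a).hasDerivAt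
    have h4 := ((h3.inner ℝ (hasDerivAt_const 0 (B (Sum.inr α)))).neg).mul hW
    have h5 := hpair (Function.update (normalPart B) α (t j))
    have h6 := h5.congr_of_eventuallyEq (f₁ := fun s : ℝ =>
      -⟪tilt f x t X (some j) (s • a), B (Sum.inr α)⟫_ℝ *
        pairing (normalGaussMap o hf (X (s • a))) (normalPart B)) (by
      filter_upwards [(tendsto_line a).eventually h.eventually_pairing] with s hs
      rw [hs (Function.update _ _ _), h.det_gram_graphNormal_update, h.w_eq])
    have h7 := h4.unique h6
    have h8 : pairing (normalGaussMap o hf (X ((0 : ℝ) • a))) (normalPart B) = 1 := by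
      rw [← h.w_eq, zero_smul, h.map_zero, w_self]
    simp only [h8] at h7
    simpa using h7
  have h9 := sum_inner_normal_sq (B := B)
    (fun c => h.inner_inl (h.fderiv_fderiv_graphMap_zero_mem hf a (stdVec j)) c)
  simp only [h0] at h9
  simpa using h9.symm

end IsLocalModel

end GaussMap

/-! ### Subharmonicity of w⁻² and its equality case -/

section Subsolution

variable {n m : ℕ} {M : Type*} [TopologicalSpace M] [ChartedSpace (Model n) M]

/-- Along suitable curves through `x` with orthonormal velocities, the sum of the second derivatives
of `Φ` is nonnegative, while `f` has the second derivatives of a minimal immersion. -/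
def IsSubsolutionAt (f : M → Ambient n m) (Φ : M → ℝ) (x : M) : Prop :=
  ∃ (t b : Fin n → Ambient n m) (X : Fin n → ℝ → M) (first second : Fin n → ℝ),
    IsTangentFrame f x t ∧ ∑ i, b i = 0 ∧ (∀ i, Filter.Tendsto (X i) (𝓝 0) (𝓝 x)) ∧
      (∀ i, X i 0 = x) ∧ (∀ i, HasJet (fun s => f (X i s)) (t i) (b i - f x)) ∧
      (∀ i, HasJet (fun s => Φ (X i s)) (first i) (second i)) ∧ 0 ≤ ∑ i, second i

/-- The linear map whose values on the tangent frame are the slopes. -/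
def slopeMap {k N : ℕ} (ν q : Fin k → EuclideanSpace ℝ (Fin N)) :
    EuclideanSpace ℝ (Fin N) →ₗ[ℝ] EuclideanSpace ℝ (Fin N) :=
  ∑ β, ((innerₗ (EuclideanSpace ℝ (Fin N))) (q β)).smulRight (∑ α, (gram ν q)⁻¹ β α • ν α)

theorem slope_eq_slopeMap {N : ℕ}
    (B : OrthonormalBasis (Option (Fin n) ⊕ Fin m) ℝ (EuclideanSpace ℝ (Fin N)))
    (q : Fin m → EuclideanSpace ℝ (Fin N)) (b : Option (Fin n)) :
    slope B q b = slopeMap (normalPart B) q (B (Sum.inl b)) := by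
  simp only [slope, slopeMatrix, Matrix.mul_apply, tangentCoeff, Matrix.of_apply, slopeMap,
    LinearMap.sum_apply, LinearMap.smulRight_apply, innerₗ_apply_apply, Finset.smul_sum,
    Finset.sum_smul, smul_smul]
  rw [Finset.sum_comm]
  refine Finset.sum_congr rfl fun β _ => Finset.sum_congr rfl fun α _ => ?_
  rw [real_inner_comm]
  rfl

variable [IsManifold (𝓡 n) ∞ M] [NeZero n] [NeZero m]

/-- The quadratic form controlling the Laplacian of `w⁻²`. -/
def curvatureForm {ι W : Type*} [Fintype ι] [NormedAddCommGroup W] [InnerProductSpace ℝ W]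
    (b : ι → ι → W) (z : ι → W) : ℝ :=
  ∑ i, ∑ j, ‖b i j‖ ^ 2 + slopeForm b z + 2 * ∑ i, (∑ j, ⟪b i j, z j⟫_ℝ) ^ 2

variable {o : ManifoldOrientation n M} {f : M → Ambient n m} {hf : IsSphereImmersion f} {x : M}

/-- Choosing the tangent frame that diagonalizes the slope map makes the slopes orthogonal, and |w|
≥ 1/3 becomes the product bound 9 of the algebraic inequality. The strict bound gives its rigidity.
-/
theorem exists_isLocalModel_of_le (p : Frame m (n + m + 1))
    (h0 : w (normalGaussMap o hf x) (Quotient.mk _ p) ≠ 0)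
    (h9 : 1 / 9 ≤ w (normalGaussMap o hf x) (Quotient.mk _ p) ^ 2) :
    ∃ t B X, IsLocalModel o hf x t B X ∧
      0 ≤ curvatureForm (hess f x t X) (fun j => slope B p.1 (some j)) ∧
      (1 / 9 < w (normalGaussMap o hf x) (Quotient.mk _ p) ^ 2 →
        curvatureForm (hess f x t X) (fun j => slope B p.1 (some j)) ≤ 0 →
        ∀ i j, hess f x t X i j = 0) := by
  obtain ⟨t, ht1, ht2, ht3⟩ := exists_orthonormal_diagonalizing (n := n)
    (finrank_range_differential hf x) (slopeMap (normalFrame o hf x).1 p.1)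
  obtain ⟨B, X, h⟩ := exists_isLocalModel o hf (t := t) ⟨ht1, ht2⟩
  have hz : ∀ i j : Fin n, i ≠ j → ⟪slope B p.1 (some i), slope B p.1 (some j)⟫_ℝ = 0 := by
    intro i j hij
    rw [slope_eq_slopeMap, slope_eq_slopeMap, h.tangent_eq, h.tangent_eq, h.normal_eq]
    exact ht3 i j hij
  rw [h.w_eq'] at h0
  have hprod := prod_one_add_slope_le p.2 h0 hz
  rw [← h.w_eq'] at hprod
  refine ⟨t, B, X, h, norm_sq_add_slopeForm_nonneg (h.hess_comm hf) hz (hprod.trans ?_),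
    fun h9' hle => eq_zero_of_norm_sq_add_slopeForm_le (h.hess_comm hf) hz
      (hprod.trans_lt ?_) hle⟩
  · rw [inv_le_comm₀ (by linarith) (by norm_num)]
    linarith
  · rw [inv_lt_comm₀ (by linarith) (by norm_num)]
    linarith

/-- The frame starts with the image of the kernel of the Gauss differential, which lies in the
nullity of the Hessian. The slope form is then nonnegative, so the curvature form dominates ∑ ‖b i
j‖² with no lower bound on w. -/
theorem exists_isLocalModel_of_rank (p : Frame m (n + m + 1))
    (hmin : ∀ x, meanCurvature f x = 0) (hr : normalGaussRank o hf x ≤ 2) :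
    ∃ t B X, IsLocalModel o hf x t B X ∧
      0 ≤ curvatureForm (hess f x t X) (fun j => slope B p.1 (some j)) ∧
      (curvatureForm (hess f x t X) (fun j => slope B p.1 (some j)) ≤ 0 →
        ∀ i j, hess f x t X i j = 0) := by
  have hk := finrank_gaussKernel o hf x
  obtain ⟨t, ht1, ht2, ht3⟩ := exists_orthonormal_extending (n := n) (gaussKernel_le o hf x)
    (finrank_range_differential hf x)
  obtain ⟨B, X, h⟩ := exists_isLocalModel o hf (t := t) ⟨ht1, ht2⟩
  have hn : 0 < n := Nat.pos_of_ne_zero (NeZero.ne n)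
  -- The kernel has dimension at least n - 2, so only the last two indices escape it. Subtraction is
  -- truncated: for n = 1 the two indices coincide.
  have hpq : ∀ i : Fin n, i ≠ ⟨n - 1, by omega⟩ → i ≠ ⟨n - 2, by omega⟩ →
      ∀ j, hess f x t X i j = 0 := by
    intro i hi1 hi2 j
    refine h.fderiv_fderiv_graphMap_eq_zero ?_ j
    have hi : i.1 < Module.finrank ℝ (gaussKernel o hf x) := by
      have h1 : i.1 ≠ n - 1 := fun hh => hi1 (Fin.ext hh)
      have h2 : i.1 ≠ n - 2 := fun hh => hi2 (Fin.ext hh)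
      have := i.2
      omega
    rw [Finset.sum_eq_single i]
    · simpa [stdVec] using ht3 i hi
    · intro k _ hk
      simp [stdVec, hk]
    · simp
  have hS := slopeForm_nonneg_of_rank_two (h.hess_comm hf)
    (h.sum_fderiv_fderiv_graphMap_zero hf hmin) (fun j => slope B p.1 (some j)) _ _ hpq
  have h1 : ∀ i, 0 ≤ ∑ j, ‖hess f x t X i j‖ ^ 2 := fun i =>
    Finset.sum_nonneg fun j _ => sq_nonneg _
  have h2 := Finset.sum_nonneg fun i (_ : i ∈ Finset.univ) => h1 i
  have h3 : 0 ≤ ∑ i, (∑ j, ⟪hess f x t X i j, slope B p.1 (some j)⟫_ℝ) ^ 2 :=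
    Finset.sum_nonneg fun i _ => sq_nonneg _
  refine ⟨t, B, X, h, by rw [curvatureForm]; positivity, fun hle i j => ?_⟩
  rw [curvatureForm] at hle
  have h4 : ∑ i, ∑ j, ‖hess f x t X i j‖ ^ 2 = 0 := by linarith
  have h5 := (Finset.sum_eq_zero_iff_of_nonneg fun i _ => h1 i).1 h4 i (Finset.mem_univ i)
  have h6 := (Finset.sum_eq_zero_iff_of_nonneg fun j _ => sq_nonneg _).1 h5 j (Finset.mem_univ j)
  exact norm_eq_zero.1 (pow_eq_zero_iff two_ne_zero |>.1 h6)

theorem exists_isLocalModel_curvatureForm (p : Frame m (n + m + 1))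
    (hmin : ∀ x, meanCurvature f x = 0)
    (h0 : w (normalGaussMap o hf x) (Quotient.mk _ p) ≠ 0)
    (h9 : normalGaussRank o hf x ≤ 2 ∨ 1 / 9 < w (normalGaussMap o hf x) (Quotient.mk _ p) ^ 2) :
    ∃ t B X, IsLocalModel o hf x t B X ∧
      0 ≤ curvatureForm (hess f x t X) (fun j => slope B p.1 (some j)) ∧
      (curvatureForm (hess f x t X) (fun j => slope B p.1 (some j)) ≤ 0 →
        ∀ i j, hess f x t X i j = 0) := by
  rcases h9 with h9 | h9
  · exact exists_isLocalModel_of_rank p hmin h9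
  · obtain ⟨t, B, X, h1, h2, h3⟩ := exists_isLocalModel_of_le p h0 h9.le
    exact ⟨t, B, X, h1, h2, h3 h9⟩

/-- `w⁻²` is subharmonic. -/
theorem isSubsolutionAt_inv_w_sq (P : Grassmannian m (n + m + 1))
    (hmin : ∀ x, meanCurvature f x = 0) (h0 : w (normalGaussMap o hf x) P ≠ 0)
    (h9 : normalGaussRank o hf x ≤ 2 ∨ 1 / 9 < w (normalGaussMap o hf x) P ^ 2) :
    IsSubsolutionAt f (fun y => (w (normalGaussMap o hf y) P ^ 2)⁻¹) x := by
  induction P using Quotient.inductionOn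
  rename_i p
  obtain ⟨t, B, X, h, hQ, -⟩ := exists_isLocalModel_curvatureForm p hmin h0 h9
  obtain ⟨second, h1, h2⟩ := h.exists_hasJet hmin p h0
  refine ⟨t, fun i => hess f x t X i i, fun i s => X (s • stdVec i), _, second, h.frame,
    h.sum_fderiv_fderiv_graphMap_zero hf hmin,
    fun i => h.tendsto.comp (tendsto_line _), fun i => by simp [h.map_zero],
    fun i => h.hasJet_comp hf i, h1, ?_⟩
  rw [h2]
  exact mul_nonneg (by positivity) hQ

/-- If `w` is locally constant then the second fundamental form vanishes. -/
theorem secondFundamentalForm_eq_zero_of_w_eq (P : Grassmannian m (n + m + 1))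
    (hmin : ∀ x, meanCurvature f x = 0) (h0 : w (normalGaussMap o hf x) P ≠ 0)
    (h9 : normalGaussRank o hf x ≤ 2 ∨ 1 / 9 < w (normalGaussMap o hf x) P ^ 2)
    (hconst : ∀ᶠ y in 𝓝 x, w (normalGaussMap o hf y) P = w (normalGaussMap o hf x) P)
    (u v : TangentSpace (𝓡 n) x) : secondFundamentalForm f x u v = 0 := by
  induction P using Quotient.inductionOn
  rename_i p
  obtain ⟨t, B, X, h, hQ, hQ0⟩ := exists_isLocalModel_curvatureForm p hmin h0 h9
  obtain ⟨second, h1, h2⟩ := h.exists_hasJet hmin p h0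
  refine h.secondFundamentalForm_eq_zero hf (hQ0 ?_) u v
  have h3 : ∀ i, second i = 0 := by
    intro i
    refine ((h1 i).unique ((HasJet.const
      ((w (normalGaussMap o hf x) (Quotient.mk _ p) ^ 2)⁻¹)).congr ?_)).2
    filter_upwards [(h.tendsto.comp (tendsto_line (stdVec i))).eventually hconst] with s hs
    simp only [Function.comp_apply] at hs
    rw [hs]
  simp only [h3, Finset.sum_const_zero] at h2
  have h4 : 0 < 2 * (w (normalGaussMap o hf x) (Quotient.mk _ p) ^ 2)⁻¹ := by positivity
  exact ((mul_eq_zero.1 h2.symm).resolve_left h4.ne').le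

end Subsolution

/-! ### The strong maximum principle by an exponential barrier -/

section MaximumPrinciple

/-- By strict differentiability the chord G q.1 - G q.2 and its linearization at q.2 are both close
to L (q.1 - q.2), and an injective L is bounded below. Consequently short chords of an immersion are
never normal at their endpoints. -/
theorem eventually_inner_fderiv_sub_pos {E W : Type*} [NormedAddCommGroup E] [NormedSpace ℝ E]
    [FiniteDimensional ℝ E] [NormedAddCommGroup W] [InnerProductSpace ℝ W] {G : E → W} {p : E}
    (hG : ContDiffAt ℝ 1 G p) (hinj : Function.Injective (fderiv ℝ G p)) :
    ∀ᶠ q : E × E in 𝓝 (p, p), q.1 ≠ q.2 →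
      0 < ⟪fderiv ℝ G q.2 (q.1 - q.2), G q.1 - G q.2⟫_ℝ := by
  set L := fderiv ℝ G p with hL
  obtain ⟨K, hK0, hK⟩ := LinearMap.exists_antilipschitzWith (L : E →ₗ[ℝ] W)
    (LinearMap.ker_eq_bot.2 hinj)
  have hK' : ∀ v, ‖v‖ ≤ K * ‖L v‖ := fun v => by
    have := hK.le_mul_dist v 0
    simpa using this
  have hKpos : (0 : ℝ) < K := by exact_mod_cast hK0
  -- With this choice each of the two errors is at most a quarter of ‖L v‖, and 1 - 1/4 - 1/4 - 1/16
  -- > 0.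
  set ε : ℝ := (4 * K)⁻¹ with hε
  have hεpos : 0 < ε := by positivity
  have h1 : ∀ᶠ q : E × E in 𝓝 (p, p), ‖G q.1 - G q.2 - L (q.1 - q.2)‖ ≤ ε * ‖q.1 - q.2‖ :=
    (hG.hasStrictFDerivAt (by simp)).isLittleO.def hεpos
  have h2 : ∀ᶠ q : E × E in 𝓝 (p, p), ‖fderiv ℝ G q.2 - L‖ ≤ ε := by
    have hc : ContinuousAt (fderiv ℝ G) p := (hG.fderiv_right (m := 0) (by simp)).continuousAt
    have h3 : ContinuousAt (fun q : E × E => ‖fderiv ℝ G q.2 - L‖) (p, p) :=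
      ((ContinuousAt.comp (g := fderiv ℝ G) (f := Prod.snd) (x := (p, p)) hc
        continuousAt_snd).sub continuousAt_const).norm
    exact (h3.eventually (gt_mem_nhds (by simpa [← hL] using hεpos))).mono fun q hq => hq.le
  filter_upwards [h1, h2] with q hq1 hq2 hne
  set v := q.1 - q.2 with hv
  have hv0 : 0 < ‖v‖ := norm_pos_iff.2 (sub_ne_zero.2 hne)
  have h3 : ‖fderiv ℝ G q.2 v - L v‖ ≤ ε * ‖v‖ :=
    ((fderiv ℝ G q.2 - L).le_opNorm v).trans (by gcongr)
  have h4 : 4 * (ε * ‖v‖) ≤ ‖L v‖ := by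
    have := hK' v
    rw [hε]
    field_simp
    linarith
  have e1 : fderiv ℝ G q.2 v = L v + (fderiv ℝ G q.2 v - L v) := by abel
  have e2 : G q.1 - G q.2 = L v + (G q.1 - G q.2 - L v) := by abel
  rw [e1, e2]
  set a := fderiv ℝ G q.2 v - L v
  set b := G q.1 - G q.2 - L v
  rw [inner_add_left, inner_add_right, inner_add_right, real_inner_self_eq_norm_sq]
  have i1 := abs_le.1 (abs_real_inner_le_norm (L v) b)
  have i2 := abs_le.1 (abs_real_inner_le_norm a (L v))
  have i3 := abs_le.1 (abs_real_inner_le_norm a b)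
  have hpos : 0 < ε * ‖v‖ := by positivity
  have j1 : ‖L v‖ * ‖b‖ ≤ ‖L v‖ * (ε * ‖v‖) := by gcongr
  have j2 : ‖a‖ * ‖L v‖ ≤ (ε * ‖v‖) * ‖L v‖ := by gcongr
  have j3 : ‖a‖ * ‖b‖ ≤ (ε * ‖v‖) * (ε * ‖v‖) := by gcongr
  nlinarith

variable {n m : ℕ} {M : Type*} [TopologicalSpace M] [ChartedSpace (Model n) M]
  [IsManifold (𝓡 n) ∞ M] {f : M → Ambient n m}

/-- The tangent vectors detecting chords serve two purposes: they give local injectivity of f, and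
they guarantee that the barrier direction has a tangential component at the touching point, bounded
below nearby by continuity. -/
theorem exists_local_tangent_field (hf : IsSphereImmersion f) (z : M) :
    ∃ V : Model n → M → Ambient n m, (∀ᶠ x in 𝓝 z, ∀ v, ContinuousAt (V v) x) ∧
      (∀ᶠ x in 𝓝 z, ∀ v, V v x ∈ LinearMap.range (differential f x)) ∧
      ∃ U ∈ 𝓝 z, ∀ x ∈ U, ∀ y ∈ U, x ≠ y → ∃ v, ⟪V v x, f y - f x⟫_ℝ ≠ 0 := by
  set φ := extChartAt (𝓡 n) z with hφ
  have hsm := (hf.contDiffAt_inChart z).of_le (show (1 : ℕ∞ω) ≤ ∞ by norm_cast)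
  have hφc : ContinuousAt φ z := continuousAt_extChartAt (I := 𝓡 n) z
  have hsmall : ∀ᶠ x in 𝓝 z, ContDiffAt ℝ 1 (inChart f z) (φ x) :=
    hφc.eventually (hsm.eventually (by simp))
  have hbase : ∀ᶠ x in 𝓝 z,
      x ∈ (trivializationAt (Model n) (TangentSpace (𝓡 n)) z).baseSet :=
    (trivializationAt (Model n) (TangentSpace (𝓡 n)) z).open_baseSet.mem_nhds
      (mem_baseSet_trivializationAt _ _ z)
  have hsrc : ∀ᶠ x in 𝓝 z, x ∈ φ.source := extChartAt_source_mem_nhds (I := 𝓡 n) z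
  refine ⟨fun v x => fderiv ℝ (inChart f z) (φ x) v, ?_, ?_, ?_⟩
  · filter_upwards [hsmall, hsrc] with x hx hx' v
    have h1 : ContinuousAt (fderiv ℝ (inChart f z)) (φ x) :=
      (hx.fderiv_right (m := 0) (by simp)).continuousAt
    have h2 : ContinuousAt φ x := continuousAt_extChartAt' hx'
    exact (ContinuousAt.comp (g := fderiv ℝ (inChart f z)) (f := φ) h1 h2).clm_apply
      continuousAt_const
  · filter_upwards [hsmall, hbase] with x hx hx' v
    rw [← differential_trivialization_symm hx' (hx.differentiableAt (by simp))]
    exact LinearMap.mem_range_self _ _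
  · have hinj : Function.Injective (fderiv ℝ (inChart f z) (φ z)) := by
      intro a b hab
      have := hf.injective z (a₁ := a) (a₂ := b)
      exact this ((differential_eq_fderiv hf z a).trans
        (Eq.trans hab (differential_eq_fderiv hf z b).symm))
    have h1 := eventually_inner_fderiv_sub_pos hsm hinj
    rw [nhds_prod_eq] at h1
    have h3 : ∀ᶠ q : M × M in 𝓝 z ×ˢ 𝓝 z, φ q.1 ≠ φ q.2 →
        0 < ⟪fderiv ℝ (inChart f z) (φ q.2) (φ q.1 - φ q.2),
          inChart f z (φ q.1) - inChart f z (φ q.2)⟫_ℝ :=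
      (Filter.Tendsto.prodMap hφc hφc).eventually h1
    obtain ⟨U, hU, h4⟩ := Filter.eventually_prod_self_iff'.1 h3
    refine ⟨U ∩ φ.source, Filter.inter_mem hU hsrc, fun x hx y hy hxy => ?_⟩
    have h5 : φ y ≠ φ x := fun h => hxy (φ.injOn hx.2 hy.2 h.symm)
    have h6 := h4 y hy.1 x hx.1 h5
    have h7 : ∀ w ∈ φ.source, inChart f z (φ w) = f w := fun w hw => by
      simp only [inChart, Function.comp_apply]
      rw [φ.left_inv hw]
    rw [h7 x hx.2, h7 y hy.2] at h6
    exact ⟨_, h6.ne'⟩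

theorem inner_sq_le_of_isTangentFrame (hf : IsSphereImmersion f) {x : M}
    {t : Fin n → Ambient n m} (ht : IsTangentFrame f x t) {v : Ambient n m}
    (hv : v ∈ LinearMap.range (differential f x)) (Y : Ambient n m) :
    ⟪v, Y⟫_ℝ ^ 2 ≤ ‖v‖ ^ 2 * ∑ i, ⟪Y, t i⟫_ℝ ^ 2 := by
  rw [← ht.span_eq hf] at hv
  obtain ⟨c, rfl⟩ := (Submodule.mem_span_range_iff_exists_fun ℝ).1 hv
  have h1 : ‖∑ i, c i • t i‖ ^ 2 = ∑ i, c i ^ 2 := by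
    rw [← real_inner_self_eq_norm_sq, ht.orthonormal.inner_sum]
    simp [sq]
  have h2 : ⟪∑ i, c i • t i, Y⟫_ℝ = ∑ i, c i * ⟪Y, t i⟫_ℝ := by
    rw [sum_inner]
    exact Finset.sum_congr rfl fun i _ => by rw [real_inner_smul_left, real_inner_comm]
  rw [h1, h2]
  exact Finset.sum_mul_sq_le_sq_mul_sq _ _ _

/-- Along curves as in `IsSubsolutionAt`, an exponential barrier is strictly subharmonic. -/
theorem not_isLocalMax_add_barrier (hf : IsSphereImmersion f) {x : M} {Φ : M → ℝ}
    (hΦ : IsSubsolutionAt f Φ x) {Y : Ambient n m} {κ ε C : ℝ} (hκ : 0 < κ) (hε : 0 < ε)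
    (hY : ∀ t, IsTangentFrame f x t → n * ‖Y‖ < κ * ∑ i, ⟪Y, t i⟫_ℝ ^ 2) :
    ¬ IsLocalMax (fun y => Φ y + ε * (Real.exp (κ * ⟪Y, f y⟫_ℝ) - C)) x := by
  intro hmax
  obtain ⟨t, b, X, first, second, ht, hb, hX, hX0, hfj, hΦj, hsum⟩ := hΦ
  set e := Real.exp (κ * ⟪Y, f x⟫_ℝ) with he
  have hjet : ∀ i, HasJet (fun s => Φ (X i s) + ε * (Real.exp (κ * ⟪Y, f (X i s)⟫_ℝ) - C))
      (first i + ε * (e * (κ * ⟪Y, t i⟫_ℝ)))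
      (second i + ε * (e * (κ * ⟪Y, t i⟫_ℝ) ^ 2 + e * (κ * ⟪Y, b i - f x⟫_ℝ))) := by
    intro i
    have j1 := ((hfj i).clm (innerSL ℝ Y)).const_smul κ
    have j2 := j1.comp (φ := Real.exp) (φ' := Real.exp)
      (Filter.Eventually.of_forall fun y => Real.hasDerivAt_exp y) (Real.hasDerivAt_exp _)
    have j3 := (hΦj i).add ((j2.add (HasJet.const (-C))).const_smul ε)
    refine (j3.congr (Filter.Eventually.of_forall fun s => ?_)).cast ?_ ?_
    · simp [sub_eq_add_neg]
    · simp [hX0, he]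
    · simp [hX0, he]
  have hle : ∀ i, second i + ε * (e * (κ * ⟪Y, t i⟫_ℝ) ^ 2 + e * (κ * ⟪Y, b i - f x⟫_ℝ)) ≤ 0 := by
    intro i
    refine (hjet i).nonpos_of_isLocalMax ?_
    have := (hX i).eventually hmax
    filter_upwards [this] with s hs
    simpa only [hX0] using hs
  have h1 := Finset.sum_nonpos fun i (_ : i ∈ Finset.univ) => hle i
  have h2 : ∑ i, (second i + ε * (e * (κ * ⟪Y, t i⟫_ℝ) ^ 2 + e * (κ * ⟪Y, b i - f x⟫_ℝ))) =
      ∑ i, second i + ε * e * κ * (κ * ∑ i, ⟪Y, t i⟫_ℝ ^ 2 + ∑ i, ⟪Y, b i - f x⟫_ℝ) := by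
    rw [Finset.sum_add_distrib]
    refine congrArg _ ?_
    rw [Finset.mul_sum, ← Finset.sum_add_distrib, Finset.mul_sum]
    exact Finset.sum_congr rfl fun i _ => by ring
  -- Because the b i sum to zero, the second derivatives of f add up to -n f x: the coordinates
  -- satisfy Δf = -n f.
  have h3 : ∑ i, ⟪Y, b i - f x⟫_ℝ = -(n * ⟪Y, f x⟫_ℝ) := by
    rw [← inner_sum, Finset.sum_sub_distrib, hb]
    simp [inner_neg_right, ← Nat.cast_smul_eq_nsmul ℝ, real_inner_smul_right]
  have h4 : ⟪Y, f x⟫_ℝ ≤ ‖Y‖ := by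
    have := real_inner_le_norm Y (f x)
    rwa [hf.norm_eq_one, mul_one] at this
  have h5 : (n : ℝ) * ⟪Y, f x⟫_ℝ ≤ n * ‖Y‖ := by gcongr
  have h6 := hY t ht
  have h7 : 0 < ε * e * κ := by positivity
  rw [h2, h3] at h1
  have h8 := mul_pos h7 (show 0 < κ * ∑ i, ⟪Y, t i⟫_ℝ ^ 2 + -(n * ⟪Y, f x⟫_ℝ) by linarith)
  linarith

/-- The touching step of the strong maximum principle. -/
theorem not_touching [T2Space M] [LocallyCompactSpace M] (hf : IsSphereImmersion f) {z : M}
    {Φ : M → ℝ} {Y : Ambient n m} {V : M → Ambient n m} (hV : ContinuousAt V z)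
    (hVmem : ∀ᶠ x in 𝓝 z, V x ∈ LinearMap.range (differential f x))
    (hVY : ⟪V z, Y⟫_ℝ ≠ 0) (hc : ∀ᶠ x in 𝓝 z, ContinuousAt Φ x)
    (hsub : ∀ᶠ x in 𝓝 z, IsSubsolutionAt f Φ x) (hmax : ∀ᶠ x in 𝓝 z, Φ x ≤ Φ z)
    (hlt : ∀ᶠ x in 𝓝 z, x ≠ z → ⟪Y, f z⟫_ℝ ≤ ⟪Y, f x⟫_ℝ → Φ x < Φ z) : False := by
  have hfc : Continuous f := hf.contMDiff.continuous
  set R : ℝ := ‖V z‖ ^ 2 + 1 with hR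
  set g : ℝ := ⟪V z, Y⟫_ℝ ^ 2 / 2 with hg
  have hRpos : 0 < R := by positivity
  have hgpos : 0 < g := by positivity
  have h1 : ∀ᶠ x in 𝓝 z, ‖V x‖ ^ 2 < R :=
    (hV.norm.pow 2).eventually (gt_mem_nhds (lt_add_one (‖V z‖ ^ 2)))
  have h2 : ∀ᶠ x in 𝓝 z, g < ⟪V x, Y⟫_ℝ ^ 2 :=
    (ContinuousAt.pow (f := fun x => ⟪V x, Y⟫_ℝ) (Filter.Tendsto.inner hV tendsto_const_nhds)
      2).eventually (lt_mem_nhds (half_lt_self (by positivity)))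
  -- Near z one has ‖V‖² < R and ⟪V, Y⟫² > g, so the tangential part of Y has square greater than g
  -- / R; κ is taken so that κ g / R > n ‖Y‖.
  set κ : ℝ := (R * (n * ‖Y‖) + 1) / g with hκ
  have hκpos : 0 < κ := by positivity
  have hgood : ∀ᶠ x in 𝓝 z, ∀ t, IsTangentFrame f x t →
      n * ‖Y‖ < κ * ∑ i, ⟪Y, t i⟫_ℝ ^ 2 := by
    filter_upwards [h1, h2, hVmem] with x hx1 hx2 hx3 t ht
    have h3 := inner_sq_le_of_isTangentFrame hf ht hx3 Y
    set S := ∑ i, ⟪Y, t i⟫_ℝ ^ 2 with hS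
    have hS0 : 0 ≤ S := Finset.sum_nonneg fun i _ => sq_nonneg _
    have h4 : g < R * S := by
      have : ‖V x‖ ^ 2 * S ≤ R * S := by gcongr
      linarith
    have h5 : R * (n * ‖Y‖) < R * (κ * S) := by
      calc R * (n * ‖Y‖) < κ * g := by rw [hκ, div_mul_cancel₀ _ hgpos.ne']; linarith
        _ ≤ κ * (R * S) := by gcongr
        _ = R * (κ * S) := by ring
    exact lt_of_mul_lt_mul_left h5 hRpos.le
  obtain ⟨K, hKz, hKsub, hK⟩ := local_compact_nhds
    (hgood.and (hc.and (hsub.and (hmax.and hlt))))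
  have hKmem : ∀ x ∈ K, _ := fun x hx => hKsub hx
  have hΦK : ContinuousOn Φ K := fun x hx => (hKmem x hx).2.1.continuousWithinAt
  set h : M → ℝ := fun y => Real.exp (κ * ⟪Y, f y⟫_ℝ) with hh
  have hhc : Continuous h := by fun_prop
  -- The boundary points where the barrier does not drop below its value at z. There Φ is strictly
  -- below Φ z, by compactness with a uniform gap Φ z - a.
  set S : Set M := (K \ interior K) ∩ {x | ⟪Y, f z⟫_ℝ ≤ ⟪Y, f x⟫_ℝ} with hS
  have hScomp : IsCompact S := (hK.diff isOpen_interior).inter_right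
    (isClosed_le continuous_const (continuous_const.inner hfc))
  have hzint : z ∈ interior K := mem_interior_iff_mem_nhds.2 hKz
  obtain ⟨a', ha', haS'⟩ := hScomp.exists_forall_le' (f := fun x => -Φ x) (a := -Φ z)
    (hΦK.mono fun x hx => hx.1.1).neg (fun x hx => neg_lt_neg ((hKmem x hx.1.1).2.2.2.2
      (fun hxz => hx.1.2 (hxz ▸ hzint)) hx.2))
  obtain ⟨a, rfl⟩ : ∃ a, a' = -a := ⟨-a', (neg_neg a').symm⟩
  have ha : a < Φ z := neg_lt_neg_iff.1 ha'
  have haS : ∀ x ∈ S, Φ x ≤ a := fun x hx => neg_le_neg_iff.1 (haS' x hx)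
  set H : ℝ := Real.exp (κ * ‖Y‖) with hH
  have hhH : ∀ x, h x ≤ H := fun x => by
    simp only [hh, hH]
    have := real_inner_le_norm Y (f x)
    rw [hf.norm_eq_one, mul_one] at this
    gcongr
  -- The barrier h takes values in (0, H], so on S the perturbation costs at most half the gap.
  -- Elsewhere on the boundary it is negative, which forces the maximum of Ψ into the interior.
  set ε : ℝ := (Φ z - a) / (2 * H) with hε
  have hHpos : 0 < H := Real.exp_pos _
  have hεpos : 0 < ε := div_pos (by linarith) (by positivity)
  set Ψ : M → ℝ := fun y => Φ y + ε * (h y - h z) with hΨ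
  have hΨK : ContinuousOn Ψ K := by
    refine hΦK.add (ContinuousOn.mul continuousOn_const ?_)
    exact (hhc.continuousOn).sub continuousOn_const
  obtain ⟨x, hxK, hx⟩ := hK.exists_isMaxOn ⟨z, interior_subset hzint⟩ hΨK
  have hxz : Φ z ≤ Ψ x := by
    have := hx (interior_subset hzint)
    simpa [hΨ] using this
  have hxint : x ∈ interior K := by
    by_contra hcon
    by_cases hYx : ⟪Y, f z⟫_ℝ ≤ ⟪Y, f x⟫_ℝ
    · have h3 := haS x ⟨⟨hxK, hcon⟩, hYx⟩
      have h4 : ε * (h x - h z) ≤ ε * H := by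
        have : 0 < h z := Real.exp_pos _
        have := hhH x
        gcongr
        linarith
      have h5 : ε * H = (Φ z - a) / 2 := by rw [hε]; field_simp
      simp only [hΨ] at hxz
      linarith
    · push Not at hYx
      have h3 : h x < h z := by
        simp only [hh]
        gcongr
      have h4 := (hKmem x hxK).2.2.2.1
      have h5 : ε * (h x - h z) < 0 := mul_neg_of_pos_of_neg hεpos (by linarith)
      simp only [hΨ] at hxz
      linarith
  refine not_isLocalMax_add_barrier hf (hKmem x hxK).2.2.1 hκpos hεpos (hKmem x hxK).1
    (C := h z) ?_
  filter_upwards [mem_interior_iff_mem_nhds.1 hxint] with y hy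
  exact hx hy

/-- The strong maximum principle. -/
theorem eventually_eq_of_isSubsolutionAt [T2Space M] [LocallyCompactSpace M]
    (hf : IsSphereImmersion f) {z : M} {Φ : M → ℝ} (hc : ∀ᶠ x in 𝓝 z, ContinuousAt Φ x)
    (hsub : ∀ᶠ x in 𝓝 z, IsSubsolutionAt f Φ x) (hmax : ∀ᶠ x in 𝓝 z, Φ x ≤ Φ z) :
    ∀ᶠ x in 𝓝 z, Φ x = Φ z := by
  by_contra hcon
  have hfc : Continuous f := hf.contMDiff.continuous
  obtain ⟨V, hV1, hV2, U, hU, hV3⟩ := exists_local_tangent_field hf z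
  obtain ⟨K, hKz, hKsub, hK⟩ := local_compact_nhds (Filter.inter_mem hU
    (hV1.and (hV2.and (hc.and (hsub.and hmax)))))
  have hK1 : ∀ x ∈ K, ∀ v, ContinuousAt (V v) x := fun x hx => (hKsub hx).2.1
  have hK2 : ∀ x ∈ K, ∀ v, V v x ∈ LinearMap.range (differential f x) :=
    fun x hx => (hKsub hx).2.2.1
  have hK3 : ∀ x ∈ K, ContinuousAt Φ x := fun x hx => (hKsub hx).2.2.2.1
  have hK4 : ∀ x ∈ K, IsSubsolutionAt f Φ x := fun x hx => (hKsub hx).2.2.2.2.1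
  have hK5 : ∀ x ∈ K, Φ x ≤ Φ z := fun x hx => (hKsub hx).2.2.2.2.2
  have hK6 : ∀ x ∈ K, ∀ y ∈ K, x ≠ y → ∃ v, ⟪V v x, f y - f x⟫_ℝ ≠ 0 :=
    fun x hx y hy => hV3 x (hKsub hx).1 y (hKsub hy).1
  have hinj : ∀ x ∈ K, ∀ y ∈ K, x ≠ y → f x ≠ f y := by
    intro x hx y hy hxy heq
    obtain ⟨v, hv⟩ := hK6 x hx y hy hxy
    rw [heq, sub_self, inner_zero_right] at hv
    exact hv rfl
  have hΦK : ContinuousOn Φ K := fun x hx => (hK3 x hx).continuousWithinAt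
  have hzK : z ∈ K := mem_of_mem_nhds hKz
  have hzint : z ∈ interior K := mem_interior_iff_mem_nhds.2 hKz
  obtain ⟨r, hr, hrK⟩ := (hK.diff (isOpen_interior (s := K))).exists_forall_le'
    (f := fun y => dist (f y) (f z)) (a := 0) (hfc.dist continuous_const).continuousOn
    (fun y hy => dist_pos.2 (hinj y hy.1 z hzK fun h => hy.2 (h ▸ hzint)))
  have hnear : ∀ᶠ y in 𝓝 z, y ∈ K ∧ dist (f y) (f z) < r / 2 :=
    Filter.Eventually.and hKz ((hfc.dist continuous_const).continuousAt.eventually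
      (gt_mem_nhds (by simpa using hr)))
  -- If p is within r / 2 of z (distances measured in the image), a nearest maximum point q
  -- satisfies dist q z ≤ 2 dist p z < r, and so q is interior to K.
  obtain ⟨p, hpne, hpK, hpr⟩ := ((Filter.not_eventually.1 hcon).and_eventually hnear).exists
  have hEcomp : IsCompact (K ∩ Φ ⁻¹' {Φ z}) :=
    hK.of_isClosed_subset (hΦK.preimage_isClosed_of_isClosed hK.isClosed isClosed_singleton)
      Set.inter_subset_left
  obtain ⟨q, ⟨hqK, hqΦ⟩, hq⟩ := hEcomp.exists_isMinOn ⟨z, hzK, rfl⟩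
    (f := fun y => dist (f y) (f p)) (hfc.dist continuous_const).continuousOn
  have hqΦ' : Φ q = Φ z := hqΦ
  have hqz : dist (f q) (f p) ≤ dist (f z) (f p) := hq ⟨hzK, rfl⟩
  have hqint : q ∈ interior K := by
    by_contra hcon
    have h1 := hrK q ⟨hqK, hcon⟩
    have h2 := dist_triangle (f q) (f p) (f z)
    rw [dist_comm (f z)] at hqz
    linarith
  have hqp : q ≠ p := fun h => hpne (by rw [← h, hqΦ'])
  have hKq : K ∈ 𝓝 q := mem_interior_iff_mem_nhds.1 hqint
  obtain ⟨v, hv⟩ := hK6 q hqK p hpK hqp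
  have hVq : ⟪V v q, f q⟫_ℝ = 0 := by
    obtain ⟨u, hu⟩ := hK2 q hqK v
    rw [← hu, real_inner_comm, inner_differential hf]
  -- Another maximum point x is no closer to p than q is, so ⟪f p, f x⟫ ≤ ⟪f p, f q⟫, while ⟪f q, f
  -- x⟫ < 1 = ⟪f q, f q⟫. Adding f q to f p thus makes the cap {⟪Y, f q⟫ ≤ ⟪Y, f ·⟫} touch the
  -- maximum set at q alone. Its pairing with a tangent vector at q is unchanged, as f q is
  -- orthogonal to the tangent space.
  refine not_touching hf (z := q) (Φ := Φ) (Y := f p + f q) (V := V v) (hK1 q hqK v) ?_ ?_ ?_ ?_ ?_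
    ?_
  · filter_upwards [hKq] with x hx using hK2 x hx v
  · rw [inner_sub_right, hVq, sub_zero] at hv
    rwa [inner_add_right, hVq, add_zero]
  · filter_upwards [hKq] with x hx using hK3 x hx
  · filter_upwards [hKq] with x hx using hK4 x hx
  · filter_upwards [hKq] with x hx
    rw [hqΦ']
    exact hK5 x hx
  · filter_upwards [hKq] with x hx hxq hY
    rw [hqΦ']
    refine lt_of_le_of_ne (hK5 x hx) fun hxΦ => ?_
    have h1 : dist (f q) (f p) ≤ dist (f x) (f p) := hq ⟨hx, hxΦ⟩
    have h2 : ⟪f q, f x⟫_ℝ < 1 :=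
      (inner_lt_one_iff_real_of_norm_eq_one (hf.norm_eq_one q) (hf.norm_eq_one x)).2
        (hinj q hqK x hx (Ne.symm hxq))
    rw [dist_eq_norm, dist_eq_norm] at h1
    have h3 := pow_le_pow_left₀ (norm_nonneg _) h1 2
    rw [norm_sub_sq_real, norm_sub_sq_real, hf.norm_eq_one, hf.norm_eq_one, hf.norm_eq_one] at h3
    rw [inner_add_left, inner_add_left, hf.inner_self] at hY
    rw [real_inner_comm (f p) (f q), real_inner_comm (f p) (f x)] at h3
    linarith

end MaximumPrinciple

/-! ### Totally geodesic immersions of compact manifolds are equators -/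

section Equator

variable {n m : ℕ} {M : Type*} [TopologicalSpace M] [ChartedSpace (Model n) M]
  {f : M → Ambient n m} {x : M}

namespace IsGnomonicParam

variable {t : Fin n → Ambient n m} {X : Model n → M}

theorem fderiv_fderiv_graphMap_eventually_eq_zero (h : IsGnomonicParam f x t X)
    (hf : IsSphereImmersion f) (hB : ∀ x u v, secondFundamentalForm f x u v = 0) :
    ∀ᶠ u in 𝓝 0, fderiv ℝ (fderiv ℝ (graphMap f x t X)) u = 0 := by
  filter_upwards [h.eq_zero_of_mem_normalSpace hf, h.fderiv_fderiv_graphMap_mem hf,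
    h.contMDiffAt, h.fderiv_fderiv_scaled hf, h.contDiffAt_scaleFactor hf] with u h1 h2 h3 h4 h5
  have h6 : ∀ a j, fderiv ℝ (fderiv ℝ (graphMap f x t X)) u a (stdVec j) = 0 := by
    intro a j
    refine h1 _ (h2 a j) fun v hv => ?_
    rw [← h4, inner_fderiv_fderiv_param hf h3 (h5.of_le (by norm_num)) hv, hB, inner_zero_right,
      mul_zero]
  ext1 a
  ext1 b
  calc fderiv ℝ (fderiv ℝ (graphMap f x t X)) u a b
      = fderiv ℝ (fderiv ℝ (graphMap f x t X)) u a (∑ j, b j • stdVec j) := by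
        rw [sum_smul_stdVec]
    _ = 0 := by simp only [map_sum, map_smul, h6, smul_zero, Finset.sum_const_zero]

theorem graphMap_eventually_eq_zero (h : IsGnomonicParam f x t X)
    (hf : IsSphereImmersion f) (hB : ∀ x u v, secondFundamentalForm f x u v = 0) :
    ∀ᶠ u in 𝓝 0, graphMap f x t X u = 0 ∧ fderiv ℝ (graphMap f x t X) u = 0 := by
  obtain ⟨ε, hε, hball⟩ := Metric.eventually_nhds_iff_ball.1
    ((h.fderiv_fderiv_graphMap_eventually_eq_zero hf hB).and (h.contDiffAt_graphMap hf))
  have h0 : (0 : Model n) ∈ Metric.ball (0 : Model n) ε := Metric.mem_ball_self hε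
  have hpre : IsPreconnected (Metric.ball (0 : Model n) ε) := (convex_ball 0 ε).isPreconnected
  have h1 : ∀ u ∈ Metric.ball (0 : Model n) ε, fderiv ℝ (graphMap f x t X) u = 0 := by
    intro u hu
    have := Metric.isOpen_ball.is_const_of_fderiv_eq_zero (𝕜 := ℝ) hpre
      (f := fderiv ℝ (graphMap f x t X)) (fun y hy => by
        have := ((hball y hy).2.fderiv_right (m := 2) (by norm_num)).differentiableAt (by simp)
        exact this.differentiableWithinAt) (fun y hy => (hball y hy).1) hu h0
    rw [this, h.fderiv_graphMap_zero hf]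
  have h2 : ∀ u ∈ Metric.ball (0 : Model n) ε, graphMap f x t X u = 0 := by
    intro u hu
    have := Metric.isOpen_ball.is_const_of_fderiv_eq_zero (𝕜 := ℝ) hpre
      (f := graphMap f x t X) (fun y hy =>
        ((hball y hy).2.differentiableAt (by simp)).differentiableWithinAt) h1 hu h0
    rw [this, h.graphMap_zero hf]
  filter_upwards [Metric.ball_mem_nhds 0 hε] with u hu using ⟨h2 u hu, h1 u hu⟩

end IsGnomonicParam

variable [IsManifold (𝓡 n) ∞ M]

theorem normalSpace_eventually_eq (hf : IsSphereImmersion f)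
    (hB : ∀ x u v, secondFundamentalForm f x u v = 0) (x : M) :
    ∀ᶠ y in 𝓝 x, normalSpace f y = normalSpace f x := by
  obtain ⟨t, ht⟩ := exists_isTangentFrame hf x
  obtain ⟨X, h⟩ := exists_isGnomonicParam hf ht
  have h1 : ∀ᶠ u in 𝓝 0, normalSpace f (X u) = normalSpace f x := by
    filter_upwards [h.mem_normalSpace_param_iff hf, h.graphMap_eventually_eq_zero hf hB]
      with u hu ⟨hu1, hu2⟩
    ext v
    rw [hu, ht.mem_normalSpace_iff hf]
    simp [hu1, hu2]
  have hg := (contMDiffAt_gnomonic hf x t).continuousAt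
  rw [ContinuousAt, ht.gnomonic_self hf] at hg
  filter_upwards [h.left_inv, hg.eventually h1] with y h5 h6
  rwa [h5] at h6

/-- The vectors of the cone over `M` near `f x` are covered by `f`. -/
theorem mem_range_eventually (hf : IsSphereImmersion f)
    (hB : ∀ x u v, secondFundamentalForm f x u v = 0) (x : M) :
    ∀ᶠ v in 𝓝 (f x), ‖v‖ = 1 → v ∈ (normalSpace f x)ᗮ → v ∈ Set.range f := by
  obtain ⟨t, ht⟩ := exists_isTangentFrame hf x
  obtain ⟨X, h⟩ := exists_isGnomonicParam hf ht
  let ν : OrthonormalBasis (Fin m) ℝ (normalSpace f x) :=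
    (stdOrthonormalBasis ℝ _).reindex (finCongr (finrank_normalSpace hf x))
  obtain ⟨B, hBa, hBt, hBn⟩ := exists_isAdapted hf ht
    (ν.orthonormal.comp_linearIsometry (normalSpace f x).subtypeₗᵢ) (fun α => (ν α).2)
  let g : Ambient n m → Model n := fun v => WithLp.toLp 2 fun i => ⟪v, t i⟫_ℝ / ⟪v, f x⟫_ℝ
  have hg : ContinuousAt g (f x) := by
    refine (PiLp.continuous_toLp 2 _).continuousAt.comp (continuousAt_pi.2 fun i => ?_)
    refine ContinuousAt.div ?_ ?_ (by rw [hf.inner_self]; exact one_ne_zero)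
    · exact (continuous_id.inner continuous_const).continuousAt
    · exact (continuous_id.inner continuous_const).continuousAt
  have hg0 : g (f x) = 0 := by
    ext i
    simp [g, ht.inner_left hf]
  rw [ContinuousAt, hg0] at hg
  have hpos : ∀ᶠ v in 𝓝 (f x), 0 < ⟪v, f x⟫_ℝ :=
    ((continuous_id.inner continuous_const).continuousAt).eventually
      (lt_mem_nhds (by simp only [id]; rw [hf.inner_self]; exact one_pos))
  filter_upwards [hpos, hg.eventually h.inner_pos,
    hg.eventually (h.graphMap_eventually_eq_zero hf hB)] with v h1 h2 h3 hv1 hvN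
  -- The point with the same central projection as v. The graph map vanishes, so its image under f
  -- is a positive multiple of v, and both vectors are unit.
  refine ⟨X (g v), ?_⟩
  have h4 : scaleFactor f x X (g v) • f (X (g v)) = affinePart f x t (g v) :=
    sub_eq_zero.1 h3.1
  have h5 : v = ⟪v, f x⟫_ℝ • affinePart f x t (g v) := by
    have h6 := B.sum_repr' v
    rw [Fintype.sum_sum_type, Fintype.sum_option] at h6
    have h7 : ∀ α, ⟪B (Sum.inr α), v⟫_ℝ = 0 := fun α =>
      (Submodule.mem_orthogonal _ _).1 hvN _ (hBa.normal α)
    simp only [h7, zero_smul, Finset.sum_const_zero, add_zero, hBt, hBa.position] at h6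
    conv_lhs => rw [← h6]
    rw [affinePart, smul_add, Finset.smul_sum, real_inner_comm]
    refine congrArg _ (Finset.sum_congr rfl fun i _ => ?_)
    simp only [g]
    rw [smul_smul, mul_div_cancel₀ _ h1.ne', real_inner_comm]
  have hs : 0 < scaleFactor f x X (g v) := inv_pos.2 h2
  rw [← h4, smul_smul] at h5
  have h8 := congrArg norm h5
  rw [norm_smul, hv1, hf.norm_eq_one, mul_one, Real.norm_of_nonneg (by positivity)] at h8
  rw [← h8, one_smul] at h5
  exact h5.symm

/-- The normal space is locally constant, hence constant, and f takes values in the unit sphere of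
its orthogonal complement V. The image is closed by compactness and open by `mem_range_eventually`;
the sphere is connected because dim V = n + 1 ≥ 2. -/
theorem isEquator_range [CompactSpace M] [ConnectedSpace M] [NeZero n] (hf : IsSphereImmersion f)
    (hB : ∀ x u v, secondFundamentalForm f x u v = 0) : IsEquator n (Set.range f) := by
  obtain ⟨x₀⟩ : Nonempty M := inferInstance
  have hN : ∀ x, normalSpace f x = normalSpace f x₀ := by
    have h1 : IsLocallyConstant fun y => normalSpace f y :=
      (IsLocallyConstant.iff_eventually_eq _).2 (normalSpace_eventually_eq hf hB)
    exact fun x => h1.apply_eq_of_preconnectedSpace x x₀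
  set V := (normalSpace f x₀)ᗮ with hV
  have hrank : Module.finrank ℝ V = n + 1 := by
    have h1 := Submodule.finrank_add_finrank_orthogonal (normalSpace f x₀)
    rw [finrank_normalSpace hf] at h1
    have h2 := h1.trans (finrank_euclideanSpace_fin (𝕜 := ℝ) (n := n + m + 1))
    change Module.finrank ℝ ↥(normalSpace f x₀)ᗮ = n + 1
    omega
  have hfV : ∀ x, f x ∈ V := by
    intro x
    rw [hV, Submodule.mem_orthogonal, ← hN x]
    exact fun v hv => (mem_normalSpace_iff.1 hv).1
  refine ⟨V, hrank, Set.Subset.antisymm ?_ ?_⟩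
  · rintro _ ⟨x, rfl⟩
    exact ⟨by simp [hf.norm_eq_one], hfV x⟩
  · have hconn : IsConnected (Metric.sphere (0 : V) 1) := by
      refine isConnected_sphere ?_ 0 zero_le_one
      rw [← Module.finrank_eq_rank, hrank]
      have : 0 < n := Nat.pos_of_ne_zero (NeZero.ne n)
      exact_mod_cast (by omega : 1 < n + 1)
    have : PreconnectedSpace (Metric.sphere (0 : V) 1) :=
      isPreconnected_iff_preconnectedSpace.1 hconn.isPreconnected
    let ι : Metric.sphere (0 : V) 1 → Ambient n m := fun v => ((v : V) : Ambient n m)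
    have hι : Continuous ι := continuous_subtype_val.comp continuous_subtype_val
    have hclopen : IsClopen (ι ⁻¹' Set.range f) := by
      constructor
      · exact (isCompact_range hf.contMDiff.continuous).isClosed.preimage hι
      · rw [isOpen_iff_mem_nhds]
        rintro v ⟨x, hx⟩
        have h1 := mem_range_eventually hf hB x
        rw [hx] at h1
        filter_upwards [hι.continuousAt.eventually h1] with u hu
        refine hu ?_ ?_
        · exact mem_sphere_zero_iff_norm.1 u.2
        · rw [hN]
          exact (u : V).2
    have huniv := hclopen.eq_univ ⟨⟨⟨f x₀, hfV x₀⟩, by simp [hf.norm_eq_one]⟩, x₀, rfl⟩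
    rintro v ⟨hv1, hvV⟩
    have h2 : (⟨⟨v, hvV⟩, by simpa using hv1⟩ : Metric.sphere (0 : V) 1) ∈ ι ⁻¹' Set.range f := by
      rw [huniv]; trivial
    exact h2

end Equator

/-! ### The pencil spanned by two S-orthogonal planes -/

section Pencil

variable {k N : ℕ}

theorem gram_update_right (e q : Fin k → EuclideanSpace ℝ (Fin N)) (i : Fin k)
    (b : EuclideanSpace ℝ (Fin N)) :
    gram e (Function.update q i b) = (gram e q).updateCol i fun j => ⟪e j, b⟫_ℝ := by
  ext j l
  rw [Matrix.updateCol_apply]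
  split_ifs with h
  · subst h
    simp [gram]
  · simp [gram, Function.update_of_ne h]

theorem finrank_toSubmodule (G : Grassmannian k N) : Module.finrank ℝ (toSubmodule G) = k := by
  induction G using Quotient.inductionOn
  rename_i e
  change Module.finrank ℝ (Submodule.span ℝ (Set.range e.1)) = k
  rw [finrank_span_eq_card e.2.linearIndependent, Fintype.card_fin]

theorem orthonormal_update_neg {t : Fin k → EuclideanSpace ℝ (Fin N)} (ht : Orthonormal ℝ t)
    (i : Fin k) : Orthonormal ℝ (Function.update t i (-t i)) := by
  rw [orthonormal_iff_ite] at ht ⊢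
  intro j l
  by_cases hj : j = i
  · subst hj
    by_cases hl : l = j
    · subst hl
      simpa using ht l l
    · simpa [Function.update_of_ne hl, inner_neg_left, Ne.symm hl] using ht j l
  · by_cases hl : l = i
    · subst hl
      simpa [Function.update_of_ne hj, inner_neg_right, hj] using ht j l
    · simpa [Function.update_of_ne hj, Function.update_of_ne hl] using ht j l

/-- Every orthonormal basis of an oriented plane is, up to the sign of one vector, an oriented
orthonormal basis. -/
theorem exists_frame_eq (G : Grassmannian k N) {t : Fin k → EuclideanSpace ℝ (Fin N)}
    (ht : Orthonormal ℝ t) (hmem : ∀ i, t i ∈ toSubmodule G) (i₀ : Fin k) :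
    ∃ p : Frame k N, G = Quotient.mk _ p ∧ ∀ i, i ≠ i₀ → p.1 i = t i := by
  induction G using Quotient.inductionOn
  rename_i e
  have key : ∀ t : Fin k → EuclideanSpace ℝ (Fin N), ∀ ht : Orthonormal ℝ t,
      (∀ i, t i ∈ Submodule.span ℝ (Set.range e.1)) → (gram t e.1).det = 1 →
      (Quotient.mk (frameSetoid k N) e) = Quotient.mk _ ⟨t, ht⟩ := by
    intro t ht hmem hdet
    have h1 := eq_rotate_of_mem_span e.2 hmem
    refine Quotient.sound ⟨gram t e.1, ?_, h1⟩
    refine Matrix.mem_specialOrthogonalGroup_iff.2 ⟨?_, hdet⟩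
    rw [Matrix.mem_orthogonalGroup_iff]
    have h2 := gram_rotate (gram t e.1) (gram t e.1) e.1 e.1
    rw [← h1, gram_self_of_orthonormal ht, gram_self_of_orthonormal e.2, mul_one] at h2
    exact h2.symm
  have hdet : (gram t e.1).det * (gram t e.1).det = 1 := by
    have h1 := det_gram_of_mem_span e.2 hmem t
    rw [gram_self_of_orthonormal ht, Matrix.det_one, gram_comm e.1 t, Matrix.det_transpose] at h1
    exact h1.symm
  rcases mul_self_eq_one_iff.1 hdet with h | h
  · exact ⟨⟨t, ht⟩, key t ht hmem h, fun i _ => rfl⟩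
  · refine ⟨⟨Function.update t i₀ (-t i₀), orthonormal_update_neg ht i₀⟩, key _ _ ?_ ?_,
      fun i hi => Function.update_of_ne hi _ _⟩
    · intro i
      by_cases hi : i = i₀
      · subst hi
        rw [Function.update_self]
        exact neg_mem (hmem i)
      · rw [Function.update_of_ne hi]
        exact hmem i
    · rw [gram_comm, Matrix.det_transpose, ← gramAlternating_apply,
        AlternatingMap.map_update_neg, Function.update_eq_self, gramAlternating_apply, gram_comm,
        Matrix.det_transpose, h, neg_neg]

/-- An orthonormal basis of the (k - 1)-dimensional intersection is completed in each plane by one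
vector, placed at the last index. Orientation corrections touch only that vector, so the frames
agree elsewhere and w(P, Q) reduces to the inner product of the two remaining vectors. -/
theorem SOrthogonal.exists_frames {P Q : Grassmannian k N} (h : SOrthogonal P Q) :
    ∃ (i₀ : Fin k) (p q : Frame k N), P = Quotient.mk _ p ∧ Q = Quotient.mk _ q ∧
      (∀ i, i ≠ i₀ → q.1 i = p.1 i) ∧ ⟪p.1 i₀, q.1 i₀⟫_ℝ = 0 := by
  obtain ⟨hdim, hw⟩ := h
  obtain ⟨t, ht1, ht2, ht3⟩ := exists_orthonormal_extending (n := k)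
    (inf_le_left : toSubmodule P ⊓ toSubmodule Q ≤ toSubmodule P) (finrank_toSubmodule P)
  let i₀ : Fin k := ⟨k - 1, by omega⟩
  have hlt : ∀ i, i ≠ i₀ → t i ∈ toSubmodule Q := by
    intro i hi
    refine (ht3 i ?_).2
    have h1 : i.1 ≠ k - 1 := fun hh => hi (Fin.ext hh)
    have := i.2
    omega
  classical
  let v : Fin k → toSubmodule Q := fun i => if hi : i ≠ i₀ then ⟨t i, hlt i hi⟩ else 0
  have hv : Orthonormal ℝ (Set.domRestrict {i | i ≠ i₀} v) := by
    have h1 : ∀ i : {i | i ≠ i₀}, ((Set.domRestrict {i | i ≠ i₀} v i : toSubmodule Q) :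
        EuclideanSpace ℝ (Fin N)) = t i := by
      rintro ⟨i, hi⟩
      have hi' : i ≠ i₀ := hi
      simp [v, hi']
    rw [orthonormal_iff_ite]
    intro i j
    rw [Submodule.coe_inner, h1, h1, orthonormal_iff_ite.1 ht1]
    simp [Subtype.ext_iff]
  obtain ⟨c, hc⟩ := hv.exists_orthonormalBasis_extension_of_card_eq
    (by rw [finrank_toSubmodule, Fintype.card_fin])
  have hc' : ∀ i, i ≠ i₀ → (c i : EuclideanSpace ℝ (Fin N)) = t i := by
    intro i hi
    rw [hc i hi]
    simp [v, hi]
  obtain ⟨p, hp1, hp2⟩ := exists_frame_eq P ht1 ht2 i₀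
  obtain ⟨q, hq1, hq2⟩ := exists_frame_eq Q (t := fun i => (c i : EuclideanSpace ℝ (Fin N)))
    (c.orthonormal.comp_linearIsometry (toSubmodule Q).subtypeₗᵢ) (fun i => (c i).2) i₀
  have hpq : ∀ i, i ≠ i₀ → q.1 i = p.1 i := fun i hi => by rw [hq2 i hi, hc' i hi, hp2 i hi]
  refine ⟨i₀, p, q, hp1, hq1, hpq, ?_⟩
  have h2 : q.1 = Function.update p.1 i₀ (q.1 i₀) := by
    funext i
    by_cases hi : i = i₀
    · subst hi; simp
    · rw [Function.update_of_ne hi, hpq i hi]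
  have h3 : (gram p.1 q.1).det = ⟪p.1 i₀, q.1 i₀⟫_ℝ := by
    rw [h2, gram_update_right, gram_self_of_orthonormal p.2, ← Matrix.cramer_apply,
      Matrix.cramer_one, Function.update_self]
    rfl
  rw [← h3, ← hw, hp1, hq1]
  rfl

/-- The pencil of oriented planes spanned by two S-orthogonal ones. -/
theorem SOrthogonal.exists_pencil {P Q : Grassmannian k N} (h : SOrthogonal P Q) :
    ∃ R : ℝ → Grassmannian k N, ∀ β G, w G (R β) = Real.cos β * w G P + Real.sin β * w G Q := by
  obtain ⟨i₀, p, q, rfl, rfl, hpq, h0⟩ := h.exists_frames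
  have hq : q.1 = Function.update p.1 i₀ (q.1 i₀) := by
    funext i
    by_cases hi : i = i₀
    · subst hi; simp
    · rw [Function.update_of_ne hi, hpq i hi]
  have hortho : ∀ β : ℝ, Orthonormal ℝ (Function.update p.1 i₀
      (Real.cos β • p.1 i₀ + Real.sin β • q.1 i₀)) := by
    intro β
    have hp' := orthonormal_iff_ite.1 p.2
    have hq' := orthonormal_iff_ite.1 q.2
    have hb : ∀ i, i ≠ i₀ → ⟪p.1 i, q.1 i₀⟫_ℝ = 0 := fun i hi => by
      rw [← hpq i hi, hq' i i₀, if_neg hi]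
    rw [orthonormal_iff_ite]
    intro i j
    by_cases hi : i = i₀
    · subst hi
      by_cases hj : j = i
      · subst hj
        simp only [Function.update_self, inner_add_left, inner_add_right, real_inner_smul_left,
          real_inner_smul_right, h0, real_inner_comm (p.1 j) (q.1 j), hp' j j, hq' j j, if_true]
        have := Real.cos_sq_add_sin_sq β
        linear_combination this
      · have h1 := hb j hj
        rw [real_inner_comm] at h1
        simp only [Function.update_self, Function.update_of_ne hj, inner_add_left,
          real_inner_smul_left, h1, hp' i j, if_neg (Ne.symm hj)]
        simp
    · by_cases hj : j = i₀
      · subst hj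
        simp only [Function.update_self, Function.update_of_ne hi, inner_add_right,
          real_inner_smul_right, hb i hi, hp' i j, if_neg hi]
        simp
      · rw [Function.update_of_ne hi, Function.update_of_ne hj, hp' i j]
  refine ⟨fun β => Quotient.mk _ ⟨_, hortho β⟩, fun β G => ?_⟩
  induction G using Quotient.inductionOn
  rename_i e
  change (gram e.1 (Function.update p.1 i₀ _)).det =
    Real.cos β * (gram e.1 p.1).det + Real.sin β * (gram e.1 q.1).det
  conv_rhs => rw [hq]
  -- The three tuples differ only at the index i₀, where the determinant is linear.
  rw [← gramAlternating_apply, ← gramAlternating_apply, ← gramAlternating_apply,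
    AlternatingMap.map_update_add, AlternatingMap.map_update_smul, AlternatingMap.map_update_smul,
    Function.update_eq_self]
  rfl

end Pencil

/-! ### Rigidity from the maximum principle applied to the pencil -/

section Rigidity

variable {n m : ℕ} {M : Type*} [TopologicalSpace M] [ChartedSpace (Model n) M]
  [IsManifold (𝓡 n) ∞ M] [NeZero n] [NeZero m] [T2Space M] [CompactSpace M] [ConnectedSpace M]

/-- If the pairings of the Gauss map with a pencil are `r cos (θ - β)`, then one of them is
constant. -/
theorem exists_w_eq_const (o : ManifoldOrientation n M) {f : M → Ambient n m}
    (hf : IsSphereImmersion f) (hmin : ∀ x, meanCurvature f x = 0)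
    {R : ℝ → Grassmannian m (n + m + 1)} {θ r : M → ℝ} (hθ : Continuous θ) (hr : Continuous r)
    (hR : ∀ β x, w (normalGaussMap o hf x) (R β) = r x * Real.cos (θ x - β))
    {c : ℝ} (hc : 0 < c) (hcr : ∀ x, c < r x)
    (h9 : (∀ x, normalGaussRank o hf x ≤ 2) ∨ 1 / 9 < c ^ 2) :
    ∃ β, ∀ x, w (normalGaussMap o hf x) (R β) = c := by
  have hr0 : ∀ x, 0 < r x := fun x => hc.trans (hcr x)
  -- φ x is the angle in (0, π/2) at which r x cos equals c, so θ - φ is the value of β, behind θ,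
  -- at which the pairing with R β drops to c.
  set φ : M → ℝ := fun x => Real.arccos (c / r x) with hφ
  have hφc : Continuous φ :=
    Real.continuous_arccos.comp (continuous_const.div hr fun x => (hr0 x).ne')
  have hφ0 : ∀ x, 0 < φ x := fun x => Real.arccos_pos.2 ((div_lt_one (hr0 x)).2 (hcr x))
  have hφ1 : ∀ x, φ x < Real.pi / 2 := fun x =>
    Real.arccos_lt_pi_div_two.2 (div_pos hc (hr0 x))
  have hcos : ∀ x, r x * Real.cos (φ x) = c := fun x => by
    have h1 : 0 < c / r x := div_pos hc (hr0 x)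
    have h2 : c / r x < 1 := (div_lt_one (hr0 x)).2 (hcr x)
    rw [hφ, Real.cos_arccos (by linarith) h2.le, mul_div_cancel₀ _ (hr0 x).ne']
  have hGc : Continuous fun x => θ x - φ x := hθ.sub hφc
  obtain ⟨z₀, -, hz₀⟩ := isCompact_univ.exists_isMaxOn Set.univ_nonempty hGc.continuousOn
  set α := θ z₀ - φ z₀ with hα
  have hle : ∀ x, θ x - φ x ≤ α := fun x => hz₀ (Set.mem_univ x)
  -- At such a point z, 0 < θ - α ≤ φ holds nearby, so w(N, R α) = r cos (θ - α) ≥ r cos φ = c with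
  -- equality at z. The subsolution w⁻² therefore has a local maximum at z and is constant near it;
  -- injectivity of the cosine on [0, π] then returns θ - φ = α.
  have hopen : IsOpen {x | θ x - φ x = α} := by
    rw [isOpen_iff_mem_nhds]
    intro z hz
    have hz' : θ z - α = φ z := by
      have : θ z - φ z = α := hz
      linarith
    have hpos : 0 < θ z - α := by rw [hz']; exact hφ0 z
    have hnear : ∀ᶠ x in 𝓝 z, 0 < θ x - α := by
      have h1 : Continuous fun x => θ x - α := hθ.sub continuous_const
      exact h1.continuousAt.eventually (lt_mem_nhds hpos)
    have hge : ∀ᶠ x in 𝓝 z, c ≤ w (normalGaussMap o hf x) (R α) := by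
      filter_upwards [hnear] with x hx
      rw [hR, ← hcos x]
      have h1 : Real.cos (φ x) ≤ Real.cos (θ x - α) :=
        Real.cos_le_cos_of_nonneg_of_le_pi hx.le
          (by linarith [hφ1 x, Real.pi_pos]) (by linarith [hle x])
      exact mul_le_mul_of_nonneg_left h1 (hr0 x).le
    have hwz : w (normalGaussMap o hf z) (R α) = c := by rw [hR, hz', hcos]
    have hconst := eventually_eq_of_isSubsolutionAt hf
      (Φ := fun y => (w (normalGaussMap o hf y) (R α) ^ 2)⁻¹) (z := z) ?_ ?_ ?_
    · filter_upwards [hconst, hge, hnear] with x h1 h2 h3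
      simp only [hwz, inv_inj] at h1
      have h4 : w (normalGaussMap o hf x) (R α) = c :=
        (pow_left_inj₀ (hc.le.trans h2) hc.le two_ne_zero).1 h1
      rw [hR, ← hcos x] at h4
      have h5 := mul_left_cancel₀ (hr0 x).ne' h4
      have h6 := Real.injOn_cos ⟨h3.le, by linarith [hle x, hφ1 x, Real.pi_pos]⟩
        ⟨(hφ0 x).le, by linarith [hφ1 x, Real.pi_pos]⟩ h5
      change θ x - φ x = α
      linarith
    · filter_upwards [hge] with x hx
      exact ((continuous_w_normalGaussMap o hf (R α)).continuousAt.pow 2).inv₀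
        (pow_ne_zero 2 (hc.trans_le hx).ne')
    · filter_upwards [hge] with x hx
      refine isSubsolutionAt_inv_w_sq (R α) hmin (hc.trans_le hx).ne' ?_
      rcases h9 with h9 | h9
      · exact Or.inl (h9 x)
      · exact Or.inr (h9.trans_le (pow_le_pow_left₀ hc.le hx 2))
    · filter_upwards [hge] with x hx
      rw [hwz]
      exact inv_anti₀ (by positivity) (pow_le_pow_left₀ hc.le hx 2)
  have hclopen : IsClopen {x | θ x - φ x = α} := ⟨isClosed_eq hGc continuous_const, hopen⟩
  have huniv := hclopen.eq_univ ⟨z₀, rfl⟩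
  refine ⟨α, fun x => ?_⟩
  have hx : θ x - φ x = α := by
    have : x ∈ {x | θ x - φ x = α} := by rw [huniv]; trivial
    exact this
  rw [hR, ← hcos x, ← hx]
  congr 2
  ring

/-- A minimal immersion whose normal Gauss map avoids a slit is totally geodesic. -/
theorem secondFundamentalForm_eq_zero_of_slit (o : ManifoldOrientation n M) {f : M → Ambient n m}
    (hf : IsSphereImmersion f) (hmin : ∀ x, meanCurvature f x = 0)
    {P Q : Grassmannian m (n + m + 1)} (hPQ : SOrthogonal P Q) {c₀ : ℝ} (hc₀ : 0 ≤ c₀)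
    (h9 : (∀ x, normalGaussRank o hf x ≤ 2) ∨ 1 / 9 ≤ c₀ ^ 2)
    (hlow : ∀ x, c₀ ^ 2 < w (normalGaussMap o hf x) P ^ 2 + w (normalGaussMap o hf x) Q ^ 2)
    (hslit : ¬ ∃ x, w (normalGaussMap o hf x) Q = 0 ∧ w (normalGaussMap o hf x) P < 0)
    (x : M) (u v : TangentSpace (𝓡 n) x) : secondFundamentalForm f x u v = 0 := by
  obtain ⟨R, hR⟩ := hPQ.exists_pencil
  set ζ : M → ℂ := fun x => ⟨w (normalGaussMap o hf x) P, w (normalGaussMap o hf x) Q⟩ with hζ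
  have hζc : Continuous ζ := by
    have h1 := continuous_w_normalGaussMap o hf P
    have h2 := continuous_w_normalGaussMap o hf Q
    exact Complex.equivRealProdCLM.symm.continuous.comp (h1.prodMk h2)
  have hnorm : ∀ x, c₀ < ‖ζ x‖ := by
    intro x
    refine lt_of_pow_lt_pow_left₀ 2 (norm_nonneg _) ?_
    rw [Complex.sq_norm, Complex.normSq_mk, ← sq, ← sq]
    exact hlow x
  -- The excluded half line together with the nonvanishing of ζ gives exactly the domain on which
  -- the argument is continuous.
  have hmem : ∀ x, ζ x ∈ Complex.slitPlane := by
    intro x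
    rw [Complex.mem_slitPlane_iff]
    by_cases hQ : w (normalGaussMap o hf x) Q = 0
    · left
      have h1 : 0 ≤ w (normalGaussMap o hf x) P := not_lt.1 fun h => hslit ⟨x, hQ, h⟩
      refine lt_of_le_of_ne h1 fun h => ?_
      have h2 := hlow x
      have h3 : w (normalGaussMap o hf x) P = 0 := h.symm
      rw [hQ, h3] at h2
      nlinarith [sq_nonneg c₀]
    · exact Or.inr hQ
  have hθc : Continuous fun x => Complex.arg (ζ x) :=
    continuous_iff_continuousAt.2 fun x =>
      (Complex.continuousAt_arg (hmem x)).comp hζc.continuousAt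
  have hRζ : ∀ β x, w (normalGaussMap o hf x) (R β) =
      ‖ζ x‖ * Real.cos (Complex.arg (ζ x) - β) := by
    intro β x
    have h1 := Complex.norm_mul_cos_arg (ζ x)
    have h2 := Complex.norm_mul_sin_arg (ζ x)
    rw [hR, Real.cos_sub]
    have h3 : (ζ x).re = w (normalGaussMap o hf x) P := rfl
    have h4 : (ζ x).im = w (normalGaussMap o hf x) Q := rfl
    rw [← h3, ← h4, ← h1, ← h2]
    ring
  obtain ⟨a, ha, haζ⟩ := isCompact_univ.exists_forall_le' (f := fun x => ‖ζ x‖) (a := c₀)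
    hζc.norm.continuousOn fun x _ => hnorm x
  -- Strictly above c₀, so that c is positive and the bound 1/9 becomes strict; strictly below every
  -- ‖ζ x‖, so that the angle arccos (c / r) is positive.
  set c := (c₀ + a) / 2 with hcdef
  have hc : 0 < c := by rw [hcdef]; linarith
  have hc9 : (∀ x, normalGaussRank o hf x ≤ 2) ∨ 1 / 9 < c ^ 2 := by
    refine h9.imp_right fun h => h.trans_lt ?_
    have : c₀ < c := by rw [hcdef]; linarith
    gcongr
  obtain ⟨β, hβ⟩ := exists_w_eq_const o hf hmin hθc hζc.norm hRζ hc
    (fun x => by have := haζ x (Set.mem_univ x); rw [hcdef]; linarith) hc9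
  refine secondFundamentalForm_eq_zero_of_w_eq (o := o) (hf := hf) (R β) hmin ?_ ?_
    (Filter.Eventually.of_forall fun y => by rw [hβ, hβ]) u v
  · rw [hβ]; exact hc.ne'
  · rw [hβ]
    exact hc9.imp_left fun h => h x

end Rigidity

end BernsteinSphere
end

open BernsteinSphere in
theorem mainTheorem3 {n m : ℕ} [NeZero n] [NeZero m] {M : Type*} [TopologicalSpace M]
    [T2Space M] [CompactSpace M] [ConnectedSpace M] [ChartedSpace (EuclideanSpace ℝ (Fin n)) M]
    [IsManifold (𝓡 n) ∞ M] (o : ManifoldOrientation n M)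
    (f : M → EuclideanSpace ℝ (Fin (n + m + 1))) (hf : IsSphereImmersion f)
    (hmin : ∀ x, meanCurvature f x = 0)
    (P Q : Grassmannian m (n + m + 1)) (hPQ : SOrthogonal P Q)
    (hlow : (∀ x, normalGaussRank o hf x ≤ 2) →
      ∀ x, 0 < w (normalGaussMap o hf x) P ^ 2 + w (normalGaussMap o hf x) Q ^ 2)
    (hhigh : ¬ (∀ x, normalGaussRank o hf x ≤ 2) →
      ∀ x, 1 / 9 < w (normalGaussMap o hf x) P ^ 2 + w (normalGaussMap o hf x) Q ^ 2)
    (hslit : ¬ ∃ x, w (normalGaussMap o hf x) Q = 0 ∧ w (normalGaussMap o hf x) P < 0) :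
    (∀ x u v, secondFundamentalForm f x u v = 0) ∧ IsEquator n (Set.range f) := by
  have hB : ∀ x u v, secondFundamentalForm f x u v = 0 := by
    by_cases hr : ∀ x, normalGaussRank o hf x ≤ 2
    · exact secondFundamentalForm_eq_zero_of_slit o hf hmin hPQ le_rfl (Or.inl hr)
        (fun x => by simpa using hlow hr x) hslit
    · exact secondFundamentalForm_eq_zero_of_slit o hf hmin hPQ (c₀ := 1 / 3) (by norm_num)
        (Or.inr (by norm_num)) (fun x => by
          have := hhigh hr x
          norm_num at this ⊢
          exact this) hslit
  exact ⟨hB, isEquator_range hf hB⟩
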